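/- **Setting.** Let $G$ be a finite abelian group (written additively), $\chi:G\times G\to\{z\in\mathbb C:|z|=1\}$ a nondegenerate symmetric bicharacter, $\tau=\pm|G|^{-1/2}$, and $\Omega=G\sqcup\{m\}$. For $g\in G$ let $H^g$ be the vector space with basis $v^g_k$ ($k\in G$), $v^g_m$; let $H^m$ have basis $v^m_k,\ v^m_{\overline k}$ ($k\in G$). Write $\Omega_x$ for the index set of the basis of $H^x$, so $\Omega_g=G\sqcup\{m\}$ and $\Omega_m=G\sqcup\overline G$. Define a bilinear product $\circ$ on $\bigoplus_{x\in\Omega}H^x$ by $$v^g_k\circ v^h_{h+k}=v^{g+h}_{h+k},\quad v^g_m\circ v^h_m=v^{g+h}_m,\quad v^m_k\circ v^g_m=\chi(g,k)v^m_k,\quad v^m_{\overline k}\circ v^g_{g+k}=v^m_{\overline{g+k}},$$ $$v^g_m\circ v^m_{\overline k}=\chi(g,k)v^m_{\overline k},\quad v^g_k\circ v^m_k=v^m_{k-g},\quad v^m_h\circ v^m_{\overline k}=v^{k-h}_k,\quad v^m_{\overline h}\circ v^m_h=\tau\sum_{g\in G}\chi(g,h)^{-1}v^g_m,$$ all other products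 of basis vectors being $0$. The *Tambara–Yamagami weak Hopf $C^*$-algebra* is $B=\bigoplus_{x\in\Omega}H^x\otimes\overline{H^x}$ with basis $f^x_{\alpha\beta}=v^x_\alpha\otimes\overline{v^x_\beta}$ ($x\in\Omega$, $\alpha,\beta\in\Omega_x$) and $$f^x_{\alpha\beta}f^y_{\gamma\delta}=\sum_{z\in\Omega}p_z(v^x_\alpha\circ v^y_\gamma)\otimes\overline{p_z(v^x_\beta\circ v^y_\delta)},\quad 1=\sum_{\alpha,\beta\in\Omega}f^0_{\alpha\beta},\quad \Delta(f^x_{\alpha\beta})=\sum_{\gamma\in\Omega_x}f^x_{\alpha\gamma}\otimes f^x_{\gamma\beta},\quad \varepsilon(f^x_{\alpha\beta})=\delta_{\alpha,\beta},$$ where $p_z$ is the projection onto $H^z$. Put $g^*=-g$ and $m^*=m$. For an index in $\Omega_g$ put $k^*=k-g$ and $m^*=m$; for an index in $\Omega_m$ put $k^*=\overline k$ and $\overline k^*=k$. Let $w(\overline k)=\tau$ and let $w=1$ on all other indices. The involution (conjugate linear) and the antipode (linear) are $$(f^x_{\alpha\beta})^*=\frac{w(\beta)}{w(\alpha)}f^{x^*}_{\alpha^*\beta^*},\qquad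 S(f^x_{\alpha\beta})=\frac{w(\alpha)}{w(\beta)}f^{x^*}_{\beta^*\alpha^*}.$$ **Quantum subgroupoids.** As a $C^*$-algebra $B=\bigoplus_{l\in G}B^l\oplus B^m$ with $B^l\cong M_{|G|+1}(\mathbb C)$ and $B^m\cong M_{2|G|}(\mathbb C)$. With suitable matrix units $e^l_{ab}$ ($a,b\in\Omega$) of $B^l$, $$f^p_{h,k}=e^{h-k}_{p-k,-k},\quad f^m_{h,k}=e^{h-k}_{-k,m},\quad f^m_{\overline h,\overline k}=e^{h-k}_{m,-k},\quad f^p_{m,m}=\sum_{l\in G}\chi(p,l)\,e^l_{m,m}\qquad(p,h,k\in G),$$ and the remaining $f^x_{\alpha\beta}$ span $B^m$. For a subgroup $L$ of $G$ let $\mathfrak G^L$ be the weak Hopf $C^*$-algebra $B_L=\bigoplus_{l\in L}B^l$ with (using the convention $m-l=m$) $$\Delta_L(e^l_{ab})=\sum_{l_1,l_2\in L,\ l_1+l_2=l}e^{l_1}_{a-l_2,b-l_2}\otimes e^{l_2}_{ab},\qquad S_L(e^l_{ab})=e^{-l}_{b-l,a-l},\qquad \varepsilon_L(e^l_{ab})=\delta_{l,0},$$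 and let $\pi^L:B\to B_L$ be the canonical projection, which is an epimorphism of weak Hopf $C^*$-algebras. Let also $(\mathfrak G^\Omega,\pi^\Omega)=(B,\mathrm{id})$. For $x=\Omega$, or $x$ a subgroup of $G$, the quotient type coideal of $(\mathfrak G^x,\pi^x)$ is $$I^x=\{b\in B:\ (\pi^x\otimes\mathrm{id})\Delta(b)=(\pi^x\otimes\mathrm{id})((1\otimes b)\Delta(1))\}.$$ **Coideals.** A coideal of $B$ is a unital $C^*$-subalgebra $I\subset B$ with $\Delta(I)\subset I\otimes B$. It is *invariant* if $I\triangleleft B=I$, where $I\triangleleft B$ is the linear span of the elements $b\triangleleft y:=S(y_{(1)})\,b\,y_{(2)}$ with $b\in I$, $y\in B$. **Proposition.** Let $I$ be an invariant coideal of $B$. Then $I=\bigoplus_{y\in\Omega}X^y\otimes\overline{H^y}$ for some linear subspaces $X^y\subset H^y$, and there is a unique $x\in\{L: L \text{ a subgroup of } G\}\sqcup\{\Omega\}$ such that $I=I^x$ (equality of subsets of $B$, not merely an isomorphism). -/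

import Mathlib

open scoped TensorProduct
universe u
set_option linter.all false

/-- A weak Hopf `C*`-algebra.  The coalgebra structure is Mathlib's `Coalgebra ℂ B`.  The `*`-algebra `B`
is a finite dimensional `C*`-algebra: it is finite dimensional and has a faithful
`*`-representation by complex matrices (for a finite dimensional `*`-algebra this is the same as
carrying a `C*`-norm). -/
class WeakHopfCStarAlgebra (B : Type*) [Ring B] [StarRing B] [Algebra ℂ B] [StarModule ℂ B]
    extends Coalgebra ℂ B where
  finiteDimensional : FiniteDimensional ℂ B
  exists_faithful : ∃ (n : ℕ) (ρ : B →⋆ₐ[ℂ] Matrix (Fin n) (Fin n) ℂ), Function.Injective ρ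
  /-- `Δ` is a homomorphism, not necessarily unital. -/
  comul_mul (b c : B) : comul (b * c) = comul b * comul c
  /-- `Δ(b*) = Δ(b)*`. -/
  comul_star (b : B) : comul (star b) = star (comul b)
  /-- `ε(b c₍₁₎) ε(c₍₂₎ d) = ε(b c d)`. -/
  counit_mul_mul (b c d : B) :
    LinearMap.mul' ℂ ℂ (TensorProduct.map (counit ∘ₗ LinearMap.mulLeft ℂ b)
      (counit ∘ₗ LinearMap.mulRight ℂ d) (comul c)) = counit (b * c * d)
  /-- `(Δ(1) ⊗ 1) (1 ⊗ Δ(1)) = (Δ ⊗ id) Δ(1)`. -/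
  comul_one_mul :
    (comul 1 ⊗ₜ[ℂ] (1 : B)) * (TensorProduct.assoc ℂ B B B).symm ((1 : B) ⊗ₜ[ℂ] comul 1) =
      comul.rTensor B (comul 1)
  /-- The antipode: an anti-algebra and anti-coalgebra map. -/
  antipode : B →ₗ[ℂ] B
  antipode_one : antipode 1 = 1
  antipode_mul (b c : B) : antipode (b * c) = antipode c * antipode b
  counit_antipode (b : B) : counit (antipode b) = counit b
  comul_antipode (b : B) :
    comul (antipode b) = TensorProduct.map antipode antipode (TensorProduct.comm ℂ B B (comul b))
  /-- `m (id ⊗ S) Δ(b) = (ε ⊗ id) (Δ(1) (b ⊗ 1))`. -/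
  mul_antipode_right (b : B) :
    LinearMap.mul' ℂ B (antipode.lTensor B (comul b)) =
      TensorProduct.lid ℂ B (counit.rTensor B (comul 1 * (b ⊗ₜ[ℂ] (1 : B))))
  /-- `m (S ⊗ id) Δ(b) = (id ⊗ ε) ((1 ⊗ b) Δ(1))`. -/
  mul_antipode_left (b : B) :
    LinearMap.mul' ℂ B (antipode.rTensor B (comul b)) =
      TensorProduct.rid ℂ B (counit.lTensor B (((1 : B) ⊗ₜ[ℂ] b) * comul 1))

namespace WeakHopfCStarAlgebra
open CoalgebraStruct
variable {B : Type u} [Ring B] [StarRing B] [Algebra ℂ B] [StarModule ℂ B] [WeakHopfCStarAlgebra B]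

/-- The right adjoint action `b ◁ x = S(x₍₁₎) b x₍₂₎`. -/
noncomputable def adjointAction (b x : B) : B :=
  LinearMap.mul' ℂ B (TensorProduct.map antipode (LinearMap.mulLeft ℂ b) (comul (R := ℂ) x))

/-- A unital `C*`-subalgebra `I` of `B` (that is, a unital `*`-subalgebra, as `B` is finite dimensional)
is a (right) coideal if `Δ(I) ⊆ I ⊗ B`. -/
def IsCoideal (I : StarSubalgebra ℂ B) : Prop :=
  ∀ b ∈ I, comul (R := ℂ) b ∈
    LinearMap.range (TensorProduct.map (Subalgebra.toSubmodule I.toSubalgebra).subtype (LinearMap.id : B →ₗ[ℂ] B))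

/-- A coideal `I` is invariant if `I ◁ B = I`, where `I ◁ B` is the linear span of all `b ◁ x` with
`b ∈ I`, `x ∈ B`. -/
def IsInvariant (I : StarSubalgebra ℂ B) : Prop :=
  Submodule.span ℂ {c : B | ∃ b ∈ I, ∃ x : B, c = adjointAction b x} = Subalgebra.toSubmodule I.toSubalgebra

/-- A quantum subgroupoid of `B`: a weak Hopf `C*`-algebra `carrier` together with an epimorphism
`proj : B → carrier` of weak Hopf `C*`-algebras (a surjective unital `*`-homomorphism that respects the
coproduct, the counit and the antipode). -/
structure QuantumSubgroupoid (B : Type u) [Ring B] [StarRing B] [Algebra ℂ B] [StarModule ℂ B]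
    [WeakHopfCStarAlgebra B] where
  carrier : Type u
  [ring : Ring carrier]
  [starRing : StarRing carrier]
  [algebra : Algebra ℂ carrier]
  [starModule : StarModule ℂ carrier]
  [weakHopf : WeakHopfCStarAlgebra carrier]
  proj : B →⋆ₐ[ℂ] carrier
  surjective : Function.Surjective proj
  comul_proj (b : B) : comul (R := ℂ) (proj b) =
    Algebra.TensorProduct.map (proj : B →ₐ[ℂ] carrier) (proj : B →ₐ[ℂ] carrier) (comul (R := ℂ) b)
  counit_proj (b : B) : counit (R := ℂ) (proj b) = counit (R := ℂ) b
  antipode_proj (b : B) : antipode (proj b) = proj (antipode b)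

attribute [instance] QuantumSubgroupoid.ring QuantumSubgroupoid.starRing QuantumSubgroupoid.algebra
  QuantumSubgroupoid.starModule QuantumSubgroupoid.weakHopf

/-- The quotient type coideal `{b | (π ⊗ id) Δ(b) = (π ⊗ id) ((1 ⊗ b) Δ(1))}` of a quantum subgroupoid
`(H, π)` of `B`: the fixed points of the left coaction `(π ⊗ id) Δ`. -/
def quotientTypeCoideal (H : QuantumSubgroupoid B) : Set B :=
  {b | Algebra.TensorProduct.map (H.proj : B →ₐ[ℂ] H.carrier) (AlgHom.id ℂ B) (comul (R := ℂ) b) =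
    Algebra.TensorProduct.map (H.proj : B →ₐ[ℂ] H.carrier) (AlgHom.id ℂ B) ((1 ⊗ₜ[ℂ] b) * comul (R := ℂ) 1)}
end WeakHopfCStarAlgebra

namespace TambaraYamagami

/-- The data of a Tambara-Yamagami `C*`-category over the finite abelian group `G`: a nondegenerate
symmetric bicharacter `χ` with values in the unit circle, and `τ = ± |G|^{-1/2}`. -/
structure Datum (G : Type u) [AddCommGroup G] [Fintype G] where
  χ : G → G → ℂ
  norm_χ : ∀ g h, ‖χ g h‖ = 1
  χ_add_left : ∀ g h k, χ (g + h) k = χ g k * χ h k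
  χ_symm : ∀ g h, χ g h = χ h g
  nondegenerate : ∀ g, (∀ h, χ g h = 1) → g = 0
  τ : ℝ
  τ_eq : τ = 1 / √(Fintype.card G) ∨ τ = -(1 / √(Fintype.card G))

/-- The set `Ω` of simple objects is `Option G`: `some g` is the group element `g` and `none` is the
object `m`.  `Idx G x` is the index set `Ω_x` of the basis `(v^x_α)` of `H^x`.
For `x = g ∈ G` it is `G ⊔ {m}`, with `pt k = k` and `pm = m`;
for `x = m` it is `G ⊔ Ḡ`, with `el k = k` and `bar k = k̄`. -/
inductive Idx (G : Type u) : Option G → Type u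
  | pt {g : G} (k : G) : Idx G (some g)
  | pm {g : G} : Idx G (some g)
  | el (k : G) : Idx G none
  | bar (k : G) : Idx G none
  deriving DecidableEq

namespace Idx
def equivSome {G : Type u} (g : G) : Idx G (some g) ≃ Option G where
  toFun | .pt k => some k
        | .pm => none
  invFun | some k => .pt k
         | none => .pm
  left_inv := by rintro (_ | _) <;> rfl
  right_inv := by rintro (_ | _) <;> rfl
def equivNone {G : Type u} : Idx G none ≃ G ⊕ G where
  toFun | .el k => .inl k
        | .bar k => .inr k
  invFun | .inl k => .el k
         | .inr k => .bar k
  left_inv := by rintro (_ | _) <;> rfl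
  right_inv := by rintro (_ | _) <;> rfl
instance {G : Type u} [Fintype G] : (x : Option G) → Fintype (Idx G x)
  | some g => Fintype.ofEquiv _ (equivSome g).symm
  | none => Fintype.ofEquiv _ equivNone.symm
end Idx
open Idx

theorem sum_some {M : Type*} [AddCommMonoid M] {G : Type u} [Fintype G] (g : G) (F : Idx G (some g) → M) : ∑ α, F α = F .pm + ∑ k : G, F (.pt k) := by
  rw [← Equiv.sum_comp (equivSome g).symm, Fintype.sum_option]; rfl
theorem sum_none {M : Type*} [AddCommMonoid M] {G : Type u} [Fintype G] (F : Idx G none → M) : ∑ α, F α = ∑ k : G, F (.el k) + ∑ k : G, F (.bar k) := by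
  rw [← Equiv.sum_comp (equivNone).symm, Fintype.sum_sum_type]; rfl

variable {G : Type u} [AddCommGroup G] [Fintype G] [DecidableEq G] (D : Datum G)

/-- The set of all basis vectors of `⨁ₓ H^x`: `pt g k` is `v^g_k`, `pm g` is `v^g_m`, `el k` is `v^m_k`
and `bar k` is `v^m_k̄`. -/
inductive Vec (G : Type u)
  | pt (g k : G)
  | pm (g : G)
  | el (k : G)
  | bar (k : G)

/-- The basis vector `v^x_α`. -/
def Idx.vec {G : Type u} : {x : Option G} → Idx G x → Vec G
  | _, .pt (g := g) k => .pt g k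
  | _, .pm (g := g) => .pm g
  | _, .el k => .el k
  | _, .bar k => .bar k

/-- `circVec D u v w` is the coefficient of the basis vector `w` in the product `u ∘ v`, where
* `v^g_k ∘ v^h_a = δ_{a,h+k} v^{g+h}_{h+k}` and `v^g_m ∘ v^h_m = v^{g+h}_m`,
* `v^m_k ∘ v^g_m = χ(g,k) v^m_k` and `v^m_k̄ ∘ v^g_a = δ_{a,g+k} v^m_{(g+k)‾}`,
* `v^g_m ∘ v^m_k̄ = χ(g,k) v^m_k̄` and `v^g_a ∘ v^m_k = δ_{a,k} v^m_{k-g}`,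
* `v^m_h ∘ v^m_k̄ = v^{k-h}_k` and `v^m_h̄ ∘ v^m_k = δ_{h,k} τ ∑_p χ(p,h)⁻¹ v^p_m`,

and all other products of basis vectors vanish. -/
noncomputable def circVec : Vec G → Vec G → Vec G → ℂ
  | .pt g k, .pt h a, .pt p b => if p = g + h ∧ a = h + k ∧ b = h + k then 1 else 0
  | .pm g, .pm h, .pm p => if p = g + h then 1 else 0
  | .el k, .pm g, .el b => if b = k then D.χ g k else 0
  | .bar k, .pt g a, .bar b => if a = g + k ∧ b = g + k then 1 else 0
  | .pm g, .bar k, .bar b => if b = k then D.χ g k else 0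
  | .pt g a, .el k, .el b => if a = k ∧ b = k - g then 1 else 0
  | .el h, .bar k, .pt p b => if p = k - h ∧ b = k then 1 else 0
  | .bar h, .el k, .pm p => if h = k then D.τ * (D.χ p h)⁻¹ else 0
  | _, _, _ => 0

/-- The coefficient of `v^z_μ` in `v^x_α ∘ v^y_γ`. -/
noncomputable def circ (x y z : Option G) (α : Idx G x) (γ : Idx G y) (μ : Idx G z) : ℂ := circVec D α.vec γ.vec μ.vec

/-- The vector space `B = ⨁ₓ H^x ⊗ conj(H^x)`, in coordinates with respect to its basis
`f^x_{αβ} = v^x_α ⊗ conj(v^x_β)`. -/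
def Alg (_D : Datum G) : Type u := (Σ x : Option G, Idx G x × Idx G x) → ℂ

noncomputable instance : AddCommGroup (Alg D) := inferInstanceAs (AddCommGroup (_ → ℂ))
noncomputable instance : Module ℂ (Alg D) := inferInstanceAs (Module ℂ (_ → ℂ))

/-- The basis `(f^x_{αβ})` of `B`. -/
noncomputable def basis : Module.Basis (Σ x : Option G, Idx G x × Idx G x) ℂ (Alg D) :=
  Module.Basis.ofEquivFun (LinearEquiv.refl ℂ (_ → ℂ))

/-- The basis vector `f^x_{αβ}` of `B`. -/
noncomputable abbrev f (x : Option G) (α β : Idx G x) : Alg D := basis D ⟨x, α, β⟩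

/-- The coefficient of `f^x_{αβ}` in `a`. -/
noncomputable abbrev cf (a : Alg D) (x : Option G) (α β : Idx G x) : ℂ := (basis D).repr a ⟨x, α, β⟩

/-- The product of `B`: `f^x_{αβ} f^y_{γδ} = (v^x_α ∘ v^y_γ) ⊗ conj(v^x_β ∘ v^y_δ)`, where only the
components in the same summand `H^z ⊗ conj(H^z)` are paired.  See `f_mul_f` for the value on the basis. -/
noncomputable instance : Mul (Alg D) where
  mul a b := ∑ x, ∑ y, ∑ z, ∑ μ, ∑ ν, (∑ α, ∑ γ, circ D x y z α γ μ * ∑ β, ∑ δ,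
    star (circ D x y z β δ ν) * (cf D a x α β * cf D b y γ δ)) • f D z μ ν

theorem mul_def (a b : Alg D) (z) (μ ν) : cf D (a * b) z μ ν = ∑ x, ∑ y, ∑ α, ∑ γ, circ D x y z α γ μ * ∑ β, ∑ δ,
    star (circ D x y z β δ ν) * (cf D a x α β * cf D b y γ δ) := by
  change cf D (∑ x, ∑ y, ∑ z, ∑ μ, ∑ ν, _) _ _ _ = _
  simp only [cf, f, map_sum, Finsupp.coe_finsetSum, Finset.sum_apply, map_smul, Finsupp.smul_apply,
    Module.Basis.repr_self, smul_eq_mul, Finsupp.single_apply]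
  refine Finset.sum_congr rfl fun x _ => Finset.sum_congr rfl fun y _ => ?_
  rw [Finset.sum_eq_single z]
  rotate_left
  · intro z' _ hz
    refine Finset.sum_eq_zero fun _ _ => Finset.sum_eq_zero fun _ _ => ?_
    rw [if_neg, mul_zero]
    rintro h; exact hz (congrArg Sigma.fst h)
  · simp
  rw [Finset.sum_eq_single μ]
  rotate_left
  · intro z' _ hz
    refine Finset.sum_eq_zero fun _ _ => ?_
    rw [if_neg, mul_zero]
    rintro h; simp at h; exact hz h.1
  · simp
  rw [Finset.sum_eq_single ν]
  · simp
  · intro z' _ hz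
    rw [if_neg, mul_zero]
    rintro h; simp at h; exact hz h
  · simp

section circ
variable (g h p k : G)
theorem circ_sss (F : Idx G (some g) → Idx G (some h) → ℂ) :
    ∑ α, ∑ γ, circ D (some g) (some h) (some p) α γ (.pt k) * F α γ =
      if g = p - h then F (.pt (k - h)) (.pt k) else 0 := by
  have h1 : ∀ x, k = h + x ↔ x = k - h := fun x => by grind
  have h2 : p = g + h ↔ g = p - h := by grind
  simp [sum_some, sum_none, circ, circVec, vec, ite_and, h1, h2]
theorem circ_ssn (F : Idx G (some g) → Idx G (some h) → ℂ) :
    ∑ α, ∑ γ, circ D (some g) (some h) (some p) α γ .pm * F α γ =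
      if g = p - h then F .pm .pm else 0 := by
  simp [sum_some, sum_none, circ, circVec, vec, eq_sub_iff_add_eq, eq_comm]
theorem circ_mms (F : Idx G none → Idx G none → ℂ) :
    ∑ α, ∑ γ, circ D none none (some p) α γ (.pt k) * F α γ =
      F (.el (k - p)) (.bar k) := by
  have h1 : ∀ x y, p = y - x ↔ x = y - p := fun x y => by grind
  rw [Finset.sum_comm]
  simp [sum_some, sum_none, circ, circVec, vec, ite_and, h1]
theorem circ_mmn (F : Idx G none → Idx G none → ℂ) :
    ∑ α, ∑ γ, circ D none none (some p) α γ .pm * F α γ =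
      ∑ h, D.τ * (D.χ p h)⁻¹ * F (.bar h) (.el h) := by
  simp [sum_some, sum_none, circ, circVec, vec]
theorem circ_msl (F : Idx G none → Idx G (some g) → ℂ) :
    ∑ α, ∑ γ, circ D none (some g) none α γ (.el k) * F α γ =
      D.χ g k * F (.el k) .pm := by
  simp [sum_some, sum_none, circ, circVec, vec]
theorem circ_msr (F : Idx G none → Idx G (some g) → ℂ) :
    ∑ α, ∑ γ, circ D none (some g) none α γ (.bar k) * F α γ =
      F (.bar (k - g)) (.pt k) := by
  have h1 : ∀ x, k = g + x ↔ x = k - g := fun x => by grind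
  simp [sum_some, sum_none, circ, circVec, vec, ite_and, h1]
theorem circ_sml (F : Idx G (some g) → Idx G none → ℂ) :
    ∑ α, ∑ γ, circ D (some g) none none α γ (.el k) * F α γ =
      F (.pt (k + g)) (.el (k + g)) := by
  have h1 : ∀ x, k = x - g ↔ x = k + g := fun x => by grind
  simp [sum_some, sum_none, circ, circVec, vec, ite_and, h1]
theorem circ_smr (F : Idx G (some g) → Idx G none → ℂ) :
    ∑ α, ∑ γ, circ D (some g) none none α γ (.bar k) * F α γ =
      D.χ g k * F .pm (.bar k) := by
  simp [sum_some, sum_none, circ, circVec, vec]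
theorem circ_ssm (μ : Idx G none) (α : Idx G (some g)) (γ : Idx G (some h)) :
    circ D (some g) (some h) none α γ μ = 0 := by
  rcases α with _ | _ <;> rcases γ with _ | _ <;> rcases μ with _ | _ <;> rfl
theorem circ_mmm (μ α γ : Idx G none) :
    circ D none none none α γ μ = 0 := by
  rcases α with _ | _ <;> rcases γ with _ | _ <;> rcases μ with _ | _ <;> rfl
theorem circ_mss (μ : Idx G (some g)) (α : Idx G none) (γ : Idx G (some h)) :
    circ D none (some h) (some g) α γ μ = 0 := by
  rcases α with _ | _ <;> rcases γ with _ | _ <;> rcases μ with _ | _ <;> rfl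
theorem circ_sms (μ : Idx G (some g)) (γ : Idx G none) (α : Idx G (some h)) :
    circ D (some h) none (some g) α γ μ = 0 := by
  rcases α with _ | _ <;> rcases γ with _ | _ <;> rcases μ with _ | _ <;> rfl

def Datum.conj {G : Type u} [AddCommGroup G] [Fintype G] (D : Datum G) : Datum G where
  χ g h := star (D.χ g h)
  norm_χ g h := by simp [D.norm_χ]
  χ_add_left g h k := by simp [D.χ_add_left, mul_comm]
  χ_symm g h := by rw [D.χ_symm]
  nondegenerate g h := D.nondegenerate g fun k => by simpa using congrArg star (h k)
  τ := D.τ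
  τ_eq := D.τ_eq

theorem star_circ (x y z : Option G) (α γ μ) : star (circ D x y z α γ μ) = circ D.conj x y z α γ μ := by
  rcases x with _ | x <;> rcases y with _ | y <;> rcases z with _ | z <;> rcases α with _ | α <;>
    rcases γ with _ | γ <;> rcases μ with _ | μ <;> simp [circ, circVec, vec, Datum.conj, apply_ite star]


theorem chi_ne_zero : D.χ g h ≠ 0 := by
  intro h0; have := D.norm_χ g h; simp [h0] at this
theorem star_chi : star (D.χ g h) = (D.χ g h)⁻¹ := by
  apply eq_inv_of_mul_eq_one_left
  have := Complex.conj_mul' (D.χ g h)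
  rw [D.norm_χ] at this
  simpa using this
theorem inv_star : (star (D.χ g h))⁻¹ = D.χ g h := by
  rw [star_chi, inv_inv]
theorem tau_conj : D.conj.τ = D.τ := rfl
theorem chi_conj : D.conj.χ g h = star (D.χ g h) := rfl

theorem sum_split (T : Option G → Option G → ℂ) : ∑ x, ∑ y, T x y =
    T none none + ∑ h, T none (some h) + (∑ g, T (some g) none + ∑ g, ∑ h, T (some g) (some h)) := by
  simp [Fintype.sum_option, Finset.sum_add_distrib]; ring

theorem cf_mul (a b : Alg D) (z) (μ ν) : cf D (a * b) z μ ν =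
   (∑ α, ∑ γ, circ D none none z α γ μ * ∑ β, ∑ δ,
    circ D.conj none none z β δ ν * (cf D a none α β * cf D b none γ δ)) +
    ∑ h, (∑ α, ∑ γ, circ D none (some h) z α γ μ * ∑ β, ∑ δ,
    circ D.conj none (some h) z β δ ν * (cf D a none α β * cf D b (some h) γ δ)) +
    (∑ g, (∑ α, ∑ γ, circ D (some g) none z α γ μ * ∑ β, ∑ δ,
    circ D.conj (some g) none z β δ ν * (cf D a (some g) α β * cf D b none γ δ)) +
    ∑ g, ∑ h, (∑ α, ∑ γ, circ D (some g) (some h) z α γ μ * ∑ β, ∑ δ,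
    circ D.conj (some g) (some h) z β δ ν * (cf D a (some g) α β * cf D b (some h) γ δ)))
     := by
  rw [mul_def]; simp only [star_circ]; rw [sum_split]

theorem sum_ite2 (F : G → G → ℂ) : ∑ g, ∑ q, (if g = p - q then F g q else 0) = ∑ q, F (p - q) q := by
  rw [Finset.sum_comm]; simp


variable (a b : Alg D)
/- The coordinates of an element of `B`, by type of the pair of indices. -/
noncomputable def Alg.tt (a : Alg D) (p h k : G) : ℂ := cf D a (some p) (.pt h) (.pt k)
noncomputable def Alg.tm (a : Alg D) (p h : G) : ℂ := cf D a (some p) (.pt h) .pm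
noncomputable def Alg.mt (a : Alg D) (p k : G) : ℂ := cf D a (some p) .pm (.pt k)
noncomputable def Alg.mm (a : Alg D) (p : G) : ℂ := cf D a (some p) .pm .pm
noncomputable def Alg.ee (a : Alg D) (h k : G) : ℂ := cf D a none (.el h) (.el k)
noncomputable def Alg.eb (a : Alg D) (h k : G) : ℂ := cf D a none (.el h) (.bar k)
noncomputable def Alg.be (a : Alg D) (h k : G) : ℂ := cf D a none (.bar h) (.el k)
noncomputable def Alg.bb (a : Alg D) (h k : G) : ℂ := cf D a none (.bar h) (.bar k)

theorem mul_tt : (a * b).tt D p h k =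
     a.ee D (h - p) (k - p) * b.bb D h k
     + ∑ q : G, a.tt D (p - q) (h - q) (k - q) * b.tt D q h k := by
  refine (cf_mul D a b _ _ _).trans ?_
  simp only [circ_mss, circ_sms, zero_mul, Finset.sum_const_zero, add_zero, zero_add, circ_sss, circ_mms,
    ← ite_and, and_self]
  rw [sum_ite2]; rfl
theorem mul_tm : (a * b).tm D p h =
     ∑ k, D.τ * D.χ p k * (a.eb D (h - p) k * b.be D h k)
     + ∑ q : G, a.tm D (p - q) (h - q) * b.tm D q h := by
  refine (cf_mul D a b _ _ _).trans ?_
  simp only [circ_mss, circ_sms, zero_mul, Finset.sum_const_zero, add_zero, zero_add, circ_sss, circ_mms,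
    circ_mmn, circ_ssn, ← ite_and, and_self, chi_conj, tau_conj, inv_star]
  rw [sum_ite2]; rfl
theorem mul_mt : (a * b).mt D p k =
     ∑ h, D.τ * (D.χ p h)⁻¹ * (a.be D h (k - p) * b.eb D h k)
     + ∑ q : G, a.mt D (p - q) (k - q) * b.mt D q k := by
  refine (cf_mul D a b _ _ _).trans ?_
  simp only [circ_mss, circ_sms, zero_mul, Finset.sum_const_zero, add_zero, zero_add, circ_sss, circ_mms,
    circ_mmn, circ_ssn, ← ite_and, and_self, chi_conj, tau_conj, inv_star]
  rw [sum_ite2]; rfl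
theorem mul_mm : (a * b).mm D p =
     ∑ h, D.τ * (D.χ p h)⁻¹ * ∑ k, D.τ * D.χ p k * (a.bb D h k * b.ee D h k)
     + ∑ q : G, a.mm D (p - q) * b.mm D q := by
  refine (cf_mul D a b _ _ _).trans ?_
  simp only [circ_mss, circ_sms, zero_mul, Finset.sum_const_zero, add_zero, zero_add, circ_sss, circ_mms,
    circ_mmn, circ_ssn, ← ite_and, and_self, chi_conj, tau_conj, inv_star]
  rw [sum_ite2]; rfl
theorem mul_ee : (a * b).ee D h k =
     ∑ g, D.χ g h * ((D.χ g k)⁻¹ * (a.ee D h k * b.mm D g))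
     + ∑ g, a.tt D g (h + g) (k + g) * b.ee D (h + g) (k + g) := by
  refine (cf_mul D a b _ _ _).trans ?_
  simp only [circ_mmm, circ_ssm, zero_mul, Finset.sum_const_zero, add_zero, zero_add, circ_msl, circ_msr,
    circ_sml, circ_smr, chi_conj, star_chi]
  rfl
theorem mul_eb : (a * b).eb D h k =
     ∑ g, D.χ g h * (a.eb D h (k - g) * b.mt D g k)
     + ∑ g, (D.χ g k)⁻¹ * (a.tm D g (h + g) * b.eb D (h + g) k) := by
  refine (cf_mul D a b _ _ _).trans ?_
  simp only [circ_mmm, circ_ssm, zero_mul, Finset.sum_const_zero, add_zero, zero_add, circ_msl, circ_msr,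
    circ_sml, circ_smr, chi_conj, star_chi]
  rfl
theorem mul_be : (a * b).be D h k =
     ∑ g, (D.χ g k)⁻¹ * (a.be D (h - g) k * b.tm D g h)
     + ∑ g, D.χ g h * (a.mt D g (k + g) * b.be D h (k + g)) := by
  refine (cf_mul D a b _ _ _).trans ?_
  simp only [circ_mmm, circ_ssm, zero_mul, Finset.sum_const_zero, add_zero, zero_add, circ_msl, circ_msr,
    circ_sml, circ_smr, chi_conj, star_chi]
  rfl
theorem mul_bb : (a * b).bb D h k =
     ∑ g, (a.bb D (h - g) (k - g) * b.tt D g h k)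
     + ∑ g, D.χ g h * ((D.χ g k)⁻¹ * (a.mm D g * b.bb D h k)) := by
  refine (cf_mul D a b _ _ _).trans ?_
  simp only [circ_mmm, circ_ssm, zero_mul, Finset.sum_const_zero, add_zero, zero_add, circ_msl, circ_msr,
    circ_sml, circ_smr, chi_conj, star_chi]
  rfl
end circ
end TambaraYamagami

namespace TambaraYamagami
open Idx
variable {G : Type u} [AddCommGroup G] [Fintype G] [DecidableEq G] (D : Datum G)

theorem cf_f (x y : Option G) (α β : Idx G x) (μ ν : Idx G y) :
    cf D (f D x α β) y μ ν = if (⟨x, α, β⟩ : Σ x : Option G, Idx G x × Idx G x) = ⟨y, μ, ν⟩ then 1 else 0 := by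
  simp [cf, f, Finsupp.single_apply]

/-- The unit `∑ f^0_{αβ}` of `B`. -/
noncomputable instance : One (Alg D) where
  one := ∑ α, ∑ β, f D (some 0) α β

theorem cf_one (y : Option G) (μ ν : Idx G y) :
    cf D 1 y μ ν = if y = some 0 then 1 else 0 := by
  change cf D (∑ α, ∑ β, f D (some 0) α β) y μ ν = _
  have : cf D (∑ α, ∑ β, f D (some 0) α β) y μ ν = ∑ α, ∑ β, cf D (f D (some 0) α β) y μ ν := by
    simp [cf]
  rw [this]
  simp only [cf_f]
  split_ifs with h
  · subst h
    simp [ite_and]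
  · refine Finset.sum_eq_zero fun α _ => Finset.sum_eq_zero fun β _ => if_neg fun h' => h ?_
    exact (congrArg Sigma.fst h').symm

section
variable (a b : Alg D) (c : ℂ) (g h k p : G)
theorem ext8 {a b : Alg D} (h1 : ∀ p h k, a.tt D p h k = b.tt D p h k)
    (h2 : ∀ p h, a.tm D p h = b.tm D p h) (h3 : ∀ p h, a.mt D p h = b.mt D p h)
    (h4 : ∀ p, a.mm D p = b.mm D p) (h5 : ∀ h k, a.ee D h k = b.ee D h k)
    (h6 : ∀ h k, a.eb D h k = b.eb D h k) (h7 : ∀ h k, a.be D h k = b.be D h k)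
    (h8 : ∀ h k, a.bb D h k = b.bb D h k) : a = b := by
  apply (basis D).repr.injective
  ext ⟨x, α, β⟩
  cases α <;> cases β
  · apply h1
  · apply h2
  · apply h3
  · apply h4
  · apply h5
  · apply h6
  · apply h7
  · apply h8

theorem add_tt : (a + b).tt D p h k = a.tt D p h k + b.tt D p h k := by simp [Alg.tt, cf]
theorem add_tm : (a + b).tm D p h = a.tm D p h + b.tm D p h := by simp [Alg.tm, cf]
theorem add_mt : (a + b).mt D p h = a.mt D p h + b.mt D p h := by simp [Alg.mt, cf]
theorem add_mm : (a + b).mm D p = a.mm D p + b.mm D p := by simp [Alg.mm, cf]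
theorem add_ee : (a + b).ee D p h = a.ee D p h + b.ee D p h := by simp [Alg.ee, cf]
theorem add_eb : (a + b).eb D p h = a.eb D p h + b.eb D p h := by simp [Alg.eb, cf]
theorem add_be : (a + b).be D p h = a.be D p h + b.be D p h := by simp [Alg.be, cf]
theorem add_bb : (a + b).bb D p h = a.bb D p h + b.bb D p h := by simp [Alg.bb, cf]
theorem smul_tt : (c • b).tt D p h k = c * b.tt D p h k := by simp [Alg.tt, cf]
theorem smul_tm : (c • b).tm D p h = c * b.tm D p h := by simp [Alg.tm, cf]
theorem smul_mt : (c • b).mt D p h = c * b.mt D p h := by simp [Alg.mt, cf]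
theorem smul_mm : (c • b).mm D p = c * b.mm D p := by simp [Alg.mm, cf]
theorem smul_ee : (c • b).ee D p h = c * b.ee D p h := by simp [Alg.ee, cf]
theorem smul_eb : (c • b).eb D p h = c * b.eb D p h := by simp [Alg.eb, cf]
theorem smul_be : (c • b).be D p h = c * b.be D p h := by simp [Alg.be, cf]
theorem smul_bb : (c • b).bb D p h = c * b.bb D p h := by simp [Alg.bb, cf]
theorem one_tt : (1 : Alg D).tt D p h k = if p = 0 then 1 else 0 := by simp [Alg.tt, cf_one]
theorem one_tm : (1 : Alg D).tm D p h = if p = 0 then 1 else 0 := by simp [Alg.tm, cf_one]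
theorem one_mt : (1 : Alg D).mt D p h = if p = 0 then 1 else 0 := by simp [Alg.mt, cf_one]
theorem one_mm : (1 : Alg D).mm D p = if p = 0 then 1 else 0 := by simp [Alg.mm, cf_one]
theorem one_ee : (1 : Alg D).ee D p h = 0 := by simp [Alg.ee, cf_one]
theorem one_eb : (1 : Alg D).eb D p h = 0 := by simp [Alg.eb, cf_one]
theorem one_be : (1 : Alg D).be D p h = 0 := by simp [Alg.be, cf_one]
theorem one_bb : (1 : Alg D).bb D p h = 0 := by simp [Alg.bb, cf_one]

/- characters -/
theorem chi_add_right : D.χ g (h + k) = D.χ g h * D.χ g k := by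
  rw [D.χ_symm, D.χ_add_left, D.χ_symm h, D.χ_symm k]
theorem chi_zero_left : D.χ 0 h = 1 := by
  have := D.χ_add_left 0 0 h
  rw [add_zero] at this
  exact (mul_eq_left₀ (chi_ne_zero D 0 h)).1 this.symm
theorem chi_zero_right : D.χ h 0 = 1 := by rw [D.χ_symm, chi_zero_left]
theorem chi_neg_left : D.χ (-g) h = (D.χ g h)⁻¹ := by
  apply eq_inv_of_mul_eq_one_left
  rw [← D.χ_add_left, neg_add_cancel, chi_zero_left]
theorem chi_neg_right : D.χ g (-h) = (D.χ g h)⁻¹ := by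
  rw [D.χ_symm, chi_neg_left, D.χ_symm]
theorem chi_sub_left : D.χ (g - h) k = D.χ g k * (D.χ h k)⁻¹ := by
  rw [sub_eq_add_neg, D.χ_add_left, chi_neg_left]
theorem chi_sub_right : D.χ g (h - k) = D.χ g h * (D.χ g k)⁻¹ := by
  rw [sub_eq_add_neg, chi_add_right, chi_neg_right]
theorem sum_chi : ∑ p, D.χ p g = if g = 0 then (Fintype.card G : ℂ) else 0 := by
  split_ifs with hg
  · simp [hg, chi_zero_right]
  · obtain ⟨x, hx⟩ : ∃ x, D.χ g x ≠ 1 := by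
      by_contra! H
      exact hg (D.nondegenerate g H)
    have : D.χ x g * ∑ p, D.χ p g = ∑ p, D.χ p g := by
      rw [Finset.mul_sum]
      refine Fintype.sum_equiv (Equiv.addLeft x) _ _ fun p => ?_
      simp [D.χ_add_left]
    rw [D.χ_symm] at hx
    have h2 : (D.χ x g - 1) * ∑ p, D.χ p g = 0 := by rw [sub_mul, this]; ring
    exact (mul_eq_zero.1 h2).resolve_left (sub_ne_zero.2 hx)
theorem tau_sq : (D.τ : ℂ) * D.τ * Fintype.card G = 1 := by
  have hc : (0 : ℝ) < Fintype.card G := by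
    exact_mod_cast Fintype.card_pos
  have : D.τ * D.τ * Fintype.card G = 1 := by
    rcases D.τ_eq with h | h <;> rw [h] <;> field_simp <;> rw [Real.sq_sqrt hc.le]
  exact_mod_cast this
theorem tau_ne_zero : (D.τ : ℂ) ≠ 0 := by
  intro h; simpa [h] using tau_sq D

theorem sum_tau_chi : ∑ p, (D.τ : ℂ) * D.τ * D.χ p g = if g = 0 then 1 else 0 := by
  rw [← Finset.mul_sum, sum_chi]; split_ifs <;> simp [tau_sq]

/-- `B` is the direct sum of full matrix algebras `B^l` (`l ∈ G`) of size `|G| + 1`, with matrix units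
`e^l_{ij}`, `i, j ∈ G ⊔ {m}`, and of one block `B^m` of size `2|G|`.  In terms of these
`f^p_{h,k} = e^{h-k}_{p-k,-k}`, `f^m_{h,k} = e^{h-k}_{-k,m}`, `f^m_{h̄,k̄} = e^{h-k}_{m,-k}`,
`f^p_{m,m} = ∑_l χ(p,l) e^l_{m,m}`, while the remaining `f^x_{αβ}` lie in `B^m`.
`blk D l a` is the matrix of the component in `B^l` of `a`. -/
noncomputable def blk (l : G) (a : Alg D) : Matrix (Option G) (Option G) ℂ :=
  Matrix.of fun i j => match i, j with
    | some h, some k => a.tt D (h - k) (l - k) (-k)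
    | some h, none => a.ee D (l - h) (-h)
    | none, some k => a.bb D (l - k) (-k)
    | none, none => ∑ p, D.χ p l * a.mm D p

/-- The matrix of the component of `a` in `B^m`. -/
noncomputable def mblk (a : Alg D) : Matrix (G ⊕ G) (G ⊕ G) ℂ :=
  Matrix.of fun i j => match i, j with
    | .inl h, .inl k => a.tm D (k - h) k
    | .inr h, .inr k => a.mt D (k - h) k
    | .inl h, .inr k => D.τ * (D.χ h k)⁻¹ * a.eb D h k
    | .inr k, .inl h => D.χ h k * a.be D h k

@[simp] theorem blk_ss (l : G) : blk D l a (some h) (some k) = a.tt D (h - k) (l - k) (-k) := rfl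
@[simp] theorem blk_sn (l : G) : blk D l a (some h) none = a.ee D (l - h) (-h) := rfl
@[simp] theorem blk_ns (l : G) : blk D l a none (some k) = a.bb D (l - k) (-k) := rfl
@[simp] theorem blk_nn (l : G) : blk D l a none none = ∑ p, D.χ p l * a.mm D p := rfl
@[simp] theorem mblk_ll : mblk D a (.inl h) (.inl k) = a.tm D (k - h) k := rfl
@[simp] theorem mblk_rr : mblk D a (.inr h) (.inr k) = a.mt D (k - h) k := rfl
@[simp] theorem mblk_lr : mblk D a (.inl h) (.inr k) = D.τ * (D.χ h k)⁻¹ * a.eb D h k := rfl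
@[simp] theorem mblk_rl : mblk D a (.inr h) (.inl k) = D.χ k h * a.be D k h := rfl

theorem blk_mul (l : G) : blk D l (a * b) = blk D l a * blk D l b := by
  ext i j
  rw [Matrix.mul_apply, Fintype.sum_option]
  rcases i with _ | i <;> rcases j with _ | j
  · simp only [blk_nn, mul_mm, blk_ns, blk_sn, mul_add, Finset.sum_add_distrib]
    rw [add_comm]
    congr 1
    · simp only [Finset.mul_sum, Finset.sum_mul]
      rw [Finset.sum_comm]
      refine Finset.sum_congr rfl fun q _ => ?_
      refine Fintype.sum_equiv (Equiv.subRight q) _ _ fun p => ?_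
      simp only [Equiv.subRight_apply, chi_sub_left]
      have := chi_ne_zero D q l
      field_simp
    · trans ∑ h, ∑ k, (∑ p, (D.τ : ℂ) * D.τ * D.χ p (l - (h - k))) * (a.bb D h k * b.ee D h k)
      · simp only [Finset.mul_sum, Finset.sum_mul]
        rw [Finset.sum_comm]
        refine Finset.sum_congr rfl fun h _ => ?_
        rw [Finset.sum_comm]
        refine Finset.sum_congr rfl fun k _ => Finset.sum_congr rfl fun p _ => ?_
        simp only [chi_sub_right]
        have := chi_ne_zero D p h
        have := chi_ne_zero D p k
        field_simp
      · simp only [sum_tau_chi, ite_mul, one_mul, zero_mul]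
        rw [Finset.sum_comm]
        refine Fintype.sum_equiv (Equiv.neg G) _ _ fun k => ?_
        have : ∀ h, l - (h - k) = 0 ↔ h = l + k := fun h => by grind
        simp [this]
  · simp only [blk_nn, blk_ss, mul_bb, blk_ns, blk_sn, mul_add, Finset.sum_add_distrib]
    rw [add_comm]
    congr 1
    · simp only [Finset.sum_mul]
      refine Finset.sum_congr rfl fun p _ => ?_
      rw [chi_sub_right, chi_neg_right]
      have := chi_ne_zero D p j
      field_simp
    · refine Fintype.sum_equiv (Equiv.addRight j) _ _ fun q => ?_
      simp only [Equiv.coe_addRight]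
      congr 2 <;> abel
  · simp only [blk_nn, blk_ss, mul_ee, blk_ns, blk_sn, mul_add, Finset.sum_add_distrib]
    congr 1
    · simp only [Finset.mul_sum]
      refine Finset.sum_congr rfl fun p _ => ?_
      rw [chi_sub_right, chi_neg_right]
      have := chi_ne_zero D p i
      field_simp
    · refine Fintype.sum_equiv (Equiv.subLeft i) _ _ fun q => ?_
      simp only [Equiv.subLeft_apply]
      congr 2 <;> abel
  · simp only [blk_nn, blk_ss, mul_tt, blk_ns, blk_sn, mul_add, Finset.sum_add_distrib]
    congr 1
    · congr 2 <;> abel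
    · refine Fintype.sum_equiv (Equiv.addRight j) _ _ fun q => ?_
      simp only [Equiv.coe_addRight]
      congr 2 <;> abel

theorem mblk_mul : mblk D (a * b) = mblk D a * mblk D b := by
  ext i j
  rw [Matrix.mul_apply, Fintype.sum_sum_type]
  rcases i with i | i <;> rcases j with j | j
  · simp only [mblk_ll, mblk_rr, mblk_lr, mblk_rl, mul_tm]
    rw [add_comm]
    congr 1
    · refine Fintype.sum_equiv (Equiv.subLeft j) _ _ fun q => ?_
      simp only [Equiv.subLeft_apply]
      congr 2 <;> abel
    · refine Finset.sum_congr rfl fun p _ => ?_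
      rw [chi_sub_left, sub_sub_cancel]
      ring
  · simp only [mblk_ll, mblk_rr, mblk_lr, mblk_rl, mul_eb, mul_add, Finset.mul_sum]
    rw [add_comm]
    congr 1
    · refine Fintype.sum_equiv (Equiv.addRight i) _ _ fun q => ?_
      simp only [Equiv.coe_addRight]
      have := chi_ne_zero D i j
      have := chi_ne_zero D q j
      rw [D.χ_add_left, show q + i - i = q by abel, add_comm q i]
      field_simp
    · refine Fintype.sum_equiv (Equiv.subLeft j) _ _ fun q => ?_
      simp only [Equiv.subLeft_apply]
      have := chi_ne_zero D i j
      have := chi_ne_zero D i q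
      rw [chi_sub_right, D.χ_symm q i, sub_sub_cancel]
      field_simp
  · simp only [mblk_ll, mblk_rr, mblk_lr, mblk_rl, mul_be, mul_add, Finset.mul_sum]
    congr 1
    · refine Fintype.sum_equiv (Equiv.subLeft j) _ _ fun q => ?_
      simp only [Equiv.subLeft_apply]
      have := chi_ne_zero D q i
      rw [chi_sub_left, sub_sub_cancel]
      field_simp
    · refine Fintype.sum_equiv (Equiv.addRight i) _ _ fun q => ?_
      simp only [Equiv.coe_addRight]
      have := chi_ne_zero D j i
      have := chi_ne_zero D j q
      rw [chi_add_right, show q + i - i = q by abel, add_comm q i, D.χ_symm q j]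
      field_simp
  · simp only [mblk_ll, mblk_rr, mblk_lr, mblk_rl, mul_mt]
    congr 1
    · refine Finset.sum_congr rfl fun p _ => ?_
      rw [D.χ_symm (j - i) p, chi_sub_right, sub_sub_cancel, mul_inv, inv_inv]
      ring
    · refine Fintype.sum_equiv (Equiv.subLeft j) _ _ fun q => ?_
      simp only [Equiv.subLeft_apply]
      congr 2 <;> abel
end
end TambaraYamagami

namespace TambaraYamagami
open Idx
variable {G : Type u} [AddCommGroup G] [Fintype G] [DecidableEq G] (D : Datum G)
section
variable (a b : Alg D) (c : ℂ) (g h k p l : G)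

theorem blk_add : blk D l (a + b) = blk D l a + blk D l b := by
  ext i j
  rcases i with _ | i <;> rcases j with _ | j <;>
  simp [add_tt, add_mm, add_ee, add_bb, mul_add, Finset.sum_add_distrib]
theorem blk_smul : blk D l (c • b) = c • blk D l b := by
  ext i j
  rcases i with _ | i <;> rcases j with _ | j <;>
  simp [smul_tt, smul_mm, smul_ee, smul_bb, Finset.mul_sum, mul_left_comm]
theorem mblk_add : mblk D (a + b) = mblk D a + mblk D b := by
  ext i j
  rcases i with i | i <;> rcases j with j | j <;>
  simp [add_tm, add_mt, add_eb, add_be, mul_add]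
theorem mblk_smul : mblk D (c • b) = c • mblk D b := by
  ext i j
  rcases i with i | i <;> rcases j with j | j <;>
  simp [smul_tm, smul_mt, smul_eb, smul_be, mul_left_comm]
theorem blk_one : blk D l 1 = 1 := by
  ext i j
  rcases i with _ | i <;> rcases j with _ | j <;>
  simp [one_tt, one_mm, one_ee, one_bb, Matrix.one_apply, sub_eq_zero, chi_zero_left]
theorem mblk_one : mblk D 1 = 1 := by
  ext i j
  rcases i with i | i <;> rcases j with j | j <;>
  simp [one_tm, one_mt, one_eb, one_be, Matrix.one_apply, sub_eq_zero, eq_comm]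
theorem fourier (F : G → ℂ) (q : G) :
    ∑ l, (D.τ : ℂ) * D.τ * (D.χ q l)⁻¹ * ∑ p, D.χ p l * F p = F q := by
  trans ∑ p, (∑ l, (D.τ : ℂ) * D.τ * D.χ l (p - q)) * F p
  · simp only [Finset.mul_sum, Finset.sum_mul]
    rw [Finset.sum_comm]
    refine Finset.sum_congr rfl fun p _ => Finset.sum_congr rfl fun l _ => ?_
    rw [chi_sub_right, D.χ_symm l p, D.χ_symm l q]
    ring
  · simp [sum_tau_chi, sub_eq_zero]

/-- All matrix blocks of an element of `B`. -/
noncomputable def mats (a : Alg D) : (G → Matrix (Option G) (Option G) ℂ) × Matrix (G ⊕ G) (G ⊕ G) ℂ :=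
  (fun l => blk D l a, mblk D a)
theorem mats_injective : Function.Injective (mats D) := by
  intro a b hab
  have h1 : ∀ l i j, blk D l a i j = blk D l b i j := fun l i j => by
    have := congrArg Prod.fst hab
    exact congrFun (congrFun (congrFun this l) i) j
  have h2 : ∀ i j, mblk D a i j = mblk D b i j := fun i j => by
    have := congrArg Prod.snd hab
    exact congrFun (congrFun this i) j
  apply ext8
  · intro p h k
    simpa using h1 (h - k) (some (p - k)) (some (-k))
  · intro p h
    simpa using h2 (.inl (h - p)) (.inl h)
  · intro p h
    simpa using h2 (.inr (h - p)) (.inr h)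
  · intro p
    have := fun l => h1 l none none
    simp only [blk_nn] at this
    rw [← fourier D (a.mm D), ← fourier D (b.mm D)]
    simp only [this]
  · intro h k
    simpa using h1 (h - k) (some (-k)) none
  · intro h k
    have ht := tau_ne_zero D
    simpa [-Complex.ofReal_eq_zero, ht, chi_ne_zero] using h2 (.inl h) (.inr k)
  · intro h k
    simpa [chi_ne_zero] using h2 (.inr k) (.inl h)
  · intro h k
    simpa using h1 (h - k) none (some (-k))
end

theorem mats_add (a b) : mats D (a + b) = mats D a + mats D b :=
  Prod.ext (funext fun l => blk_add D a b l) (mblk_add D a b)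
theorem mats_mul (a b) : mats D (a * b) = mats D a * mats D b :=
  Prod.ext (funext fun l => blk_mul D a b l) (mblk_mul D a b)
theorem mats_smul (c : ℂ) (b) : mats D (c • b) = c • mats D b :=
  Prod.ext (funext fun l => blk_smul D b c l) (mblk_smul D b c)
theorem mats_one : mats D 1 = 1 :=
  Prod.ext (funext fun l => blk_one D l) (mblk_one D)

noncomputable instance : Ring (Alg D) where
  __ := (inferInstance : AddCommGroup (Alg D))
  mul_assoc a b c := mats_injective D (by simp only [mats_mul, mul_assoc])
  one_mul a := mats_injective D (by simp only [mats_mul, mats_one, one_mul])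
  mul_one a := mats_injective D (by simp only [mats_mul, mats_one, mul_one])
  left_distrib a b c := mats_injective D (by simp only [mats_mul, mats_add, mul_add])
  right_distrib a b c := mats_injective D (by simp only [mats_mul, mats_add, add_mul])
  zero_mul a := mats_injective D (by
    have := mats_smul D 0 a
    simp only [zero_smul] at this
    simp only [mats_mul, this, zero_mul])
  mul_zero a := mats_injective D (by
    have := mats_smul D 0 a
    simp only [zero_smul] at this
    simp only [mats_mul, this, mul_zero])

noncomputable instance : Algebra ℂ (Alg D) :=
  Algebra.ofModule
    (fun c a b => mats_injective D (by simp only [mats_mul, mats_smul, smul_mul_assoc]))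
    (fun c a b => mats_injective D (by simp only [mats_mul, mats_smul, mul_smul_comm]))

/-- The dual object: `g* = -g` and `m* = m`. -/
@[reducible] def dual : Option G → Option G
  | some g => some (-g)
  | none => none

/-- The bijection `α ↦ α*` from `Ω_x` to `Ω_{x*}`: for `x = g` it is `k ↦ k - g`, `m ↦ m`; for `x = m` it
exchanges `k` and `k̄`. -/
def dualIdx : {x : Option G} → Idx G x → Idx G (dual x)
  | _, .pt (g := g) k => .pt (k - g)
  | _, .pm => .pm
  | _, .el k => .bar k
  | _, .bar k => .el k

/-- The weights in the formulas for the involution and the antipode: `τ` for `k̄`, and `1` otherwise. -/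
def weight : {x : Option G} → Idx G x → ℝ
  | _, .bar _ => D.τ
  | _, _ => 1

/-- The involution of `B`: the conjugate linear map with
`(f^x_{αβ})* = (w(β) / w(α)) f^{x*}_{α*β*}`, see `star_f`.  For instance
`(f^g_{h,k})* = f^{-g}_{h-g,k-g}`, `(f^m_{g,h̄})* = τ f^m_{ḡ,h}`, `(f^m_{ḡ,h})* = τ⁻¹ f^m_{g,h̄}`. -/
noncomputable instance : Star (Alg D) where
  star b := ∑ x, ∑ α, ∑ β,
    star (cf D b x α β) • ((weight D β / weight D α : ℂ) • f D (dual x) (dualIdx α) (dualIdx β))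

theorem star_f (x) (α β : Idx G x) : star (f D x α β) =
  (weight D β / weight D α : ℂ) • f D (dual x) (dualIdx α) (dualIdx β) := by
  change ∑ y, ∑ μ, ∑ ν, _ = _
  rw [Finset.sum_eq_single x, Finset.sum_eq_single α, Finset.sum_eq_single β]
  · simp [cf_f]
  · intro μ _ h; simp [cf_f, h.symm]
  · simp
  · intro μ _ h; simp [cf_f, h.symm]
  · simp
  · intro μ _ h; simp [cf_f, h.symm]
  · simp

def barIx (i : Σ x : Option G, Idx G x × Idx G x) : Σ x : Option G, Idx G x × Idx G x :=
  ⟨dual i.1, dualIdx i.2.1, dualIdx i.2.2⟩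
theorem barIx_barIx (i : Σ x : Option G, Idx G x × Idx G x) : barIx (barIx i) = i := by
  rcases i with ⟨x, α, β⟩
  have h1 : ∀ (p q a b c d : G), p = q → a = c → b = d →
    (⟨some p, pt a, pt b⟩ : Σ x : Option G, Idx G x × Idx G x) = ⟨some q, pt c, pt d⟩ := by
    rintro p _ a b _ _ rfl rfl rfl; rfl
  have h2 : ∀ (p q a c : G), p = q → a = c →
    (⟨some p, pt a, pm⟩ : Σ x : Option G, Idx G x × Idx G x) = ⟨some q, pt c, pm⟩ := by
    rintro p _ a _ rfl rfl; rfl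
  have h3 : ∀ (p q a c : G), p = q → a = c →
    (⟨some p, pm, pt a⟩ : Σ x : Option G, Idx G x × Idx G x) = ⟨some q, pm, pt c⟩ := by
    rintro p _ a _ rfl rfl; rfl
  have h4 : ∀ (p q : G), p = q →
    (⟨some p, pm, pm⟩ : Σ x : Option G, Idx G x × Idx G x) = ⟨some q, pm, pm⟩ := by
    rintro p _ rfl; rfl
  cases α <;> cases β
  · exact h1 _ _ _ _ _ _ (by abel) (by abel) (by abel)
  · exact h2 _ _ _ _ (by abel) (by abel)
  · exact h3 _ _ _ _ (by abel) (by abel)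
  · exact h4 _ _ (by abel)
  all_goals rfl

theorem star_add' (a b : Alg D) : star (a + b) = star a + star b := by
  change ∑ y, ∑ μ, ∑ ν, _ = (∑ y, ∑ μ, ∑ ν, _) + ∑ y, ∑ μ, ∑ ν, _
  simp [cf, add_smul, Finset.sum_add_distrib]
theorem star_smul' (c : ℂ) (b : Alg D) : star (c • b) = star c • star b := by
  change ∑ y, ∑ μ, ∑ ν, _ = star c • (∑ y, ∑ μ, ∑ ν, _)
  simp [cf, mul_smul, Finset.smul_sum]


theorem cf_star (b : Alg D) {x : Option G} (α β : Idx G x) {y} {μ ν : Idx G y}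
    (h : (⟨y, μ, ν⟩ : Σ x : Option G, Idx G x × Idx G x) = ⟨dual x, dualIdx α, dualIdx β⟩) :
    cf D (star b) y μ ν = star (cf D b x α β) * (weight D β / weight D α) := by
  have : cf D (star b) y μ ν = ∑ i : Σ x : Option G, Idx G x × Idx G x,
      star (cf D b i.1 i.2.1 i.2.2) * ((weight D i.2.2 / weight D i.2.1 : ℂ) *
        if barIx i = ⟨y, μ, ν⟩ then 1 else 0) := by
    rw [Fintype.sum_sigma]
    simp only [Fintype.sum_prod_type]
    change cf D (∑ x, ∑ α, ∑ β, _) _ _ _ = _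
    simp only [barIx, cf, f, map_sum, Finsupp.coe_finsetSum, Finset.sum_apply, map_smul,
      Finsupp.smul_apply, smul_eq_mul, Module.Basis.repr_self, Finsupp.single_apply]
    congr!
  rw [this, Finset.sum_eq_single ⟨x, α, β⟩]
  · simp [barIx, h]
  · intro i _ hi
    rw [if_neg, mul_zero, mul_zero]
    intro h'
    apply hi
    have h2 := congrArg barIx (h'.trans h)
    rw [barIx_barIx] at h2
    rw [h2]
    exact barIx_barIx ⟨x, α, β⟩
  · simp

section
variable (b : Alg D) (p h k l : G)
theorem star_tt : (star b).tt D p h k = star (b.tt D (-p) (h - p) (k - p)) := by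
  refine (cf_star D b (x := some (-p)) (.pt (h - p)) (.pt (k - p)) ?_).trans (by simp [weight, Alg.tt])
  exact (barIx_barIx ⟨some p, .pt h, .pt k⟩).symm
theorem star_tm : (star b).tm D p h = star (b.tm D (-p) (h - p)) := by
  refine (cf_star D b (x := some (-p)) (.pt (h - p)) .pm ?_).trans (by simp [weight, Alg.tm])
  exact (barIx_barIx ⟨some p, .pt h, .pm⟩).symm
theorem star_mt : (star b).mt D p h = star (b.mt D (-p) (h - p)) := by
  refine (cf_star D b (x := some (-p)) .pm (.pt (h - p)) ?_).trans (by simp [weight, Alg.mt])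
  exact (barIx_barIx ⟨some p, .pm, .pt h⟩).symm
theorem star_mm : (star b).mm D p = star (b.mm D (-p)) := by
  refine (cf_star D b (x := some (-p)) .pm .pm ?_).trans (by simp [weight, Alg.mm])
  exact (barIx_barIx ⟨some p, .pm, .pm⟩).symm
theorem star_ee : (star b).ee D h k = star (b.bb D h k) := by
  refine (cf_star D b (.bar h) (.bar k) rfl).trans ?_
  have := tau_ne_zero D
  simp [weight, Alg.bb, -Complex.ofReal_eq_zero, this]
theorem star_bb : (star b).bb D h k = star (b.ee D h k) := by
  refine (cf_star D b (.el h) (.el k) rfl).trans ?_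
  simp [weight, Alg.ee]
theorem star_be : (star b).be D h k = D.τ * star (b.eb D h k) := by
  refine (cf_star D b (.el h) (.bar k) rfl).trans ?_
  simp [weight, Alg.eb, mul_comm]
theorem star_eb : (star b).eb D h k = (D.τ : ℂ)⁻¹ * star (b.be D h k) := by
  refine (cf_star D b (.bar h) (.el k) rfl).trans ?_
  simp [weight, Alg.be, mul_comm]

theorem blk_star : blk D l (star b) = star (blk D l b) := by
  rw [Matrix.star_eq_conjTranspose]
  ext i j
  rw [Matrix.conjTranspose_apply]
  rcases i with _ | i <;> rcases j with _ | j
  · simp only [blk_nn, star_mm, star_sum, star_mul', star_chi]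
    refine Fintype.sum_equiv (Equiv.neg G) _ _ fun q => ?_
    simp [chi_neg_left]
  · simp only [blk_ns, blk_sn, star_bb]
  · simp only [blk_ns, blk_sn, star_ee]
  · simp only [blk_ss, star_tt]
    congr 2 <;> abel

theorem mblk_star : mblk D (star b) = star (mblk D b) := by
  rw [Matrix.star_eq_conjTranspose]
  ext i j
  rw [Matrix.conjTranspose_apply]
  have ht := tau_ne_zero D
  have hr : star (D.τ : ℂ) = D.τ := Complex.conj_ofReal _
  rcases i with i | i <;> rcases j with j | j
  · simp only [mblk_ll, star_tm]
    congr 2 <;> abel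
  · simp only [mblk_lr, mblk_rl, star_eb, star_mul', star_chi]
    field_simp
  · simp only [mblk_lr, mblk_rl, star_be, star_mul', star_chi, star_inv₀, inv_inv, hr]
    ring
  · simp only [mblk_rr, star_mt]
    congr 2 <;> abel

theorem mats_star : mats D (star b) = star (mats D b) :=
  Prod.ext (funext fun l => blk_star D b l) (mblk_star D b)
end

noncomputable instance : StarRing (Alg D) where
  star_involutive a := mats_injective D (by simp only [mats_star, star_star])
  star_mul a b := mats_injective D (by simp only [mats_star, mats_mul, star_mul])
  star_add := star_add' D

instance : StarModule ℂ (Alg D) where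
  star_smul := star_smul' D

end TambaraYamagami

namespace TambaraYamagami
open Idx
variable {G : Type u} [AddCommGroup G] [Fintype G] [DecidableEq G] (D : Datum G)

/-- The coproduct `Δ(f^x_{αβ}) = ∑_γ f^x_{αγ} ⊗ f^x_{γβ}` and the counit `ε(f^x_{αβ}) = δ_{α,β}` of `B`. -/
noncomputable instance : CoalgebraStruct ℂ (Alg D) where
  comul := (basis D).constr ℂ fun i => ∑ γ, f D i.1 i.2.1 γ ⊗ₜ[ℂ] f D i.1 γ i.2.2
  counit := (basis D).constr ℂ fun i => if i.2.1 = i.2.2 then 1 else 0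

open CoalgebraStruct

theorem comul_f (x) (α β : Idx G x) : comul (R := ℂ) (f D x α β) = ∑ γ, f D x α γ ⊗ₜ[ℂ] f D x γ β := by
  exact (basis D).constr_basis ℂ _ _
theorem counit_f (x) (α β : Idx G x) : counit (R := ℂ) (f D x α β) = if α = β then 1 else 0 := by
  exact (basis D).constr_basis ℂ _ _

noncomputable instance : Coalgebra ℂ (Alg D) where
  coassoc := (basis D).ext fun ⟨x, α, β⟩ => by
    change _ = comul.lTensor _ (comul (f D x α β))
    change TensorProduct.assoc _ _ _ _ (comul.rTensor _ (comul (f D x α β))) = _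
    simp only [comul_f, map_sum, LinearMap.rTensor_tmul, LinearMap.lTensor_tmul, TensorProduct.sum_tmul,
      TensorProduct.tmul_sum, TensorProduct.assoc_tmul]
    rw [Finset.sum_comm]
  rTensor_counit_comp_comul := (basis D).ext fun ⟨x, α, β⟩ => by
    change counit.rTensor _ (comul (f D x α β)) = 1 ⊗ₜ[ℂ] (f D x α β)
    simp only [comul_f, map_sum, LinearMap.rTensor_tmul, counit_f]
    rw [Finset.sum_eq_single α]
    · simp
    · intro b _ hb; simp [hb.symm]
    · simp
  lTensor_counit_comp_comul := (basis D).ext fun ⟨x, α, β⟩ => by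
    change counit.lTensor _ (comul (f D x α β)) = (f D x α β) ⊗ₜ[ℂ] 1
    simp only [comul_f, map_sum, LinearMap.lTensor_tmul, counit_f]
    rw [Finset.sum_eq_single β]
    · simp
    · intro b _ hb; simp [hb]
    · simp

theorem f_mul_f (x y) (α β : Idx G x) (γ δ : Idx G y) : f D x α β * f D y γ δ =
    ∑ z, ∑ μ, ∑ ν, (circ D x y z α γ μ * star (circ D x y z β δ ν)) • f D z μ ν := by
  apply (basis D).repr.injective
  ext ⟨z, μ, ν⟩
  change cf D _ z μ ν = cf D _ z μ ν
  have : cf D (∑ z, ∑ μ, ∑ ν, (circ D x y z α γ μ * star (circ D x y z β δ ν)) • f D z μ ν) z μ ν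
    = circ D x y z α γ μ * star (circ D x y z β δ ν) := by
    simp only [cf, f, map_sum, Finsupp.coe_finsetSum, Finset.sum_apply, map_smul,
      Finsupp.smul_apply, smul_eq_mul, Module.Basis.repr_self, Finsupp.single_apply]
    rw [Finset.sum_eq_single z, Finset.sum_eq_single μ, Finset.sum_eq_single ν]
    · simp
    · intro i _ hi; simp [hi]
    · simp
    · intro i _ hi; simp [hi]
    · simp
    · intro i _ hi;
      refine Finset.sum_eq_zero fun _ _ => Finset.sum_eq_zero fun _ _ => ?_
      rw [if_neg, mul_zero]
      exact fun h => hi (congrArg Sigma.fst h)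
    · simp
  rw [this, mul_def, Finset.sum_eq_single x, Finset.sum_eq_single y, Finset.sum_eq_single α,
    Finset.sum_eq_single γ, Finset.sum_eq_single β, Finset.sum_eq_single δ]
  · simp [cf_f]
  · intro i _ hi; simp [cf_f, hi.symm]
  · simp
  · intro i _ hi; simp [cf_f, hi.symm]
  · simp
  · intro i _ hi; simp [cf_f, hi.symm]
  · simp
  · intro i _ hi; simp [cf_f, hi.symm]
  · simp
  · intro i _ hi
    refine Finset.sum_eq_zero fun a _ => Finset.sum_eq_zero fun b _ => mul_eq_zero_of_right _ ?_
    refine Finset.sum_eq_zero fun c _ => Finset.sum_eq_zero fun d _ => mul_eq_zero_of_right _ ?_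
    rw [cf_f D y i, if_neg, mul_zero]
    exact fun h => hi (congrArg Sigma.fst h).symm
  · simp
  · intro i _ hi
    refine Finset.sum_eq_zero fun _ _ => ?_
    refine Finset.sum_eq_zero fun a _ => Finset.sum_eq_zero fun b _ => mul_eq_zero_of_right _ ?_
    refine Finset.sum_eq_zero fun c _ => Finset.sum_eq_zero fun d _ => mul_eq_zero_of_right _ ?_
    rw [cf_f D x i, if_neg, zero_mul]
    exact fun h => hi (congrArg Sigma.fst h).symm
  · simp

/- The basis vector `v^x_α` lies in `Hom(tgt α, src α ⊗ x)`. -/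
def src : {x : Option G} → Idx G x → Option G
  | _, .pt (g := g) k => some (k - g)
  | _, .pm => none
  | _, .el k => some k
  | _, .bar _ => none
def tgt : {x : Option G} → Idx G x → Option G
  | _, .pt k => some k
  | _, .pm => none
  | _, .el _ => none
  | _, .bar k => some k

theorem circ_tgt {x y z : Option G} (α : Idx G x) (γ : Idx G y) (μ : Idx G z)
   (h : tgt μ ≠ tgt γ) : circ D x y z α γ μ = 0 := by
  cases α <;> cases γ <;> cases μ <;> simp [circ, circVec, vec, tgt] at h ⊢ <;> grind

theorem sum4 {M : Type*} [AddCommMonoid M] (F : (z : Option G) → Idx G z → M) :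
  ∑ z, ∑ μ, F z μ = (∑ k, F none (.el k) + ∑ k, F none (.bar k)) + (∑ p, F (some p) .pm + ∑ p, ∑ k, F (some p) (.pt k)) := by
  simp only [Fintype.sum_option, sum_some, sum_none, Finset.sum_add_distrib]

theorem sum_one_zero {ι : Type*} [Fintype ι] (P : ι → Prop) [DecidablePred P] (Q : Prop) [Decidable Q] (i : ι)
    (h1 : ∀ j, P j → j = i) (h2 : P i ↔ Q) : ∑ j, (if P j then (1 : ℂ) else 0) = if Q then 1 else 0 := by
  rw [Finset.sum_eq_single i]
  · simp [h2]
  · intro j _ hj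
    rw [if_neg]
    exact fun h => hj (h1 j h)
  · simp

theorem chi_star_chi (g h : G) : D.χ g h * star (D.χ g h) = 1 := by
  rw [star_chi, mul_inv_cancel₀ (chi_ne_zero D g h)]

theorem tau_term (x a b : G) : (D.τ : ℂ) * (D.χ x a)⁻¹ * (starRingEnd ℂ) (D.τ * (D.χ x b)⁻¹) =
    D.τ * D.τ * D.χ x (b - a) := by
  have := star_chi D x b
  rw [chi_sub_right, map_mul, map_inv₀, Complex.conj_ofReal, starRingEnd_apply, this, inv_inv]
  ring

set_option maxHeartbeats 1000000 in
theorem isometry {x y : Option G} (α β : Idx G x) (γ δ : Idx G y) :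
    ∑ z, ∑ μ, circ D x y z α γ μ * star (circ D x y z β δ μ) =
      if α = β ∧ γ = δ ∧ tgt α = src γ then 1 else 0 := by
  rw [sum4]
  cases α <;> cases β <;> cases γ <;> cases δ <;>
    simp [circ, circVec, vec, tgt, src]
  · rename_i g a b c d e
    simp only [← ite_and, ← Fintype.sum_prod_type' (f := fun x k => if _ then (1:ℂ) else 0)]
    apply sum_one_zero _ _ (g + c, d)
    · rintro ⟨p, q⟩; grind
    · grind
  · simp only [← ite_and]
    rename_i g a b c d
    apply sum_one_zero _ _ (d - g)
    · grind
    · grind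
  · rename_i g c d
    by_cases h : c = d
    · subst h; simpa using chi_star_chi D g c
    · simp [h]
  · rename_i c d g
    by_cases h : c = d
    · subst h; simpa using chi_star_chi D g c
    · simp [h]
  · rename_i a b c d
    simp only [← ite_and, ← Fintype.sum_prod_type' (f := fun x k => if _ then (1:ℂ) else 0)]
    apply sum_one_zero _ _ (c - a, c)
    · rintro ⟨p, q⟩; grind
    · grind
  · simp only [← ite_and]
    rename_i a b g c d
    apply sum_one_zero _ _ (d)
    · grind
    · grind
  · rename_i a b c d
    by_cases h : a = c
    · by_cases h' : b = d
      · simp only [h, h', if_true, tau_term, sum_tau_chi, sub_eq_zero]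
        grind
      · simp [h']; grind
    · simp [h]

/-- `z` occurs in the tensor product of `x` and `y`. -/
def admissible : Option G → Option G → Option G → Prop
  | some g, some h, some p => p = g + h
  | none, none, some _ => True
  | none, some _, none => True
  | some _, none, none => True
  | _, _, _ => False

theorem circ_adm {x y z : Option G} (α : Idx G x) (γ : Idx G y) (μ : Idx G z)
   (h : ¬ admissible x y z) : circ D x y z α γ μ = 0 := by
  cases α <;> cases γ <;> cases μ <;> simp [circ, circVec, vec, admissible] at h ⊢ <;> grind



theorem sigma_eq_of_vec {z w : Option G} {μ : Idx G z} {ν : Idx G w} (h : μ.vec = ν.vec) :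
    (⟨z, μ⟩ : Σ z, Idx G z) = ⟨w, ν⟩ := by
  cases μ <;> cases ν <;> simp [vec] at h
  · obtain ⟨rfl, rfl⟩ := h; rfl
  · subst h; rfl
  · subst h; rfl
  · subst h; rfl

open scoped Classical in
set_option maxHeartbeats 1000000 in
theorem coisometry {x y z w : Option G} (μ : Idx G z) (ν : Idx G w) :
    ∑ α, ∑ γ, circ D x y z α γ μ * star (circ D x y w α γ ν) =
      if μ.vec = ν.vec ∧ admissible x y z then 1 else 0 := by
  rcases x with _ | x <;> rcases y with _ | y <;> cases μ <;>
    simp only [circ_mmm, circ_mms, circ_mmn, circ_sss, circ_ssn, circ_sms, circ_mss, circ_ssm,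
      circ_sml, circ_smr, circ_msl, circ_msr, zero_mul, Finset.sum_const_zero, admissible, and_false, and_true, if_false]
  all_goals cases ν
  all_goals simp [circ, circVec, vec, eq_comm]
  · symm
    rename_i g h
    have := tau_term D
    simp only [map_mul, map_inv₀, Complex.conj_ofReal] at this
    trans ∑ x, (D.τ : ℂ) * D.τ * D.χ x (h - g)
    · refine Finset.sum_congr rfl fun x _ => ?_
      rw [← this, D.χ_symm x g, D.χ_symm x h]
    · simp [sum_tau_chi, sub_eq_zero, eq_comm]
  · symm
    rename_i k l
    by_cases h : k = l
    · subst h; simpa using chi_star_chi D y k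
    · simp [h, Ne.symm h]
  · symm
    rename_i k l
    by_cases h : k = l
    · subst h; simpa using chi_star_chi D x k
    · simp [h, Ne.symm h]
  · grind
  · grind
end TambaraYamagami

namespace TambaraYamagami
open Idx
variable {G : Type u} [AddCommGroup G] [Fintype G] [DecidableEq G] (D : Datum G)
open CoalgebraStruct

theorem sum_triple {M : Type*} [AddCommMonoid M] (F : (z : Option G) → Idx G z → Idx G z → M) :
    ∑ z, ∑ μ, ∑ ν, F z μ ν = ∑ i : (Σ z : Option G, Idx G z × Idx G z), F i.1 i.2.1 i.2.2 := by
  rw [Fintype.sum_sigma]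
  simp only [Fintype.sum_prod_type]

open scoped Classical in
theorem sum_vec {M : Type*} [AddCommMonoid M] (F : (z : Option G) → Idx G z → M) {z : Option G} (ρ : Idx G z) :
    (∑ w, ∑ σ : Idx G w, if σ.vec = ρ.vec then F w σ else 0) = F z ρ := by
  rw [Finset.sum_eq_single z, Finset.sum_eq_single ρ]
  · simp
  · intro σ _ h
    rw [if_neg]
    intro h'
    have := sigma_eq_of_vec h'
    simp at this
    exact h this
  · simp
  · intro w _ h
    refine Finset.sum_eq_zero fun σ _ => ?_
    rw [if_neg]
    intro h'
    exact h (congrArg Sigma.fst (sigma_eq_of_vec h'))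
  · simp

theorem comul_f_mul_f {x y : Option G} (α β : Idx G x) (γ δ : Idx G y) :
    comul (R := ℂ) (f D x α β * f D y γ δ) = comul (R := ℂ) (f D x α β) * comul (R := ℂ) (f D y γ δ) := by
  classical
  have hL : comul (R := ℂ) (f D x α β * f D y γ δ) = ∑ z, ∑ μ, ∑ ρ, ∑ ν,
      (circ D x y z α γ μ * star (circ D x y z β δ ν)) • (f D z μ ρ ⊗ₜ[ℂ] f D z ρ ν) := by
    rw [f_mul_f]
    simp only [map_sum, map_smul, comul_f, Finset.smul_sum]
    refine Finset.sum_congr rfl fun z _ => Finset.sum_congr rfl fun μ _ => ?_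
    rw [Finset.sum_comm]
  have hR : comul (R := ℂ) (f D x α β) * comul (R := ℂ) (f D y γ δ) =
      ∑ z, ∑ μ, ∑ ρ, ∑ w, ∑ σ, ∑ ν, (circ D x y z α γ μ * star (circ D x y w β δ ν)) •
       ((∑ a, ∑ c, circ D x y w a c σ * star (circ D x y z a c ρ)) • (f D z μ ρ ⊗ₜ[ℂ] f D w σ ν)) := by
    rw [comul_f, comul_f, Finset.sum_mul_sum]
    simp only [Algebra.TensorProduct.tmul_mul_tmul, f_mul_f, sum_triple]
    simp only [TensorProduct.sum_tmul, TensorProduct.tmul_sum, TensorProduct.smul_tmul_smul]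
    rw [← Fintype.sum_prod_type' (f := fun a c => ∑ j : (Σ z : Option G, Idx G z × Idx G z), ∑ i : (Σ z : Option G, Idx G z × Idx G z),
      (circ D x y i.1 α γ i.2.1 * star (circ D x y i.1 a c i.2.2) *
        (circ D x y j.1 a c j.2.1 * star (circ D x y j.1 β δ j.2.2))) •
          (f D i.1 i.2.1 i.2.2 ⊗ₜ[ℂ] f D j.1 j.2.1 j.2.2))]
    simp only [Finset.sum_comm (s := (Finset.univ : Finset (Idx G x × Idx G y)))]
    rw [Finset.sum_comm]
    refine Finset.sum_congr rfl fun i _ => ?_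
    refine Finset.sum_congr rfl fun j _ => ?_
    rw [smul_smul, Finset.mul_sum, Finset.sum_smul, Fintype.sum_prod_type]
    refine Finset.sum_congr rfl fun a _ => ?_
    rw [Finset.mul_sum, Finset.sum_smul]
    refine Finset.sum_congr rfl fun c _ => ?_
    congr 1
    ring
  rw [hL, hR]
  refine Finset.sum_congr rfl fun z _ => Finset.sum_congr rfl fun μ _ => Finset.sum_congr rfl fun ρ _ => ?_
  simp only [coisometry]
  trans ∑ w, ∑ σ : Idx G w, if σ.vec = ρ.vec then ∑ ν, (circ D x y z α γ μ * star (circ D x y w β δ ν)) •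
    ((f D z μ ρ ⊗ₜ[ℂ] f D w σ ν)) else 0
  · rw [sum_vec (fun w σ => ∑ ν, (circ D x y z α γ μ * star (circ D x y w β δ ν)) •
      ((f D z μ ρ ⊗ₜ[ℂ] f D w σ ν)))]
  · refine Finset.sum_congr rfl fun w _ => Finset.sum_congr rfl fun σ _ => ?_
    by_cases h : σ.vec = ρ.vec
    · rw [if_pos h]
      refine Finset.sum_congr rfl fun ν _ => ?_
      by_cases h' : admissible x y w
      · rw [if_pos ⟨h, h'⟩, one_smul]
      · rw [circ_adm D β δ ν h']; simp
    · rw [if_neg h, Finset.sum_eq_zero]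
      intro ν _
      rw [if_neg (fun h' => h h'.1), zero_smul, smul_zero]

theorem comul_mul (b c : Alg D) : comul (R := ℂ) (b * c) = comul (R := ℂ) b * comul (R := ℂ) c := by
  let T1 : Alg D →ₗ[ℂ] Alg D →ₗ[ℂ] Alg D ⊗[ℂ] Alg D := (LinearMap.mul ℂ (Alg D)).compr₂ comul
  let T2 : Alg D →ₗ[ℂ] Alg D →ₗ[ℂ] Alg D ⊗[ℂ] Alg D := (LinearMap.mul ℂ (Alg D ⊗[ℂ] Alg D)).compl₁₂ comul comul
  have : T1 = T2 := (basis D).ext fun i => (basis D).ext fun j => comul_f_mul_f D _ _ _ _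
  exact LinearMap.congr_fun (LinearMap.congr_fun this b) c

theorem counit_f_mul_f {x y : Option G} (α β : Idx G x) (γ δ : Idx G y) :
    counit (R := ℂ) (f D x α β * f D y γ δ) = if α = β ∧ γ = δ ∧ tgt α = src γ then 1 else 0 := by
  rw [f_mul_f, ← isometry D]
  simp only [map_sum, map_smul, counit_f, smul_eq_mul, mul_ite, mul_one, mul_zero, Finset.sum_ite_eq, Finset.mem_univ, if_true]

theorem counit_mul_mul_f {x y z : Option G} (α β : Idx G x) (γ δ : Idx G y) (μ ν : Idx G z) :
    counit (R := ℂ) (f D x α β * f D y γ δ * f D z μ ν) =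
      if (α = β ∧ γ = δ ∧ tgt α = src γ) ∧ μ = ν ∧ tgt γ = src μ then 1 else 0 := by
  rw [f_mul_f]
  simp only [Finset.sum_mul, map_sum, smul_mul_assoc, map_smul, smul_eq_mul, counit_f_mul_f]
  by_cases h : μ = ν ∧ tgt γ = src μ
  · simp only [h, and_true]
    rw [← isometry D]
    refine Finset.sum_congr rfl fun w _ => Finset.sum_congr rfl fun ρ _ => ?_
    rw [Finset.sum_eq_single ρ]
    · by_cases hρ : tgt ρ = tgt γ
      · simp [h, hρ]
      · simp [circ_tgt D α γ ρ hρ]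
    · intro σ _ hσ; simp [hσ.symm]
    · simp
  · simp only [h, and_false, if_false]
    refine Finset.sum_eq_zero fun w _ => Finset.sum_eq_zero fun ρ _ => Finset.sum_eq_zero fun σ _ => ?_
    by_cases hρ : tgt ρ = tgt γ
    · rw [hρ, if_neg, mul_zero]
      exact fun h' => h h'.2
    · simp [circ_tgt D α γ ρ hρ]

theorem ext_basis {M : Type*} [AddCommGroup M] [Module ℂ M] {F K : Alg D → M} (hF : IsLinearMap ℂ F)
    (hK : IsLinearMap ℂ K) (h : ∀ x α β, F (f D x α β) = K (f D x α β)) (a : Alg D) : F a = K a :=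
  LinearMap.congr_fun (f := hF.mk' F) (g := hK.mk' K) ((basis D).ext fun ⟨x, α, β⟩ => h x α β) a

theorem counit_mul_mul (b c d : Alg D) :
    LinearMap.mul' ℂ ℂ (TensorProduct.map (counit ∘ₗ LinearMap.mulLeft ℂ b)
      (counit ∘ₗ LinearMap.mulRight ℂ d) (comul c)) = counit (R := ℂ) (b * c * d) := by
  revert b
  refine ext_basis D ⟨fun b b' => ?_, fun r b => ?_⟩ ⟨fun b b' => ?_, fun r b => ?_⟩ fun x α β => ?_
  · have : LinearMap.mulLeft ℂ (b + b') = LinearMap.mulLeft ℂ b + LinearMap.mulLeft ℂ b' := by ext; simp [add_mul]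
    rw [this, LinearMap.comp_add, TensorProduct.map_add_left]; simp
  · have : LinearMap.mulLeft ℂ (r • b) = r • LinearMap.mulLeft ℂ b := by ext; simp
    rw [this, LinearMap.comp_smul, TensorProduct.map_smul_left]; simp
  · simp [add_mul]
  · simp
  revert d
  refine ext_basis D ⟨fun b b' => ?_, fun r b => ?_⟩ ⟨fun b b' => ?_, fun r b => ?_⟩ fun z μ ν => ?_
  · have : LinearMap.mulRight ℂ (b + b') = LinearMap.mulRight ℂ b + LinearMap.mulRight ℂ b' := by ext; simp [mul_add]
    rw [this, LinearMap.comp_add, TensorProduct.map_add_right]; simp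
  · have : LinearMap.mulRight ℂ (r • b) = r • LinearMap.mulRight ℂ b := by ext; simp
    rw [this, LinearMap.comp_smul, TensorProduct.map_smul_right]; simp
  · simp [mul_add]
  · simp
  revert c
  refine ext_basis D ⟨fun b b' => ?_, fun r b => ?_⟩ ⟨fun b b' => ?_, fun r b => ?_⟩ fun y γ δ => ?_
  · simp
  · simp
  · simp [mul_add, add_mul]
  · simp
  rw [counit_mul_mul_f, comul_f]
  simp only [map_sum, TensorProduct.map_tmul, LinearMap.comp_apply, LinearMap.mulLeft_apply, LinearMap.mulRight_apply,
    counit_f_mul_f, LinearMap.mul'_apply]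
  rw [Finset.sum_eq_single γ]
  · by_cases h1 : α = β <;> by_cases h2 : γ = δ <;> by_cases h3 : tgt α = src γ <;> simp [h1, h2, h3]
    all_goals subst h2; simp_all
  · intro ρ _ h; simp [h.symm]
  · simp

end TambaraYamagami

namespace TambaraYamagami
open Idx
variable {G : Type u} [AddCommGroup G] [Fintype G] [DecidableEq G] (D : Datum G)
open CoalgebraStruct

theorem weight_ne_zero {x : Option G} (α : Idx G x) : (weight D α : ℂ) ≠ 0 := by
  have := tau_ne_zero D
  cases α <;> simp [weight] <;> simpa using this

theorem dualIdx_bijective (x : Option G) : Function.Bijective (dualIdx : Idx G x → Idx G (dual x)) := by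
  rcases x with _ | g
  · constructor
    · intro a b h; cases a <;> cases b <;> simp_all [dualIdx]
    · intro a; cases a with
      | el k => exact ⟨.bar k, rfl⟩
      | bar k => exact ⟨.el k, rfl⟩
  · constructor
    · intro a b h; cases a <;> cases b <;> simp_all [dualIdx]
    · intro a
      generalize hq : (-g : G) = q at a
      cases a with
      | pt k => subst hq; exact ⟨.pt (k + g), by simp [dualIdx]⟩
      | pm => subst hq; exact ⟨.pm, rfl⟩

theorem comul_star (b : Alg D) : comul (R := ℂ) (star b) = star (comul (R := ℂ) b) := by
  rw [← star_star (comul (R := ℂ) (star b))]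
  congr 1
  revert b
  refine ext_basis D ⟨fun b b' => ?_, fun r b => ?_⟩ ⟨fun b b' => ?_, fun r b => ?_⟩ fun x α β => ?_
  · simp
  · simp [star_smul]
  · simp
  · simp
  rw [star_f, comul_f, map_smul, comul_f, star_smul, star_sum]
  rw [← (dualIdx_bijective x).sum_comp, Finset.smul_sum]
  refine Finset.sum_congr rfl fun γ _ => ?_
  rw [← star_star (f D x α γ ⊗ₜ[ℂ] f D x γ β), ← star_smul]
  congr 1
  rw [TensorProduct.star_tmul, star_f, star_f, TensorProduct.smul_tmul_smul]
  congr 1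
  field_simp [weight_ne_zero D]

/-- The antipode of `B`: `S(f^x_{αβ}) = (w(α) / w(β)) f^{x*}_{β*α*}`.  For instance
`S(f^g_{h,k}) = f^{-g}_{k-g,h-g}`, `S(f^m_{g,h̄}) = τ⁻¹ f^m_{h,ḡ}`, `S(f^m_{ḡ,h}) = τ f^m_{h̄,g}`. -/
noncomputable def S : Alg D →ₗ[ℂ] Alg D :=
  (basis D).constr ℂ fun i => (weight D i.2.1 / weight D i.2.2 : ℂ) • f D (dual i.1) (dualIdx i.2.2) (dualIdx i.2.1)
theorem S_f (x) (α β : Idx G x) : S D (f D x α β) =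
  (weight D α / weight D β : ℂ) • f D (dual x) (dualIdx β) (dualIdx α) := (basis D).constr_basis ℂ _ _
theorem S_f_star (x) (α β : Idx G x) : S D (f D x α β) = star (f D x β α) := by
  rw [S_f, star_f]

theorem one_def : (1 : Alg D) = ∑ α, ∑ β, f D (some 0) α β := rfl

theorem S_one : S D 1 = 1 := by
  have h : S D 1 = star (1 : Alg D) := by
    rw [one_def]
    simp only [map_sum, S_f_star, star_sum]
    rw [Finset.sum_comm]
  rw [h, star_one]

theorem S_f_mul_f {x y : Option G} (α β : Idx G x) (γ δ : Idx G y) :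
    S D (f D x α β * f D y γ δ) = S D (f D y γ δ) * S D (f D x α β) := by
  rw [S_f_star, S_f_star, ← star_mul, f_mul_f, f_mul_f]
  simp only [map_sum, map_smul, S_f_star, star_sum, star_smul, star_star, star_mul]
  refine Finset.sum_congr rfl fun z _ => ?_
  rw [Finset.sum_comm]

theorem S_mul (b c : Alg D) : S D (b * c) = S D c * S D b := by
  revert b
  refine ext_basis D ⟨fun b b' => ?_, fun r b => ?_⟩ ⟨fun b b' => ?_, fun r b => ?_⟩ fun x α β => ?_
  · simp [add_mul]
  · simp
  · simp [mul_add]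
  · simp
  revert c
  refine ext_basis D ⟨fun b b' => ?_, fun r b => ?_⟩ ⟨fun b b' => ?_, fun r b => ?_⟩ fun y γ δ => ?_
  · simp [mul_add]
  · simp
  · simp [add_mul]
  · simp
  exact S_f_mul_f D _ _ _ _

theorem counit_S (b : Alg D) : counit (R := ℂ) (S D b) = counit (R := ℂ) b := by
  revert b
  refine ext_basis D ⟨fun b b' => ?_, fun r b => ?_⟩ ⟨fun b b' => ?_, fun r b => ?_⟩ fun x α β => ?_
  · simp
  · simp
  · simp
  · simp
  rw [S_f, map_smul, counit_f, counit_f]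
  by_cases h : α = β
  · subst h; rw [if_pos rfl, if_pos rfl, div_self (weight_ne_zero D α), one_smul]
  · rw [if_neg h, if_neg, smul_zero]
    exact fun h' => h ((dualIdx_bijective x).1 h').symm

theorem comul_S (b : Alg D) :
    comul (R := ℂ) (S D b) = TensorProduct.map (S D) (S D) (TensorProduct.comm ℂ _ _ (comul (R := ℂ) b)) := by
  revert b
  refine ext_basis D ⟨fun b b' => ?_, fun r b => ?_⟩ ⟨fun b b' => ?_, fun r b => ?_⟩ fun x α β => ?_
  · simp
  · simp
  · simp
  · simp
  rw [S_f, comul_f]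
  simp only [map_sum, map_smul, comul_f, TensorProduct.comm_tmul, TensorProduct.map_tmul, S_f]
  rw [← (dualIdx_bijective x).sum_comp, Finset.smul_sum]
  refine Finset.sum_congr rfl fun γ _ => ?_
  rw [TensorProduct.smul_tmul_smul]
  congr 1
  field_simp [weight_ne_zero D]

open scoped Classical in
theorem circ_zero (a c : Idx G (some 0)) (z) (μ : Idx G z) :
    circ D (some 0) (some 0) z a c μ = if a = c ∧ a.vec = μ.vec then 1 else 0 := by
  cases a <;> cases c <;> cases μ <;> simp [circ, circVec, vec] <;> grind

open scoped Classical in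
theorem f_zero_mul (a b c d : Idx G (some 0)) : f D (some 0) a b * f D (some 0) c d =
    if a = c ∧ b = d then f D (some 0) a b else 0 := by
  classical
  rw [f_mul_f]
  simp only [circ_zero D]
  trans ∑ z, ∑ μ : Idx G z, if μ.vec = a.vec then ∑ ν : Idx G z, if ν.vec = b.vec then if a = c ∧ b = d then f D z μ ν else 0 else 0 else 0
  · refine Finset.sum_congr rfl fun z _ => Finset.sum_congr rfl fun μ _ => ?_
    by_cases h : μ.vec = a.vec
    · rw [if_pos h]
      refine Finset.sum_congr rfl fun ν _ => ?_
      by_cases h3 : ν.vec = b.vec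
      · by_cases h1 : a = c <;> by_cases h2 : b = d <;> simp [h, h3, h1, h2]
      · simp [h3, Ne.symm h3]
    · rw [if_neg h]
      refine Finset.sum_eq_zero fun ν _ => ?_
      rw [if_neg (fun h' => h h'.2.symm), zero_mul, zero_smul]
  · rw [sum_vec (fun z μ => ∑ ν : Idx G z, if ν.vec = b.vec then if a = c ∧ b = d then f D z μ ν else 0 else 0)]
    rw [Finset.sum_eq_single b]
    · simp
    · intro ν _ h; rw [if_neg]
      intro h'
      have := sigma_eq_of_vec h'
      simp at this; exact h this
    · simp

theorem comul_one : comul (R := ℂ) (1 : Alg D) = ∑ a, ∑ b, ∑ c, f D (some 0) a b ⊗ₜ[ℂ] f D (some 0) b c := by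
  rw [one_def]
  simp only [map_sum, comul_f]
  refine Finset.sum_congr rfl fun _ _ => ?_
  rw [Finset.sum_comm]

theorem sum_mul_three {ι : Type*} (s : Finset ι) (F : ι → Alg D ⊗[ℂ] Alg D ⊗[ℂ] Alg D) (y : Alg D ⊗[ℂ] Alg D ⊗[ℂ] Alg D) :
    (∑ i ∈ s, F i) * y = ∑ i ∈ s, F i * y := by
  exact map_sum (AddMonoidHom.mulRight y) _ _
theorem mul_sum_three {ι : Type*} (s : Finset ι) (F : ι → Alg D ⊗[ℂ] Alg D ⊗[ℂ] Alg D) (y : Alg D ⊗[ℂ] Alg D ⊗[ℂ] Alg D) :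
    y * (∑ i ∈ s, F i) = ∑ i ∈ s, y * F i := by
  exact map_sum (AddMonoidHom.mulLeft y) _ _

theorem comul_one_mul :
    (comul (R := ℂ) (1 : Alg D) ⊗ₜ[ℂ] (1 : Alg D)) * (TensorProduct.assoc ℂ (Alg D) (Alg D) (Alg D)).symm ((1 : Alg D) ⊗ₜ[ℂ] comul (R := ℂ) (1 : Alg D)) =
      comul.rTensor (Alg D) (comul (R := ℂ) (1 : Alg D)) := by
  simp only [comul_one, map_sum, TensorProduct.sum_tmul, TensorProduct.tmul_sum, TensorProduct.assoc_symm_tmul,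
    LinearMap.rTensor_tmul, comul_f]
  have key : ∀ a b c, f D (some 0) a b ⊗ₜ[ℂ] f D (some 0) b c ⊗ₜ[ℂ] (1 : Alg D) *
      ∑ x, ∑ y, ∑ z, (1 : Alg D) ⊗ₜ[ℂ] f D (some 0) x y ⊗ₜ[ℂ] f D (some 0) y z =
      ∑ z, f D (some 0) a b ⊗ₜ[ℂ] f D (some 0) b c ⊗ₜ[ℂ] f D (some 0) c z := by
    intro a b c
    simp only [mul_sum_three, Algebra.TensorProduct.tmul_mul_tmul, one_mul, mul_one, f_zero_mul]
    rw [Finset.sum_eq_single b, Finset.sum_eq_single c]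
    · simp
    · intro x _ h; simp [h.symm]
    · simp
    · intro x _ h; simp [h.symm]
    · simp
  simp only [sum_mul_three, key]
  refine Finset.sum_congr rfl fun a _ => ?_
  refine (Finset.sum_congr rfl fun b _ => Finset.sum_comm).trans ?_
  rw [Finset.sum_comm]
  refine (Finset.sum_congr rfl fun b _ => Finset.sum_comm).trans ?_
  rw [Finset.sum_comm]

noncomputable def cst : Option G → ℂ
  | some _ => 1
  | none => (D.τ : ℂ)⁻¹

theorem conv_a {x z : Option G} (ν : Idx G z) :
    ∑ γ : Idx G x, (weight D γ : ℂ) * star (circ D x (dual x) z γ (dualIdx γ) ν) = if z = some 0 then 1 else 0 := by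
  rcases x with _ | g
  · rw [sum_none]
    cases ν <;> simp [circ, circVec, vec, dualIdx, weight, cst]
    · rename_i g k
      by_cases h : g = 0 <;> simp [h, Finset.filter_eq]
    · rename_i g
      rw [← sum_tau_chi D]
      refine Finset.sum_congr rfl fun k _ => ?_
      have := inv_star D g k
      rw [starRingEnd_apply, this, D.χ_symm, mul_assoc]
  · rw [sum_some]
    cases ν <;> simp [circ, circVec, vec, dualIdx, weight, cst]
    · rename_i g k
      by_cases h : g = 0
      · simp [h, sub_eq_neg_add, Finset.filter_eq, eq_neg_add_iff_add_eq]
      · simp [h]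

theorem conv_b {x : Option G} (α β : Idx G x) (μ : Idx G (some 0)) :
    circ D x (dual x) (some 0) α (dualIdx β) μ = if α = β ∧ tgt μ = src α then (weight D β : ℂ) else 0 := by
  cases α <;> cases β <;> cases μ <;> simp [circ, circVec, vec, dualIdx, weight, tgt, src, cst]
  · grind
  · grind
  · rw [chi_zero_left]; simp

theorem conv_c {x z : Option G} (μ : Idx G z) :
    ∑ γ : Idx G x, (weight D γ : ℂ)⁻¹ * circ D (dual x) x z (dualIdx γ) γ μ = if z = some 0 then cst D x else 0 := by
  rcases x with _ | g
  · rw [sum_none]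
    cases μ <;> simp [circ, circVec, vec, dualIdx, weight, cst]
    · rename_i g k
      by_cases h : g = 0 <;> simp [h]
    · rename_i g
      have ht := tau_ne_zero D
      trans (D.τ : ℂ)⁻¹ * (∑ x, (D.τ : ℂ) * D.τ * D.χ x (-g))
      · rw [Finset.mul_sum]
        refine Finset.sum_congr rfl fun k _ => ?_
        rw [chi_neg_right, D.χ_symm k g]
        field_simp
      · simp [sum_tau_chi]
  · rw [sum_some]
    cases μ <;> simp [circ, circVec, vec, dualIdx, weight, cst]
    · rename_i g k
      by_cases h : g = 0 <;> simp [h, Finset.filter_eq]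

theorem conv_d {x : Option G} (α β : Idx G x) (ν : Idx G (some 0)) :
    cst D x * weight D α * star (circ D (dual x) x (some 0) (dualIdx α) β ν) = if α = β ∧ tgt ν = tgt α then 1 else 0 := by
  cases α <;> cases β <;> cases ν <;> simp [circ, circVec, vec, dualIdx, weight, tgt, src, cst]
  · grind
  · have ht := tau_ne_zero D
    rename_i k l
    by_cases h : k = l
    · subst h; simp [-Complex.ofReal_eq_zero, ht, chi_zero_left]
    · simp [h, Ne.symm h]
  · have ht := tau_ne_zero D
    rw [inv_mul_cancel₀ ht]
    grind

end TambaraYamagami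

theorem exists_fin_of_matrix {B : Type*} [Ring B] [StarRing B] [Algebra ℂ B] {n : Type*} [Fintype n] [DecidableEq n]
    (ρ : B →⋆ₐ[ℂ] Matrix n n ℂ) (h : Function.Injective ρ) :
    ∃ (k : ℕ) (ρ : B →⋆ₐ[ℂ] Matrix (Fin k) (Fin k) ℂ), Function.Injective ρ := by
  let e := Fintype.equivFin n
  let E : Matrix n n ℂ ≃ₐ[ℂ] Matrix (Fin (Fintype.card n)) (Fin (Fintype.card n)) ℂ := Matrix.reindexAlgEquiv ℂ ℂ e
  refine ⟨Fintype.card n, { toAlgHom := (E : _ →ₐ[ℂ] _).comp (ρ : B →ₐ[ℂ] Matrix n n ℂ), map_star' := fun b => ?_ }, ?_⟩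
  · change E (ρ (star b)) = star (E (ρ b))
    rw [map_star]
    rfl
  · exact E.injective.comp h

namespace TambaraYamagami
open Idx
variable {G : Type u} [AddCommGroup G] [Fintype G] [DecidableEq G] (D : Datum G)
open CoalgebraStruct

theorem S_axiom_right (b : Alg D) :
    LinearMap.mul' ℂ _ ((S D).lTensor _ (comul b)) =
      TensorProduct.lid ℂ _ (counit.rTensor _ (comul 1 * (b ⊗ₜ[ℂ] (1 : Alg D)))) := by
  revert b
  refine ext_basis D ⟨fun b b' => ?_, fun r b => ?_⟩ ⟨fun b b' => ?_, fun r b => ?_⟩ fun x α β => ?_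
  · simp
  · simp
  · simp [TensorProduct.add_tmul, mul_add]
  · rw [← TensorProduct.smul_tmul', mul_smul_comm]; simp
  trans ∑ μ, ∑ ν, if α = β ∧ tgt μ = src α then f D (some 0) μ ν else 0
  · rw [comul_f]
    simp only [map_sum, LinearMap.lTensor_tmul, LinearMap.mul'_apply, S_f, mul_smul_comm, f_mul_f, sum_triple, Finset.smul_sum, smul_smul]
    rw [Finset.sum_comm]
    rw [← sum_triple (fun z μ ν => ∑ γ, ((weight D γ : ℂ) / weight D β * (circ D x (dual x) z α (dualIdx β) μ * star (circ D x (dual x) z γ (dualIdx γ) ν))) • f D z μ ν)]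
    trans ∑ z, if z = some 0 then ∑ μ, ∑ ν, ((weight D β : ℂ)⁻¹ * circ D x (dual x) z α (dualIdx β) μ) • f D z μ ν else 0
    · refine Finset.sum_congr rfl fun z _ => ?_
      have : ∀ μ ν, ∑ γ, ((weight D γ : ℂ) / weight D β * (circ D x (dual x) z α (dualIdx β) μ * star (circ D x (dual x) z γ (dualIdx γ) ν))) • f D z μ ν
          = if z = some 0 then ((weight D β : ℂ)⁻¹ * circ D x (dual x) z α (dualIdx β) μ) • f D z μ ν else 0 := by
        intro μ ν
        rw [← Finset.sum_smul]
        trans ((weight D β : ℂ)⁻¹ * circ D x (dual x) z α (dualIdx β) μ * ∑ γ, weight D γ * star (circ D x (dual x) z γ (dualIdx γ) ν)) • f D z μ ν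
        · rw [Finset.mul_sum]
          congr 1
          refine Finset.sum_congr rfl fun γ _ => ?_
          ring
        · rw [conv_a]; split_ifs <;> simp
      simp only [this]
      split_ifs <;> simp
    · rw [Finset.sum_ite_eq' Finset.univ (some 0), if_pos (Finset.mem_univ _)]
      refine Finset.sum_congr rfl fun μ _ => Finset.sum_congr rfl fun ν _ => ?_
      rw [conv_b]
      split_ifs
      · rw [inv_mul_cancel₀ (weight_ne_zero D β), one_smul]
      · simp
  · rw [comul_one]
    simp only [Finset.sum_mul, Algebra.TensorProduct.tmul_mul_tmul, mul_one, map_sum, LinearMap.rTensor_tmul, counit_f_mul_f, TensorProduct.lid_tmul]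
    symm
    refine Finset.sum_congr rfl fun a _ => ?_
    rw [Finset.sum_eq_single a]
    · refine Finset.sum_congr rfl fun ν _ => ?_
      by_cases h : α = β ∧ tgt a = src α <;> simp [h]
    · intro b _ h
      simp [h.symm]
    · simp

theorem S_axiom_left (b : Alg D) :
    LinearMap.mul' ℂ _ ((S D).rTensor _ (comul b)) =
      TensorProduct.rid ℂ _ (counit.lTensor _ (((1 : Alg D) ⊗ₜ[ℂ] b) * comul 1)) := by
  revert b
  refine ext_basis D ⟨fun b b' => ?_, fun r b => ?_⟩ ⟨fun b b' => ?_, fun r b => ?_⟩ fun x α β => ?_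
  · simp
  · simp
  · simp [TensorProduct.tmul_add, add_mul]
  · rw [TensorProduct.tmul_smul, smul_mul_assoc]; simp
  trans ∑ μ, ∑ ν, if α = β ∧ tgt ν = tgt α then f D (some 0) μ ν else 0
  · rw [comul_f]
    simp only [map_sum, LinearMap.rTensor_tmul, LinearMap.mul'_apply, S_f, smul_mul_assoc, f_mul_f, sum_triple, Finset.smul_sum, smul_smul]
    rw [Finset.sum_comm]
    rw [← sum_triple (fun z μ ν => ∑ γ, ((weight D α : ℂ) / weight D γ * (circ D (dual x) x z (dualIdx γ) γ μ * star (circ D (dual x) x z (dualIdx α) β ν))) • f D z μ ν)]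
    trans ∑ z, if z = some 0 then ∑ μ, ∑ ν, (cst D x * weight D α * star (circ D (dual x) x z (dualIdx α) β ν)) • f D z μ ν else 0
    · refine Finset.sum_congr rfl fun z _ => ?_
      have : ∀ μ ν, ∑ γ, ((weight D α : ℂ) / weight D γ * (circ D (dual x) x z (dualIdx γ) γ μ * star (circ D (dual x) x z (dualIdx α) β ν))) • f D z μ ν
          = if z = some 0 then (cst D x * weight D α * star (circ D (dual x) x z (dualIdx α) β ν)) • f D z μ ν else 0 := by
        intro μ ν
        rw [← Finset.sum_smul]
        trans ((weight D α : ℂ) * star (circ D (dual x) x z (dualIdx α) β ν) * ∑ γ, (weight D γ : ℂ)⁻¹ * (circ D (dual x) x z (dualIdx γ) γ μ)) • f D z μ ν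
        · rw [Finset.mul_sum]
          congr 1
          refine Finset.sum_congr rfl fun γ _ => ?_
          ring
        · rw [conv_c]; split_ifs
          · congr 1; ring
          · simp
      simp only [this]
      split_ifs <;> simp
    · rw [Finset.sum_ite_eq' Finset.univ (some 0), if_pos (Finset.mem_univ _)]
      refine Finset.sum_congr rfl fun μ _ => Finset.sum_congr rfl fun ν _ => ?_
      rw [conv_d]
      split_ifs <;> simp
  · rw [comul_one]
    simp only [Finset.mul_sum, Algebra.TensorProduct.tmul_mul_tmul, one_mul, map_sum, LinearMap.lTensor_tmul, counit_f_mul_f, TensorProduct.rid_tmul]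
    symm
    refine Finset.sum_congr rfl fun a _ => Finset.sum_congr rfl fun b _ => ?_
    have hs : ∀ b : Idx G (some 0), src b = tgt b := by
      intro b; cases b <;> simp [src, tgt]
    rw [Finset.sum_eq_single b]
    · by_cases h : α = β <;> simp [h, hs, eq_comm]
    · intro c _ h
      simp [h.symm]
    · simp

theorem faithful : ∃ (n : ℕ) (ρ : Alg D →⋆ₐ[ℂ] Matrix (Fin n) (Fin n) ℂ), Function.Injective ρ := by
  let F : Alg D → Matrix ((Option G × G) ⊕ (G ⊕ G)) ((Option G × G) ⊕ (G ⊕ G)) ℂ := fun a =>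
    Matrix.fromBlocks (Matrix.blockDiagonal (mats D a).1) 0 0 (mats D a).2
  have h1 : F 1 = 1 := by
    simp only [F, mats_one, Prod.fst_one, Prod.snd_one, Matrix.blockDiagonal_one, Matrix.fromBlocks_one]
  have hm : ∀ a b, F (a * b) = F a * F b := by
    intro a b
    simp only [F, mats_mul, Prod.fst_mul, Prod.snd_mul, Matrix.fromBlocks_multiply]
    congr 1 <;> simp
    exact Matrix.blockDiagonal_mul _ _
  have hadd : ∀ a b, F (a + b) = F a + F b := by
    intro a b
    simp only [F, mats_add, Prod.fst_add, Prod.snd_add, Matrix.fromBlocks_add, Matrix.blockDiagonal_add, add_zero]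
  have hs : ∀ (c : ℂ) a, F (c • a) = c • F a := by
    intro a b
    simp only [F, mats_smul, Prod.smul_fst, Prod.smul_snd, Matrix.fromBlocks_smul, Matrix.blockDiagonal_smul, smul_zero]
  have hstar : ∀ a, F (star a) = star (F a) := by
    intro a
    simp only [F, mats_star, Prod.fst_star, Prod.snd_star, Matrix.star_eq_conjTranspose, Matrix.fromBlocks_conjTranspose,
      Matrix.conjTranspose_zero, Matrix.blockDiagonal_conjTranspose]
    rfl
  let ρ : Alg D →⋆ₐ[ℂ] Matrix ((Option G × G) ⊕ (G ⊕ G)) ((Option G × G) ⊕ (G ⊕ G)) ℂ :=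
   { toAlgHom := AlgHom.ofLinearMap { toFun := F, map_add' := hadd, map_smul' := hs } h1 hm
     map_star' := hstar }
  refine exists_fin_of_matrix ρ fun a b h => mats_injective D ?_
  obtain ⟨h1, -, -, h2⟩ := Matrix.fromBlocks_inj.1 (show F a = F b from h)
  exact Prod.ext (Matrix.blockDiagonal_injective h1) h2

/-- The Tambara-Yamagami weak Hopf `C*`-algebra. -/
noncomputable instance : WeakHopfCStarAlgebra (Alg D) where
  finiteDimensional := (basis D).finiteDimensional_of_finite
  exists_faithful := faithful D
  comul_mul := comul_mul D
  comul_star := comul_star D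
  counit_mul_mul := counit_mul_mul D
  comul_one_mul := comul_one_mul D
  antipode := S D
  antipode_one := S_one D
  antipode_mul := S_mul D
  counit_antipode := counit_S D
  comul_antipode := comul_S D
  mul_antipode_right := S_axiom_right D
  mul_antipode_left := S_axiom_left D

end TambaraYamagami

namespace WeakHopfTransfer
open CoalgebraStruct
variable {B C : Type*} [Ring B] [StarRing B] [Algebra ℂ B] [StarModule ℂ B] [WeakHopfCStarAlgebra B]
  [Ring C] [StarRing C] [Algebra ℂ C] [StarModule ℂ C] [CoalgebraStruct ℂ C]

noncomputable abbrev lin (π : B →⋆ₐ[ℂ] C) : B →ₗ[ℂ] C := (π : B →ₐ[ℂ] C).toLinearMap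
noncomputable abbrev two (π : B →⋆ₐ[ℂ] C) : B ⊗[ℂ] B →ₗ[ℂ] C ⊗[ℂ] C := TensorProduct.map (lin π) (lin π)

/-- A surjective `*`-homomorphism onto `C` that intertwines the structure maps; the laws of a weak Hopf
algebra then pass from `B` to `C`. -/
structure Epi (π : B →⋆ₐ[ℂ] C) (SC : C →ₗ[ℂ] C) : Prop where
  surj : Function.Surjective π
  comul (b : B) : comul (R := ℂ) (π b) = two π (comul (R := ℂ) b)
  counit (b : B) : counit (R := ℂ) (π b) = counit (R := ℂ) b
  antipode (b : B) : SC (π b) = π (WeakHopfCStarAlgebra.antipode b)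

variable (π : B →⋆ₐ[ℂ] C) {SC : C →ₗ[ℂ] C}

theorem two_mul (s t : B ⊗[ℂ] B) : two π (s * t) = two π s * two π t :=
  map_mul (Algebra.TensorProduct.map (π : B →ₐ[ℂ] C) (π : B →ₐ[ℂ] C)) s t
theorem two_star (t : B ⊗[ℂ] B) : two π (star t) = star (two π t) := by
  induction t with
  | zero => simp
  | tmul x y => simp [two, lin, TensorProduct.star_tmul, map_star]
  | add x y hx hy => simp [star_add, map_add, hx, hy]

theorem rT (H : Epi π SC) (t : B ⊗[ℂ] B) : comul.rTensor C (two π t) = TensorProduct.map (two π) (lin π) (comul.rTensor B t) := by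
  induction t with
  | zero => simp
  | tmul x y => simp only [two, TensorProduct.map_tmul, LinearMap.rTensor_tmul]; congr 1; exact H.comul x
  | add x y hx hy => simp only [map_add, hx, hy]
theorem lT (H : Epi π SC) (t : B ⊗[ℂ] B) : comul.lTensor C (two π t) = TensorProduct.map (lin π) (two π) (comul.lTensor B t) := by
  induction t with
  | zero => simp
  | tmul x y => simp only [two, TensorProduct.map_tmul, LinearMap.lTensor_tmul]; congr 1; exact H.comul y
  | add x y hx hy => simp only [map_add, hx, hy]
theorem asc (t : (B ⊗[ℂ] B) ⊗[ℂ] B) : TensorProduct.assoc ℂ C C C (TensorProduct.map (two π) (lin π) t) =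
    TensorProduct.map (lin π) (two π) (TensorProduct.assoc ℂ B B B t) := by
  exact LinearMap.congr_fun (TensorProduct.map_map_comp_assoc_eq (lin π) (lin π) (lin π)).symm t

theorem coassoc (H : Epi π SC) : TensorProduct.assoc ℂ C C C ∘ₗ comul.rTensor C ∘ₗ comul (R := ℂ) (A := C) = comul.lTensor C ∘ₗ comul := by
  ext c
  obtain ⟨b, rfl⟩ := H.surj c
  change TensorProduct.assoc ℂ C C C (comul.rTensor C (comul (π b))) = comul.lTensor C (comul (π b))
  rw [H.comul, rT π H, lT π H, asc π]
  congr 1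
  exact Coalgebra.coassoc_apply b

theorem rTensor_counit (H : Epi π SC) : counit.rTensor C ∘ₗ comul (R := ℂ) (A := C) = TensorProduct.mk ℂ _ _ 1 := by
  ext c
  obtain ⟨b, rfl⟩ := H.surj c
  change counit.rTensor C (comul (π b)) = 1 ⊗ₜ π b
  rw [H.comul]
  have : ∀ t, counit.rTensor C (two π t) = (lin π).lTensor ℂ (counit.rTensor B t) := by
    intro t
    induction t with
    | zero => simp
    | tmul x y => simp only [two, TensorProduct.map_tmul, LinearMap.rTensor_tmul, LinearMap.lTensor_tmul]; congr 1; exact H.counit x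
    | add x y hx hy => simp only [map_add, hx, hy]
  rw [this, Coalgebra.rTensor_counit_comul, LinearMap.lTensor_tmul]
  rfl
theorem lTensor_counit (H : Epi π SC) : counit.lTensor C ∘ₗ comul (R := ℂ) (A := C) = (TensorProduct.mk ℂ _ _).flip 1 := by
  ext c
  obtain ⟨b, rfl⟩ := H.surj c
  change counit.lTensor C (comul (π b)) = π b ⊗ₜ 1
  rw [H.comul]
  have : ∀ t, counit.lTensor C (two π t) = (lin π).rTensor ℂ (counit.lTensor B t) := by
    intro t
    induction t with
    | zero => simp
    | tmul x y => simp only [two, TensorProduct.map_tmul, LinearMap.rTensor_tmul, LinearMap.lTensor_tmul]; congr 1; exact H.counit y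
    | add x y hx hy => simp only [map_add, hx, hy]
  rw [this, Coalgebra.lTensor_counit_comul, LinearMap.rTensor_tmul]
  rfl

theorem comul_mul (H : Epi π SC) (b c : C) : comul (R := ℂ) (b * c) = comul (R := ℂ) b * comul (R := ℂ) c := by
  obtain ⟨b, rfl⟩ := H.surj b
  obtain ⟨c, rfl⟩ := H.surj c
  rw [← map_mul, H.comul, H.comul, H.comul, ← two_mul, WeakHopfCStarAlgebra.comul_mul]
theorem comul_star (H : Epi π SC) (b : C) : comul (R := ℂ) (star b) = star (comul (R := ℂ) b) := by
  obtain ⟨b, rfl⟩ := H.surj b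
  rw [← map_star, H.comul, H.comul, ← two_star, WeakHopfCStarAlgebra.comul_star]
theorem counit_mul_mul (H : Epi π SC) (b c d : C) :
    LinearMap.mul' ℂ ℂ (TensorProduct.map (counit ∘ₗ LinearMap.mulLeft ℂ b)
      (counit ∘ₗ LinearMap.mulRight ℂ d) (comul c)) = counit (R := ℂ) (b * c * d) := by
  obtain ⟨b, rfl⟩ := H.surj b
  obtain ⟨c, rfl⟩ := H.surj c
  obtain ⟨d, rfl⟩ := H.surj d
  rw [← map_mul, ← map_mul, H.counit, ← WeakHopfCStarAlgebra.counit_mul_mul, H.comul]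
  congr 1
  generalize (comul (R := ℂ) c) = t
  induction t with
  | zero => simp
  | tmul x y =>
    simp only [two, TensorProduct.map_tmul, LinearMap.comp_apply, LinearMap.mulLeft_apply, LinearMap.mulRight_apply]
    congr 1
    · rw [← H.counit, map_mul π]; rfl
    · rw [← H.counit, map_mul π]; rfl
  | add x y hx hy => simp only [map_add, hx, hy]
theorem comul_one_mul (H : Epi π SC) :
    (comul (R := ℂ) (1 : C) ⊗ₜ[ℂ] (1 : C)) * (TensorProduct.assoc ℂ C C C).symm ((1 : C) ⊗ₜ[ℂ] comul (R := ℂ) (1 : C)) =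
      comul.rTensor C (comul (R := ℂ) (1 : C)) := by
  have h1 : comul (R := ℂ) (1 : C) = two π (comul (R := ℂ) (1 : B)) := by rw [← H.comul, map_one π]
  rw [h1, rT π H, ← WeakHopfCStarAlgebra.comul_one_mul]
  have h3 := map_mul (Algebra.TensorProduct.map (Algebra.TensorProduct.map (π : B →ₐ[ℂ] C) (π : B →ₐ[ℂ] C)) (π : B →ₐ[ℂ] C))
    (comul (R := ℂ) (1 : B) ⊗ₜ[ℂ] (1 : B)) ((TensorProduct.assoc ℂ B B B).symm ((1 : B) ⊗ₜ[ℂ] comul (R := ℂ) (1 : B)))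
  refine Eq.trans ?_ h3.symm
  congr 1
  · change _ = two π _ ⊗ₜ[ℂ] π 1
    rw [map_one π]
  · rw [LinearEquiv.symm_apply_eq]
    have := asc π ((TensorProduct.assoc ℂ B B B).symm ((1 : B) ⊗ₜ[ℂ] comul (R := ℂ) (1 : B)))
    refine Eq.trans ?_ this.symm
    rw [LinearEquiv.apply_symm_apply, TensorProduct.map_tmul]
    congr 1
    exact (map_one π).symm

theorem antipode_one (H : Epi π SC) : SC 1 = 1 := by
  rw [← map_one π, H.antipode, WeakHopfCStarAlgebra.antipode_one]
theorem antipode_mul (H : Epi π SC) (b c : C) : SC (b * c) = SC c * SC b := by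
  obtain ⟨b, rfl⟩ := H.surj b
  obtain ⟨c, rfl⟩ := H.surj c
  rw [← map_mul, H.antipode, H.antipode, H.antipode, ← map_mul, WeakHopfCStarAlgebra.antipode_mul]
theorem counit_antipode (H : Epi π SC) (b : C) : counit (R := ℂ) (SC b) = counit (R := ℂ) b := by
  obtain ⟨b, rfl⟩ := H.surj b
  rw [H.antipode, H.counit, H.counit, WeakHopfCStarAlgebra.counit_antipode]
theorem comul_antipode (H : Epi π SC) (b : C) :
    comul (R := ℂ) (SC b) = TensorProduct.map SC SC (TensorProduct.comm ℂ C C (comul (R := ℂ) b)) := by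
  obtain ⟨b, rfl⟩ := H.surj b
  rw [H.antipode, H.comul, H.comul, WeakHopfCStarAlgebra.comul_antipode]
  generalize (comul (R := ℂ) b) = t
  induction t with
  | zero => simp
  | tmul x y =>
    simp only [two, TensorProduct.map_tmul, TensorProduct.comm_tmul]
    congr 1
    · exact (H.antipode y).symm
    · exact (H.antipode x).symm
  | add x y hx hy => simp only [map_add, hx, hy]
theorem mul_antipode_right (H : Epi π SC) (b : C) :
    LinearMap.mul' ℂ C (SC.lTensor C (comul b)) =
      TensorProduct.lid ℂ C (counit.rTensor C (comul 1 * (b ⊗ₜ[ℂ] (1 : C)))) := by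
  obtain ⟨b, rfl⟩ := H.surj b
  have h1 : comul (R := ℂ) (1 : C) = two π (comul (R := ℂ) (1 : B)) := by rw [← H.comul, map_one π]
  have h2 : (π b ⊗ₜ[ℂ] (1 : C)) = two π (b ⊗ₜ[ℂ] (1 : B)) := by
    rw [← map_one π]; rfl
  rw [h1, h2, ← two_mul, H.comul]
  have h3 : ∀ t, TensorProduct.lid ℂ C (counit.rTensor C (two π t)) = π (TensorProduct.lid ℂ B (counit.rTensor B t)) := by
    intro t
    induction t with
    | zero => simp
    | tmul x y =>
      simp only [two, TensorProduct.map_tmul, LinearMap.rTensor_tmul, TensorProduct.lid_tmul, map_smul]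
      congr 1; exact H.counit x
    | add x y hx hy => simp only [map_add, hx, hy]
  rw [h3, ← WeakHopfCStarAlgebra.mul_antipode_right]
  generalize (comul (R := ℂ) b) = t
  induction t with
  | zero => simp
  | tmul x y =>
    simp only [two, TensorProduct.map_tmul, LinearMap.lTensor_tmul, LinearMap.mul'_apply, map_mul]
    congr 1
    exact H.antipode y
  | add x y hx hy => simp only [map_add, hx, hy]
theorem mul_antipode_left (H : Epi π SC) (b : C) :
    LinearMap.mul' ℂ C (SC.rTensor C (comul b)) =
      TensorProduct.rid ℂ C (counit.lTensor C (((1 : C) ⊗ₜ[ℂ] b) * comul 1)) := by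
  obtain ⟨b, rfl⟩ := H.surj b
  have h1 : comul (R := ℂ) (1 : C) = two π (comul (R := ℂ) (1 : B)) := by rw [← H.comul, map_one π]
  have h2 : ((1 : C) ⊗ₜ[ℂ] π b) = two π ((1 : B) ⊗ₜ[ℂ] b) := by
    rw [← map_one π]; rfl
  rw [h1, h2, ← two_mul, H.comul]
  have h3 : ∀ t, TensorProduct.rid ℂ C (counit.lTensor C (two π t)) = π (TensorProduct.rid ℂ B (counit.lTensor B t)) := by
    intro t
    induction t with
    | zero => simp
    | tmul x y =>
      simp only [two, TensorProduct.map_tmul, LinearMap.lTensor_tmul, TensorProduct.rid_tmul, map_smul]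
      congr 1; exact H.counit y
    | add x y hx hy => simp only [map_add, hx, hy]
  rw [h3, ← WeakHopfCStarAlgebra.mul_antipode_left]
  generalize (comul (R := ℂ) b) = t
  induction t with
  | zero => simp
  | tmul x y =>
    simp only [two, TensorProduct.map_tmul, LinearMap.rTensor_tmul, LinearMap.mul'_apply, map_mul]
    congr 1
    exact H.antipode x
  | add x y hx hy => simp only [map_add, hx, hy]
end WeakHopfTransfer

namespace TambaraYamagami
open Idx
variable {G : Type u} [AddCommGroup G] [Fintype G] [DecidableEq G] (D : Datum G)
open CoalgebraStruct

/-- The algebra `B_L = ⨁_{l ∈ L} B^l` for a subgroup `L` of `G`. -/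
def SubAlg (_D : Datum G) (L : AddSubgroup G) : Type u := L → Matrix (Option G) (Option G) ℂ

section
variable (L : AddSubgroup G)
noncomputable instance : Ring (SubAlg D L) := inferInstanceAs (Ring (L → Matrix (Option G) (Option G) ℂ))
noncomputable instance : StarRing (SubAlg D L) := inferInstanceAs (StarRing (L → Matrix (Option G) (Option G) ℂ))
noncomputable instance : Algebra ℂ (SubAlg D L) := inferInstanceAs (Algebra ℂ (L → Matrix (Option G) (Option G) ℂ))
instance : StarModule ℂ (SubAlg D L) := inferInstanceAs (StarModule ℂ (L → Matrix (Option G) (Option G) ℂ))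
noncomputable instance : Fintype L := Fintype.ofFinite L

/-- The basis of `B_L` that consists of the matrix units. -/
noncomputable def subBasis : Module.Basis (Σ _ : L, Option G × Option G) ℂ (SubAlg D L) :=
  Pi.basis fun _ : L => Matrix.stdBasis ℂ (Option G) (Option G)

/-- The matrix unit `e^l_{ab}` of `B_L`. -/
noncomputable abbrev e {L : AddSubgroup G} (l : L) (a b : Option G) : SubAlg D L := subBasis D L ⟨l, a, b⟩

/-- `a - l`, with the convention `m - l = m`. -/
def shift (a : Option G) (l : G) : Option G := a.map (· - l)

/-- `Δ_L(e^l_{ab}) = ∑_{l₁ + l₂ = l} e^{l₁}_{a-l₂,b-l₂} ⊗ e^{l₂}_{ab}` (with `l₁, l₂ ∈ L`) and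
`ε_L(e^l_{ab}) = δ_{l,0}`. -/
noncomputable instance : CoalgebraStruct ℂ (SubAlg D L) where
  comul := (subBasis D L).constr ℂ fun i =>
    ∑ l₂ : L, e D (i.1 - l₂) (shift i.2.1 l₂) (shift i.2.2 l₂) ⊗ₜ[ℂ] e D l₂ i.2.1 i.2.2
  counit := (subBasis D L).constr ℂ fun i => if i.1 = 0 then 1 else 0

/-- `S_L(e^l_{ab}) = e^{-l}_{b-l,a-l}`. -/
noncomputable def subAntipode : SubAlg D L →ₗ[ℂ] SubAlg D L :=
  (subBasis D L).constr ℂ fun i => e D (-i.1) (shift i.2.2 i.1) (shift i.2.1 i.1)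

/-- The canonical projection `π_L : B → B_L`: it maps `e^l_{ab}` to `e^l_{ab}` if `l ∈ L`, to `0` if
`l ∈ G` is not in `L`, and it vanishes on `B^m`. -/
noncomputable def subProj : Alg D →⋆ₐ[ℂ] SubAlg D L where
  toFun a := fun l => blk D l a
  map_one' := funext fun l => blk_one D l
  map_mul' a b := funext fun l => blk_mul D a b l
  map_zero' := funext fun l => by
    have := blk_smul D 0 0 (l : G)
    simp only [zero_smul] at this
    exact this
  map_add' a b := funext fun l => blk_add D a b l
  commutes' c := funext fun l => by
    rw [Algebra.algebraMap_eq_smul_one]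
    exact (blk_smul D 1 c (l : G)).trans (by rw [blk_one, Algebra.algebraMap_eq_smul_one]; rfl)
  map_star' a := funext fun l => blk_star D a l

open scoped Classical in
/-- `e^l_{ab}` if `l ∈ L`, and `0` otherwise. -/
noncomputable def E (l : G) (a b : Option G) : SubAlg D L := if h : l ∈ L then e D ⟨l, h⟩ a b else 0

variable {L}
theorem E_mem (l : L) (a b : Option G) : E D L l a b = e D l a b := by
  simp [E]
theorem E_not {l : G} (h : l ∉ L) (a b : Option G) : E D L l a b = 0 := by
  simp [E, h]
theorem E_apply (l : G) (a b : Option G) (l' : L) : E D L l a b l' = if (l' : G) = l then Matrix.single a b 1 else 0 := by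
  by_cases h : l ∈ L
  · obtain ⟨l, rfl⟩ : ∃ x : L, (x : G) = l := ⟨⟨l, h⟩, rfl⟩
    rw [E_mem]
    refine (congrFun (Pi.basis_apply (fun _ : L => Matrix.stdBasis ℂ (Option G) (Option G)) ⟨l, (a, b)⟩) l').trans ?_
    rw [Matrix.stdBasis_eq_single]
    by_cases h : l' = l
    · subst h; simp
    · rw [Pi.single_eq_of_ne h, if_neg (fun h' => h (Subtype.ext h'))]
  · rw [E_not D h, if_neg]; rfl
    rintro rfl; exact h l'.2

theorem E_apply' (l : G) (a b : Option G) (l' : L) (i j : Option G) :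
    E D L l a b l' i j = if (l' : G) = l ∧ a = i ∧ b = j then 1 else 0 := by
  rw [E_apply]
  by_cases h : (l' : G) = l <;> simp [h, Matrix.single_apply]

variable (L)
theorem comul_E (l : G) (a b : Option G) : comul (R := ℂ) (E D L l a b) =
    ∑ q : G, E D L (l - q) (shift a q) (shift b q) ⊗ₜ[ℂ] E D L q a b := by
  classical
  by_cases h : l ∈ L
  · obtain ⟨l, rfl⟩ : ∃ x : L, (x : G) = l := ⟨⟨l, h⟩, rfl⟩
    rw [E_mem]
    refine ((subBasis D L).constr_basis ℂ _ _).trans ?_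
    symm
    refine (Finset.sum_subset (Finset.subset_univ (Finset.univ.filter (· ∈ L))) ?_).symm.trans ?_
    · intro q _ hq
      rw [E_not D (l := q) (by simpa using hq), TensorProduct.tmul_zero]
    · rw [Finset.sum_subtype (p := (· ∈ L)) _ (by simp)]
      refine Finset.sum_congr rfl fun q _ => ?_
      rw [E_mem]
      congr 1
      exact E_mem D (l - q) _ _
  · rw [E_not D h, map_zero, Finset.sum_eq_zero]
    intro q _
    by_cases hq : q ∈ L
    · rw [E_not D (fun h' => h (by simpa using add_mem h' hq)), TensorProduct.zero_tmul]
    · rw [E_not D hq, TensorProduct.tmul_zero]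
theorem counit_E (l : G) (a b : Option G) : counit (R := ℂ) (E D L l a b) = if l = 0 then 1 else 0 := by
  by_cases h : l ∈ L
  · obtain ⟨l, rfl⟩ : ∃ x : L, (x : G) = l := ⟨⟨l, h⟩, rfl⟩
    rw [E_mem]
    refine ((subBasis D L).constr_basis ℂ _ _).trans ?_
    simp
  · rw [E_not D h, map_zero, if_neg]
    rintro rfl; exact h (zero_mem L)
theorem antipode_E (l : G) (a b : Option G) : subAntipode D L (E D L l a b) = E D L (-l) (shift b l) (shift a l) := by
  by_cases h : l ∈ L
  · obtain ⟨l, rfl⟩ : ∃ x : L, (x : G) = l := ⟨⟨l, h⟩, rfl⟩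
    rw [E_mem]
    refine ((subBasis D L).constr_basis ℂ _ _).trans ?_
    exact (E_mem D (-l) _ _).symm
  · rw [E_not D h, map_zero, E_not]
    simpa using h
end
open scoped Classical in
theorem cf_f_vec (x y : Option G) (α β : Idx G x) (μ ν : Idx G y) :
    cf D (f D x α β) y μ ν = if α.vec = μ.vec ∧ β.vec = ν.vec then 1 else 0 := by
  rw [cf_f]
  congr 1
  refine propext ⟨fun h => ?_, fun h => ?_⟩
  · cases h; exact ⟨rfl, rfl⟩
  · have h1 := sigma_eq_of_vec h.1
    cases h1
    have h2 := sigma_eq_of_vec h.2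
    simp at h2
    rw [h2]
section
variable (L : AddSubgroup G) (p h k : G)
theorem proj_apply (a : Alg D) (l : L) : subProj D L a l = blk D l a := rfl
theorem proj_tt : subProj D L (f D (some p) (.pt h) (.pt k)) = E D L (h - k) (some (p - k)) (some (-k)) := by
  funext l
  ext i j
  rw [E_apply', proj_apply]
  rcases i with _ | i <;> rcases j with _ | j <;> simp [Alg.tt, Alg.mm, Alg.ee, Alg.bb, cf_f_vec, vec]
  grind
theorem proj_tm : subProj D L (f D (some p) (.pt h) .pm) = 0 := by
  funext l
  ext i j
  rw [proj_apply]
  change _ = (0 : ℂ)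
  rcases i with _ | i <;> rcases j with _ | j <;> simp [Alg.tt, Alg.mm, Alg.ee, Alg.bb, cf_f_vec, vec]
theorem proj_mt : subProj D L (f D (some p) .pm (.pt h)) = 0 := by
  funext l
  ext i j
  rw [proj_apply]
  change _ = (0 : ℂ)
  rcases i with _ | i <;> rcases j with _ | j <;> simp [Alg.tt, Alg.mm, Alg.ee, Alg.bb, cf_f_vec, vec]
theorem proj_eb : subProj D L (f D none (.el h) (.bar k)) = 0 := by
  funext l
  ext i j
  rw [proj_apply]
  change _ = (0 : ℂ)
  rcases i with _ | i <;> rcases j with _ | j <;> simp [Alg.tt, Alg.mm, Alg.ee, Alg.bb, cf_f_vec, vec]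
theorem proj_be : subProj D L (f D none (.bar h) (.el k)) = 0 := by
  funext l
  ext i j
  rw [proj_apply]
  change _ = (0 : ℂ)
  rcases i with _ | i <;> rcases j with _ | j <;> simp [Alg.tt, Alg.mm, Alg.ee, Alg.bb, cf_f_vec, vec]
theorem proj_ee : subProj D L (f D none (.el h) (.el k)) = E D L (h - k) (some (-k)) none := by
  funext l
  ext i j
  rw [E_apply', proj_apply]
  rcases i with _ | i <;> rcases j with _ | j <;> simp [Alg.tt, Alg.mm, Alg.ee, Alg.bb, cf_f_vec, vec]
  grind
theorem proj_bb : subProj D L (f D none (.bar h) (.bar k)) = E D L (h - k) none (some (-k)) := by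
  funext l
  ext i j
  rw [E_apply', proj_apply]
  rcases i with _ | i <;> rcases j with _ | j <;> simp [Alg.tt, Alg.mm, Alg.ee, Alg.bb, cf_f_vec, vec]
  grind
theorem proj_mm : subProj D L (f D (some p) .pm .pm) = ∑ l, D.χ p l • E D L l none none := by
  funext l
  ext i j
  rw [proj_apply]
  have : (∑ l, D.χ p l • E D L l none none : SubAlg D L) l i j = ∑ q, D.χ p q * E D L q none none l i j := by
    have h1 := map_sum (Pi.evalAddMonoidHom (fun _ : L => Matrix (Option G) (Option G) ℂ) l)
      (fun q => (D.χ p q • E D L q none none : SubAlg D L)) Finset.univ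
    exact (congrFun (congrFun h1 i) j).trans (by simp only [Matrix.sum_apply]; rfl)
  rw [this]
  simp only [E_apply']
  rcases i with _ | i <;> rcases j with _ | j <;> simp [Alg.tt, Alg.mm, Alg.ee, Alg.bb, cf_f_vec, vec]

theorem shift_none (l : G) : shift none l = none := rfl
theorem shift_some (g l : G) : shift (some g) l = some (g - l) := rfl

theorem proj_comul (b : Alg D) : comul (R := ℂ) (subProj D L b) = WeakHopfTransfer.two (subProj D L) (comul (R := ℂ) b) := by
  revert b
  refine ext_basis D ⟨fun b b' => ?_, fun r b => ?_⟩ ⟨fun b b' => ?_, fun r b => ?_⟩ fun x α β => ?_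
  · simp
  · simp
  · simp
  · simp
  have h2 : ∀ u v : Alg D, WeakHopfTransfer.two (subProj D L) (u ⊗ₜ[ℂ] v) = subProj D L u ⊗ₜ[ℂ] subProj D L v := fun _ _ => rfl
  rw [comul_f, map_sum]
  simp only [h2]
  cases α <;> cases β
  · rename_i p h k
    rw [sum_some, proj_tt, comul_E, proj_tm, TensorProduct.zero_tmul, zero_add]
    refine (Fintype.sum_equiv (Equiv.subRight k) _ _ fun q => ?_).symm
    rw [proj_tt, proj_tt, shift_some, shift_some]
    simp only [Equiv.subRight_apply]
    congr 2 <;> first | abel1 | (congr 1; abel1)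
  · rw [sum_some]
    simp only [proj_tm, TensorProduct.tmul_zero, TensorProduct.zero_tmul, Finset.sum_const_zero, add_zero, map_zero]
  · rw [sum_some]
    simp only [proj_mt, TensorProduct.tmul_zero, TensorProduct.zero_tmul, Finset.sum_const_zero, add_zero, map_zero]
  · rename_i p
    rw [sum_some]
    simp only [proj_mm, proj_mt, TensorProduct.zero_tmul, Finset.sum_const_zero, add_zero, map_sum, map_smul, comul_E,
      TensorProduct.sum_tmul, TensorProduct.tmul_sum, TensorProduct.smul_tmul_smul, Finset.smul_sum, shift_none]
    rw [Finset.sum_comm]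
    refine Finset.sum_congr rfl fun q _ => ?_
    refine Fintype.sum_equiv (Equiv.subRight q) _ _ fun l => ?_
    rw [Equiv.subRight_apply, ← chi_add_right, sub_add_cancel]
  · rename_i h k
    rw [sum_none, proj_ee, comul_E]
    simp only [proj_eb, TensorProduct.zero_tmul, Finset.sum_const_zero, add_zero]
    refine (Fintype.sum_equiv (Equiv.subRight k) _ _ fun q => ?_).symm
    rw [proj_ee, proj_ee, shift_some, shift_none]
    simp only [Equiv.subRight_apply]
    congr 2 <;> first | abel1 | (congr 1; abel1)
  · rw [sum_none]
    simp only [proj_eb, TensorProduct.tmul_zero, TensorProduct.zero_tmul, Finset.sum_const_zero, add_zero, map_zero]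
  · rw [sum_none]
    simp only [proj_be, TensorProduct.tmul_zero, TensorProduct.zero_tmul, Finset.sum_const_zero, add_zero, map_zero]
  · rename_i h k
    rw [sum_none, proj_bb, comul_E]
    simp only [proj_be, TensorProduct.zero_tmul, Finset.sum_const_zero, zero_add]
    refine (Fintype.sum_equiv (Equiv.subRight k) _ _ fun q => ?_).symm
    rw [proj_bb, proj_bb, shift_some, shift_none]
    simp only [Equiv.subRight_apply]
    congr 2 <;> first | abel1 | (congr 1; abel1)

theorem proj_counit (b : Alg D) : counit (R := ℂ) (subProj D L b) = counit (R := ℂ) b := by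
  revert b
  refine ext_basis D ⟨fun b b' => ?_, fun r b => ?_⟩ ⟨fun b b' => ?_, fun r b => ?_⟩ fun x α β => ?_
  · simp
  · simp
  · simp
  · simp
  rw [counit_f]
  cases α <;> cases β <;> simp only [proj_tt, proj_tm, proj_mt, proj_mm, proj_ee, proj_eb, proj_be, proj_bb, map_zero,
    map_sum, map_smul, counit_E, sub_eq_zero]
  all_goals simp [chi_zero_right]

theorem proj_antipode (b : Alg D) : subAntipode D L (subProj D L b) = subProj D L (S D b) := by
  revert b
  refine ext_basis D ⟨fun b b' => ?_, fun r b => ?_⟩ ⟨fun b b' => ?_, fun r b => ?_⟩ fun x α β => ?_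
  · simp
  · simp
  · simp
  · simp
  have ht := tau_ne_zero D
  rw [S_f]
  cases α <;> cases β <;> simp only [weight, dualIdx, map_smul, Complex.ofReal_one, div_one, one_smul, div_self ht]
  · simp only [proj_tt, antipode_E, shift_some]
    congr 2 <;> abel
  · rename_i g k
    rw [proj_tm, map_zero, proj_mt]
  · rename_i g k
    rw [proj_mt, map_zero, proj_tm]
  · rename_i g
    rw [proj_mm, proj_mm]
    simp only [map_sum, map_smul, antipode_E, shift_none]
    refine Fintype.sum_equiv (Equiv.neg G) _ _ fun l => ?_
    simp [chi_neg_left, chi_neg_right]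
  · simp only [proj_ee, proj_bb, antipode_E, shift_some, shift_none]
    congr 2 <;> abel
  · rw [proj_eb, proj_eb, map_zero, smul_zero]
  · rw [proj_be, proj_be, map_zero, smul_zero]
  · simp only [proj_ee, proj_bb, antipode_E, shift_some, shift_none]
    congr 2 <;> abel

theorem proj_surjective : Function.Surjective (subProj D L) := by
  have hE : ∀ (l : L) a b, ∃ x, subProj D L x = e D l a b := by
    intro l a b
    rcases a with _ | h <;> rcases b with _ | k
    · refine ⟨∑ p, ((D.τ : ℂ) * D.τ * D.χ p (-l)) • f D (some p) .pm .pm, ?_⟩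
      simp only [map_sum, map_smul, proj_mm, Finset.smul_sum, smul_smul]
      rw [Finset.sum_comm]
      simp only [← Finset.sum_smul, mul_assoc, ← chi_add_right]
      simp only [← mul_assoc, sum_tau_chi, neg_add_eq_zero]
      simp [E_mem]
    · exact ⟨f D none (.bar (l - k)) (.bar (-k)), by rw [proj_bb, ← E_mem]; congr 1 <;> simp⟩
    · exact ⟨f D none (.el (l - h)) (.el (-h)), by rw [proj_ee, ← E_mem]; congr 1 <;> simp⟩
    · exact ⟨f D (some (h - k)) (.pt (l - k)) (.pt (-k)), by rw [proj_tt, ← E_mem]; congr 1 <;> simp⟩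
  let T := WeakHopfTransfer.lin (subProj D L)
  have : LinearMap.range T = ⊤ := by
    rw [eq_top_iff, ← (subBasis D L).span_eq, Submodule.span_le]
    rintro _ ⟨⟨l, a, b⟩, rfl⟩
    exact hE l a b
  exact LinearMap.range_eq_top.1 this

theorem sub_faithful : ∃ (n : ℕ) (ρ : SubAlg D L →⋆ₐ[ℂ] Matrix (Fin n) (Fin n) ℂ), Function.Injective ρ := by
  classical
  let F : SubAlg D L →ₗ[ℂ] Matrix (Option G × L) (Option G × L) ℂ :=
    { toFun := fun X => Matrix.blockDiagonal X
      map_add' := fun X Y => Matrix.blockDiagonal_add X Y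
      map_smul' := fun c X => Matrix.blockDiagonal_smul c X }
  let ρ : SubAlg D L →⋆ₐ[ℂ] Matrix (Option G × L) (Option G × L) ℂ :=
    { toAlgHom := AlgHom.ofLinearMap F Matrix.blockDiagonal_one (fun X Y => Matrix.blockDiagonal_mul X Y)
      map_star' := fun X => (Matrix.blockDiagonal_conjTranspose X).symm }
  exact exists_fin_of_matrix ρ fun X Y h => Matrix.blockDiagonal_injective h
end

theorem subEpi (L : AddSubgroup G) : WeakHopfTransfer.Epi (subProj D L) (subAntipode D L) where
  surj := proj_surjective D L
  comul := proj_comul D L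
  counit := proj_counit D L
  antipode := proj_antipode D L

/-- The weak Hopf `C*`-algebra `(B_L, Δ_L, S_L, ε_L)`. -/
noncomputable instance (L : AddSubgroup G) : WeakHopfCStarAlgebra (SubAlg D L) where
  coassoc := WeakHopfTransfer.coassoc _ (subEpi D L)
  rTensor_counit_comp_comul := WeakHopfTransfer.rTensor_counit _ (subEpi D L)
  lTensor_counit_comp_comul := WeakHopfTransfer.lTensor_counit _ (subEpi D L)
  finiteDimensional := (subBasis D L).finiteDimensional_of_finite
  exists_faithful := sub_faithful D L
  comul_mul := WeakHopfTransfer.comul_mul _ (subEpi D L)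
  comul_star := WeakHopfTransfer.comul_star _ (subEpi D L)
  counit_mul_mul := WeakHopfTransfer.counit_mul_mul _ (subEpi D L)
  comul_one_mul := WeakHopfTransfer.comul_one_mul _ (subEpi D L)
  antipode := subAntipode D L
  antipode_one := WeakHopfTransfer.antipode_one _ (subEpi D L)
  antipode_mul := WeakHopfTransfer.antipode_mul _ (subEpi D L)
  counit_antipode := WeakHopfTransfer.counit_antipode _ (subEpi D L)
  comul_antipode := WeakHopfTransfer.comul_antipode _ (subEpi D L)
  mul_antipode_right := WeakHopfTransfer.mul_antipode_right _ (subEpi D L)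
  mul_antipode_left := WeakHopfTransfer.mul_antipode_left _ (subEpi D L)

end TambaraYamagami

namespace TambaraYamagami
open WeakHopfCStarAlgebra
variable {G : Type u} [AddCommGroup G] [Fintype G] [DecidableEq G] (D : Datum G)

/-- The quantum subgroupoids `(G^x, π^x)`, where `x` is a subgroup `L` of `G` or `x = Ω`, encoded as the top
element `⊤` of `WithTop (AddSubgroup G)`: `(G^Ω, π^Ω)` is the whole weak Hopf algebra with the identity map,
`(G^L, π^L)` is `B_L` with the projection `π_L`. -/
noncomputable def quantumSubgroupoid : WithTop (AddSubgroup G) → QuantumSubgroupoid (Alg D)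
  | ⊤ =>
    { carrier := Alg D
      proj := StarAlgHom.id ℂ (Alg D)
      surjective := Function.surjective_id
      comul_proj := fun b => by
        refine Eq.symm ?_
        exact LinearMap.congr_fun (TensorProduct.map_id (R := ℂ) (M := Alg D) (N := Alg D)) (CoalgebraStruct.comul (R := ℂ) b)
      counit_proj := fun _ => rfl
      antipode_proj := fun _ => rfl }
  | (L : AddSubgroup G) =>
    { carrier := SubAlg D L
      proj := subProj D L
      surjective := proj_surjective D L
      comul_proj := proj_comul D L
      counit_proj := proj_counit D L
      antipode_proj := proj_antipode D L }
end TambaraYamagami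

namespace TambaraYamagami
open Idx WeakHopfCStarAlgebra CoalgebraStruct
variable {G : Type u} [AddCommGroup G] [Fintype G] [DecidableEq G] (D : Datum G)

/-! Read `v^x_α` as an arrow from `src α` to `tgt α`. A composite `v^x_α ∘ v^y_γ` only involves
arrows that start where `α` starts and end where `γ` ends.

Since `Δ(f^x_{αβ}) = ∑_γ f^x_{αγ} ⊗ f^x_{γβ}`, slicing the second leg of `Δ(b)` with a coordinate
functional takes one column of coordinates of `b` and moves it to an arbitrary column. A coideal is
stable under such slices, hence it is `⨁ X^y ⊗ conj(H^y)`, where `X^y` collects the columns that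
occur (`column_mem`, `mem_iff_fiber`).

Invariance restricts the `X^y`. In `S(y₁) b y₂` the left leg starts and ends at the same object, so
only loops survive (`cf_adjointAction_eq_zero`). No basis vector of `H^m` is a loop, and for `p ≠ 0`
the only loop in `H^p` is `v^p_m`. Therefore `X^m = 0`, and `X^p` is `0` or `ℂ v^p_m` for `p ≠ 0`.
It remains to find `X^0` and the set `K` of all `p` with `f^p_{mm} ∈ I`.

These two are linked by the adjoint action of two elements of the block `x = m`. Acting with
`f^m_{0,0}` takes Fourier coefficients of a vector of `X^0` and places them at the `v^p_m`
(`mm_adjointAction_el`); acting with `f^m_{0̄,0̄}` turns `v^p_m` into the character `∑_k χ(p,k)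
v^0_k` (`tt_adjointAction_bar`). Since `f^p_{mm} f^q_{mm} = f^{p+q}_{mm}` and `(f^p_{mm})* =
f^{-p}_{mm}`, the set `K` is either empty or a subgroup.

If `K` is a subgroup, `X^0` is spanned by `v^0_m` and the characters in `K`; its vectors are
arbitrary at `m` and constant on the cosets of the annihilator `L` of `K` on `G`. As `K` is the
annihilator of `L` (`mem_of_chi_annihilator_eq_one`), this is the description of `I^L` in
`mem_quotientTypeCoideal_coe`. If `K` is empty, all Fourier coefficients at `p ≠ 0` vanish, `X^0`
consists of the constant vectors, and `I = I^Ω` by `mem_quotientTypeCoideal_top`.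

For uniqueness, `f^0_{mm}` separates every `I^L` from `I^Ω`, and indicator functions of subgroups
recover `L` from `I^L`. -/

/-! ### Columns and slices of the coproduct. -/

/-- The element `v ⊗ conj(v^x_γ)` of `B`. -/
noncomputable def column (x : Option G) (γ : Idx G x) (v : Idx G x → ℂ) : Alg D := ∑ α, v α • f D x α γ

theorem cf_column {x y : Option G} (γ : Idx G x) (v : Idx G x → ℂ) (μ ν : Idx G y) :
    cf D (column D x γ v) y μ ν = ∑ α, v α * cf D (f D x α γ) y μ ν := by
  simp only [column, cf, map_sum, map_smul, Finsupp.coe_finsetSum, Finset.sum_apply, Finsupp.smul_apply, smul_eq_mul]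

theorem cf_column_self {x : Option G} (γ : Idx G x) (v : Idx G x → ℂ) (μ ν : Idx G x) :
    cf D (column D x γ v) x μ ν = if γ = ν then v μ else 0 := by
  rw [cf_column]
  simp only [cf_f, Sigma.mk.injEq, heq_eq_eq, true_and, Prod.mk.injEq]
  by_cases h : γ = ν <;> simp [h]

theorem cf_column_of_ne {x y : Option G} (h : x ≠ y) (γ : Idx G x) (v : Idx G x → ℂ) (μ ν : Idx G y) :
    cf D (column D x γ v) y μ ν = 0 := by
  rw [cf_column]
  refine Finset.sum_eq_zero fun α _ => ?_
  rw [cf_f, if_neg (fun h' => h (congrArg Sigma.fst h')), mul_zero]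

theorem eq_sum_f (b : Alg D) : b = ∑ x, ∑ α, ∑ β, cf D b x α β • f D x α β := by
  rw [sum_triple (fun x α β => cf D b x α β • f D x α β)]
  exact ((basis D).sum_repr b).symm

theorem eq_sum_column (b : Alg D) : b = ∑ x, ∑ β, column D x β fun α => cf D b x α β := by
  conv_lhs => rw [eq_sum_f D b]
  refine Finset.sum_congr rfl fun x _ => ?_
  rw [Finset.sum_comm]
  rfl

theorem cf_add (a b : Alg D) (x : Option G) (α β : Idx G x) : cf D (a + b) x α β = cf D a x α β + cf D b x α β := by
  simp [cf]

theorem cf_smul (c : ℂ) (b : Alg D) (x : Option G) (α β : Idx G x) : cf D (c • b) x α β = c * cf D b x α β := by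
  simp [cf]

/-- The functional `b ↦ cf b x γ β`. -/
noncomputable def coefficient (x : Option G) (γ β : Idx G x) : Alg D →ₗ[ℂ] ℂ := (basis D).coord ⟨x, γ, β⟩

theorem coefficient_apply (x : Option G) (γ β : Idx G x) (b : Alg D) : coefficient D x γ β b = cf D b x γ β := rfl

section slice
variable {M : Type*} [AddCommGroup M] [Module ℂ M]

/-- In `Δ(f_{αβ}) = ∑_γ f_{αγ} ⊗ f_{γβ}` the second leg remembers `γ` and `β`, so a coordinate
functional selects column `β` and rewrites it as column `γ`. The map `T` on the first leg allows two
uses: the identity for coideals, and the projection of a quantum subgroupoid for quotient type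
coideals. -/
theorem slice_map_comul (T : Alg D →ₗ[ℂ] M) (x : Option G) (γ β : Idx G x) (b : Alg D) :
    TensorProduct.rid ℂ M (TensorProduct.map T (coefficient D x γ β) (comul (R := ℂ) b)) =
      T (column D x γ fun α => cf D b x α β) := by
  revert b
  refine ext_basis D ⟨fun b b' => ?_, fun r b => ?_⟩ ⟨fun b b' => ?_, fun r b => ?_⟩ fun y μ ν => ?_
  · simp
  · simp
  · simp [column, cf_add, add_smul, Finset.sum_add_distrib]
  · simp [column, cf_smul, mul_smul, Finset.smul_sum]
  rw [comul_f]
  simp only [map_sum, TensorProduct.map_tmul, TensorProduct.rid_tmul, coefficient_apply, column, map_smul]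
  by_cases h : y = x
  · subst h
    rw [Finset.sum_eq_single γ, Finset.sum_eq_single μ]
    · by_cases h : ν = β <;> simp [cf_f, h]
    · intro a _ h; simp [cf_f, h.symm]
    · simp
    · intro a _ h; simp [cf_f, h]
    · simp
  · rw [Finset.sum_eq_zero, Finset.sum_eq_zero]
    · intro a _
      rw [cf_f, if_neg (fun h' => h (congrArg Sigma.fst h')), zero_smul]
    · intro a _
      rw [cf_f, if_neg (fun h' => h (congrArg Sigma.fst h')), zero_smul]

theorem tmul_ext_slice {s t : M ⊗[ℂ] Alg D}
    (h : ∀ x γ β, TensorProduct.rid ℂ M ((coefficient D x γ β).lTensor M s) =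
      TensorProduct.rid ℂ M ((coefficient D x γ β).lTensor M t)) : s = t := by
  -- Expansion of a tensor along the basis of the second factor; its coefficients in `M` are exactly
  -- the slices.
  have key : ∀ s : M ⊗[ℂ] Alg D, s = ∑ i : Σ x : Option G, Idx G x × Idx G x,
      TensorProduct.rid ℂ M ((coefficient D i.1 i.2.1 i.2.2).lTensor M s) ⊗ₜ[ℂ] basis D i := by
    intro s
    induction s with
    | zero => simp
    | tmul m b =>
      simp only [LinearMap.lTensor_tmul, TensorProduct.rid_tmul, TensorProduct.smul_tmul]
      rw [← TensorProduct.tmul_sum]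
      congr 1
      exact ((basis D).sum_repr b).symm
    | add s t hs ht =>
      simp only [map_add, TensorProduct.add_tmul, Finset.sum_add_distrib]
      rw [← hs, ← ht]
  rw [key s, key t]
  exact Finset.sum_congr rfl fun i _ => by rw [h]
end slice

/-! ### Quotient type coideals, column by column. -/

/-- The index of the basis vector of `H^0` with target `c`. -/
def loop : Option G → Idx G (some 0)
  | some k => .pt k
  | none => .pm

-- The vectors of `H^0` act as identity arrows: composing on the right with the one at `c` keeps the
-- arrows that end at `c` and kills the others. At `m` this uses `χ(0,k) = 1`.
open scoped Classical in
theorem circ_zero_right {x z : Option G} (α : Idx G x) (c : Idx G (some 0)) (μ : Idx G z) :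
    circ D x (some 0) z α c μ = if c = loop (tgt α) ∧ μ.vec = α.vec then 1 else 0 := by
  cases α <;> cases c <;> cases μ <;> simp [circ, circVec, vec, loop, tgt, chi_zero_left] <;> grind

theorem f_mul_f_zero {x : Option G} (α β : Idx G x) (c d : Idx G (some 0)) :
    f D x α β * f D (some 0) c d = if c = loop (tgt α) ∧ d = loop (tgt β) then f D x α β else 0 := by
  classical
  rw [f_mul_f]
  simp only [circ_zero_right D]
  by_cases h1 : c = loop (tgt α)
  · by_cases h2 : d = loop (tgt β)
    · simp only [h1, h2, true_and, and_self, if_true]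
      trans ∑ z, ∑ μ : Idx G z, if μ.vec = α.vec then ∑ ν : Idx G z, if ν.vec = β.vec then f D z μ ν else 0 else 0
      · refine Finset.sum_congr rfl fun z _ => Finset.sum_congr rfl fun μ _ => ?_
        split_ifs with h
        · refine Finset.sum_congr rfl fun ν _ => ?_
          split_ifs <;> simp
        · simp
      · rw [sum_vec (fun z μ => ∑ ν : Idx G z, if ν.vec = β.vec then f D z μ ν else 0), Finset.sum_eq_single β]
        · simp
        · intro ν _ h
          rw [if_neg]
          intro h'
          have := sigma_eq_of_vec h'
          simp at this
          exact h this
        · simp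
    · simp [h2]
  · simp [h1]

/-- The element `∑_a f^0_{ac}`. -/
noncomputable def unitColumn (c : Idx G (some 0)) : Alg D := ∑ a, f D (some 0) a c

section
variable {M : Type*} [AddCommGroup M] [Module ℂ M]
-- Here `(1 ⊗ b) Δ(1) = ∑ f^0_{ac} ⊗ b f^0_{cd}`. For a basis vector `b` the identity-arrow rule
-- leaves only the `c`, `d` at the targets of its two indices, while `a` stays free and sums up to
-- `unitColumn`.
theorem slice_map_mul_comul_one (T : Alg D →ₗ[ℂ] M) (x : Option G) (γ β : Idx G x) (b : Alg D) :
    TensorProduct.rid ℂ M (TensorProduct.map T (coefficient D x γ β) ((1 ⊗ₜ[ℂ] b) * comul (R := ℂ) 1)) =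
      cf D b x γ β • T (unitColumn D (loop (tgt γ))) := by
  revert b
  refine ext_basis D ⟨fun b b' => ?_, fun r b => ?_⟩ ⟨fun b b' => ?_, fun r b => ?_⟩ fun y μ ν => ?_
  · simp [TensorProduct.tmul_add, add_mul]
  · rw [TensorProduct.tmul_smul, smul_mul_assoc]; simp
  · simp only [cf_add, add_smul]
  · simp only [cf_smul, mul_smul]
  rw [comul_one]
  simp only [Finset.mul_sum, Algebra.TensorProduct.tmul_mul_tmul, one_mul, map_sum, TensorProduct.map_tmul,
    TensorProduct.rid_tmul, f_mul_f_zero]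
  have h2 : ∀ a, ∑ c, ∑ d, coefficient D x γ β (if c = loop (tgt μ) ∧ d = loop (tgt ν) then f D y μ ν else 0) •
      T (f D (some 0) a c) = cf D (f D y μ ν) x γ β • T (f D (some 0) a (loop (tgt μ))) := by
    intro a
    rw [Finset.sum_eq_single (loop (tgt μ)), Finset.sum_eq_single (loop (tgt ν))]
    · simp [coefficient_apply]
    · intro d _ h; simp [h]
    · simp
    · intro c _ h; simp [h]
    · simp
  simp only [h2]
  rw [← Finset.smul_sum, unitColumn, map_sum]
  by_cases h : (⟨y, μ, ν⟩ : Σ x : Option G, Idx G x × Idx G x) = ⟨x, γ, β⟩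
  · cases h; rfl
  · rw [cf_f, if_neg h, zero_smul, zero_smul]
end

/-- Both sides of the defining equation lie in `H.carrier ⊗ B`, so they agree iff all their slices
do. Each resulting condition involves a single column of `b`, which makes `quotientTypeCoideal H`
directly comparable with a coideal given by its fibers. -/
theorem mem_quotientTypeCoideal (H : QuantumSubgroupoid (Alg D)) (b : Alg D) :
    b ∈ quotientTypeCoideal H ↔ ∀ x β γ, H.proj (column D x γ fun α => cf D b x α β) =
      cf D b x γ β • H.proj (unitColumn D (loop (tgt γ))) := by
  let T : Alg D →ₗ[ℂ] H.carrier := (H.proj : Alg D →ₐ[ℂ] H.carrier).toLinearMap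
  have key : ∀ x γ β t, TensorProduct.rid ℂ H.carrier (TensorProduct.map T (coefficient D x γ β) t) =
      TensorProduct.rid ℂ H.carrier ((coefficient D x γ β).lTensor H.carrier
        (Algebra.TensorProduct.map (H.proj : Alg D →ₐ[ℂ] H.carrier) (AlgHom.id ℂ (Alg D)) t)) := by
    intro x γ β t
    induction t with
    | zero => simp
    | tmul x y => rfl
    | add s t hs ht => simp only [map_add, hs, ht]
  constructor
  · intro h x β γ
    have h1 := slice_map_comul D T x γ β b
    have h2 := slice_map_mul_comul_one D T x γ β b
    rw [key] at h1 h2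
    have h3 : Algebra.TensorProduct.map (H.proj : Alg D →ₐ[ℂ] H.carrier) (AlgHom.id ℂ (Alg D)) (comul (R := ℂ) b) = _ := h
    rw [h3, h2] at h1
    exact h1.symm
  · intro h
    refine tmul_ext_slice D fun x γ β => ?_
    rw [← key, ← key, slice_map_comul, slice_map_mul_comul_one]
    exact h x β γ

/-! ### Fibers of a coideal. -/

-- The slice of `Δ(b) ∈ I ⊗ B` has its first leg in `I`, hence lies in `I`, and by `slice_map_comul`
-- it is the moved column.
variable {D} in
theorem column_mem {I : StarSubalgebra ℂ (Alg D)} (hI : IsCoideal I) {b : Alg D} (hb : b ∈ I)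
    (x : Option G) (γ β : Idx G x) : column D x γ (fun α => cf D b x α β) ∈ I := by
  obtain ⟨t, ht⟩ := hI b hb
  have h := slice_map_comul D LinearMap.id x γ β b
  rw [LinearMap.id_apply] at h
  rw [← h, ← ht]
  clear h ht
  induction t with
  | zero => simp
  | tmul a c =>
    simp only [TensorProduct.map_tmul, TensorProduct.rid_tmul, LinearMap.id_apply]
    exact I.smul_mem a.2 _
  | add s t hs ht =>
    simp only [map_add]
    exact add_mem hs ht

/-- The subspace `X^y` of `H^y` attached to a coideal `I`. -/
noncomputable def fiber {D : Datum G} (I : StarSubalgebra ℂ (Alg D)) (y : Option G) : Submodule ℂ (Idx G y → ℂ) where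
  carrier := {v | ∀ γ, column D y γ v ∈ I}
  zero_mem' γ := by simp [column]
  add_mem' hv hw γ := by
    have := add_mem (hv γ) (hw γ)
    simpa [column, add_smul, Finset.sum_add_distrib] using this
  smul_mem' c v hv γ := by
    have := I.smul_mem (hv γ) c
    simpa [column, mul_smul, Finset.smul_sum] using this

variable {D} in
theorem cf_mem_fiber {I : StarSubalgebra ℂ (Alg D)} (hI : IsCoideal I) {b : Alg D} (hb : b ∈ I)
    (y : Option G) (β : Idx G y) : (fun α => cf D b y α β) ∈ fiber I y := fun γ => column_mem hI hb y γ β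

-- An element is the sum of its own columns, so it lies in `I` as soon as they do; conversely each
-- column of an element of `I` may be moved to any position inside `I`.
variable {D} in
theorem mem_iff_fiber {I : StarSubalgebra ℂ (Alg D)} (hI : IsCoideal I) (b : Alg D) :
    b ∈ I ↔ ∀ y β, (fun α => cf D b y α β) ∈ fiber I y := by
  refine ⟨fun hb y β => cf_mem_fiber hI hb y β, fun h => ?_⟩
  rw [eq_sum_column D b]
  exact sum_mem fun y _ => sum_mem fun β _ => h y β β

/-! ### Endpoints of arrows and the support of the adjoint action. -/

theorem circ_src {x y z : Option G} (α : Idx G x) (γ : Idx G y) (μ : Idx G z)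
    (h : src μ ≠ src α) : circ D x y z α γ μ = 0 := by
  cases α <;> cases γ <;> cases μ <;> simp [circ, circVec, vec, src] at h ⊢ <;> grind

theorem src_dualIdx {x : Option G} (α : Idx G x) : src (dualIdx α) = tgt α := by
  cases α <;> simp [dualIdx, src, tgt]

/-- Only left indices matter here: `circ` vanishes unless the first factor starts where `μ` starts
and the second ends where `μ` ends, so other coordinates cannot contribute. -/
theorem cf_mul_eq_zero {a b : Alg D} {z : Option G} (μ ν : Idx G z)
    (h : ∀ x (α β : Idx G x) y (γ δ : Idx G y), src α = src μ → tgt γ = tgt μ →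
      cf D a x α β = 0 ∨ cf D b y γ δ = 0) : cf D (a * b) z μ ν = 0 := by
  rw [mul_def]
  refine Finset.sum_eq_zero fun x _ => Finset.sum_eq_zero fun y _ => Finset.sum_eq_zero fun α _ =>
    Finset.sum_eq_zero fun γ _ => ?_
  by_cases h1 : src μ = src α
  · by_cases h2 : tgt μ = tgt γ
    · rw [mul_eq_zero]
      right
      refine Finset.sum_eq_zero fun β _ => Finset.sum_eq_zero fun δ _ => ?_
      rcases h x α β y γ δ h1.symm h2.symm with h | h <;> simp [h]
    · rw [circ_tgt D α γ μ h2, zero_mul]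
  · rw [circ_src D α γ μ h1, zero_mul]

theorem adjointAction_f (b : Alg D) (y : Option G) (γ δ : Idx G y) :
    adjointAction b (f D y γ δ) = ∑ ε, S D (f D y γ ε) * (b * f D y ε δ) := by
  rw [adjointAction, comul_f]
  simp only [map_sum, TensorProduct.map_tmul, LinearMap.mul'_apply, LinearMap.mulLeft_apply]
  rfl

/-- In `S(f_{γε}) b f_{εδ}` the left leg starts with the dual of `ε`, whose source is `tgt ε`, and
finishes with `ε`, whose target is again `tgt ε`. Whatever `b` is in between, the composite is a
loop. -/
theorem cf_adjointAction_eq_zero (b y : Alg D) {z : Option G} (μ ν : Idx G z) (h : src μ ≠ tgt μ) :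
    cf D (adjointAction b y) z μ ν = 0 := by
  revert y
  refine ext_basis D (K := fun _ => 0) ⟨fun y y' => ?_, fun r y => ?_⟩ ⟨fun _ _ => ?_, fun _ _ => ?_⟩ fun y γ δ => ?_
  · simp [adjointAction, cf]
  · simp [adjointAction, cf]
  · simp
  · simp
  rw [adjointAction_f]
  rw [← coefficient_apply, map_sum]
  refine Finset.sum_eq_zero fun ε _ => ?_
  refine cf_mul_eq_zero D μ ν fun x α β w κ δ' h1 h2 => ?_
  -- If `μ` starts at `tgt ε`, the last factor is to blame: it ends at `tgt ε`, whereas `μ`, not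
  -- being a loop, ends elsewhere. Otherwise the first factor is: its left index starts at `tgt ε`.
  by_cases hα : tgt ε = src α
  · right
    refine cf_mul_eq_zero D κ δ' fun x' α' β' y' γ' δ'' _ h4 => Or.inr ?_
    rw [cf_f, if_neg]
    intro h5
    cases h5
    exact h (by rw [← h1, ← hα, h4, h2])
  · left
    rw [S_f]
    rw [cf_smul, cf_f, if_neg, mul_zero]
    intro h5
    cases h5
    exact hα (src_dualIdx ε).symm

/-! ### The adjoint action of `f^m_{0,0}` and `f^m_{0̄,0̄}` as Fourier transforms. -/

theorem S_el_el (h k : G) : S D (f D none (.el h) (.el k)) = f D none (.bar k) (.bar h) := by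
  rw [S_f]; simp [weight, dualIdx]
theorem S_bar_bar (h k : G) : S D (f D none (.bar h) (.bar k)) = f D none (.el k) (.el h) := by
  rw [S_f]; simp only [weight, dualIdx, div_self (tau_ne_zero D), one_smul]
theorem S_el_bar (h k : G) : S D (f D none (.el h) (.bar k)) = (D.τ : ℂ)⁻¹ • f D none (.el k) (.bar h) := by
  rw [S_f]; simp [weight, dualIdx]
theorem S_bar_el (h k : G) : S D (f D none (.bar h) (.el k)) = (D.τ : ℂ) • f D none (.bar k) (.el h) := by
  rw [S_f]; simp [weight, dualIdx]

theorem mm_sum {ι : Type*} (s : Finset ι) (F : ι → Alg D) (p : G) :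
    (∑ i ∈ s, F i).mm D p = ∑ i ∈ s, (F i).mm D p := map_sum (coefficient D (some p) .pm .pm) F s
theorem tt_sum {ι : Type*} (s : Finset ι) (F : ι → Alg D) (p h k : G) :
    (∑ i ∈ s, F i).tt D p h k = ∑ i ∈ s, (F i).tt D p h k := map_sum (coefficient D (some p) (.pt h) (.pt k)) F s
theorem mt_sum {ι : Type*} (s : Finset ι) (F : ι → Alg D) (p h : G) :
    (∑ i ∈ s, F i).mt D p h = ∑ i ∈ s, (F i).mt D p h := map_sum (coefficient D (some p) .pm (.pt h)) F s

theorem bb_f_bar (e k h l : G) : (f D none (.bar e) (.bar k)).bb D h l = if e = h ∧ k = l then 1 else 0 := by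
  simp [Alg.bb, cf_f_vec, vec]
theorem ee_f_el (e k h l : G) : (f D none (.el e) (.el k)).ee D h l = if e = h ∧ k = l then 1 else 0 := by
  simp [Alg.ee, cf_f_vec, vec]
theorem mm_f_pm (q p : G) : (f D (some q) .pm .pm).mm D p = if q = p then 1 else 0 := by
  simp [Alg.mm, cf_f_vec, vec]

theorem mm_f_none (α β : Idx G none) (p : G) : (f D none α β).mm D p = 0 := by
  cases α <;> cases β <;> simp [Alg.mm, cf_f_vec, vec]
theorem tt_f_none (α β : Idx G none) (p h k : G) : (f D none α β).tt D p h k = 0 := by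
  cases α <;> cases β <;> simp [Alg.tt, cf_f_vec, vec]
theorem mt_f_none (α β : Idx G none) (p h : G) : (f D none α β).mt D p h = 0 := by
  cases α <;> cases β <;> simp [Alg.mt, cf_f_vec, vec]

/-- The relevant summands are `f^m_{ē,0̄} (b f^m_{e,0})`. The factor `b` multiplies `f^m_{e,0}` by
its coefficient at `f^0_{e,0}`, and then `v^m_ē ∘ v^m_e = τ ∑_p χ(p,e)⁻¹ v^p_m` in the left leg
produces the Fourier kernel. The right leg contributes another `τ` with trivial character, which
gives the normalisation `τ² = 1/|G|`. -/
theorem mm_adjointAction_el (b : Alg D) (p : G) :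
    (adjointAction b (f D none (.el 0) (.el 0))).mm D p =
      ∑ e, (D.τ : ℂ) * D.τ * (D.χ p e)⁻¹ * b.tt D 0 e 0 := by
  rw [adjointAction_f, sum_none, add_mm, mm_sum, mm_sum]
  -- The summands through a barred middle index start with a multiple of the mixed element
  -- `f^m_{k,0̄}`, which cannot contribute to `v^p_m` in the left leg.
  rw [Finset.sum_eq_zero (f := fun k => Alg.mm D (S D (f D none (el 0) (bar k)) * (b * f D none (bar k) (el 0))) p), add_zero]
  · refine Finset.sum_congr rfl fun e _ => ?_
    rw [S_el_el, mul_mm]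
    simp only [bb_f_bar, mm_f_none, zero_mul, Finset.sum_const_zero, add_zero]
    rw [Finset.sum_eq_single e, Finset.sum_eq_single 0]
    · rw [mul_ee, Finset.sum_eq_zero (f := fun g => D.χ g e * _), Finset.sum_eq_single 0]
      · simp [ee_f_el, chi_zero_right]; ring
      · intro g _ hg; simp [ee_f_el, hg.symm]
      · simp
      · intro g _; simp [mm_f_none]
    · intro k _ h; simp [h.symm]
    · simp
    · intro k _ h; simp [h.symm]
    · simp
  · intro e _
    rw [S_el_bar, smul_mul_assoc, smul_mm, mul_mm]
    have : ∀ h k, (f D none (.el e) (.bar 0)).bb D h k = 0 := fun h k => by simp [Alg.bb, cf_f_vec, vec]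
    simp [mm_f_none, this]

/-- The opposite direction: the middle index `h̄` gives `f^m_{h,0} (b f^m_{h̄,0̄})`. Here `v^g_m`
acts on `v^m_h̄` by `χ(g,h)`, and `v^m_h ∘ v^m_h̄ = v^0_h` reads off the value at `h`. -/
theorem tt_adjointAction_bar (b : Alg D) (h : G) :
    (adjointAction b (f D none (.bar 0) (.bar 0))).tt D 0 h 0 = ∑ g, D.χ g h * b.mm D g := by
  rw [adjointAction_f, sum_none, add_tt, tt_sum, tt_sum]
  rw [Finset.sum_eq_zero (f := fun k => Alg.tt D (S D (f D none (bar 0) (el k)) * (b * f D none (el k) (bar 0))) 0 h 0), zero_add]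
  · rw [Finset.sum_eq_single h]
    · rw [S_bar_bar, mul_tt]
      simp only [ee_f_el, tt_f_none, zero_mul, Finset.sum_const_zero, add_zero, sub_zero, mul_bb, mul_zero, zero_add,
        bb_f_bar]
      simp [chi_zero_right]
    · intro k _ hk
      rw [S_bar_bar, mul_tt]
      simp [ee_f_el, tt_f_none, hk]
    · simp
  · intro e _
    rw [S_bar_el, smul_mul_assoc, smul_tt, mul_tt]
    have : ∀ h k, (f D none (.bar e) (.el 0)).ee D h k = 0 := fun h k => by simp [Alg.ee, cf_f_vec, vec]
    simp [tt_f_none, this]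

/-- Complements `tt_adjointAction_bar`: the column of `f^p_{mm} ◁ f^m_{0̄,0̄}` that is used later
has no entry at `m`, so it is a pure character vector. -/
theorem mt_adjointAction_bar (p : G) :
    (adjointAction (f D (some p) .pm .pm) (f D none (.bar 0) (.bar 0))).mt D 0 0 = 0 := by
  rw [adjointAction_f, sum_none, add_mt, mt_sum, mt_sum]
  rw [Finset.sum_eq_zero, Finset.sum_eq_zero, add_zero]
  · intro e _
    rw [S_bar_bar, mul_mt]
    have : ∀ h k, (f D none (.el e) (.el 0)).be D h k = 0 := fun h k => by simp [Alg.be, cf_f_vec, vec]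
    simp [mt_f_none, this]
  · intro e _
    rw [S_bar_el, smul_mul_assoc, smul_mt, mul_mt]
    have : ∀ h k, (f D (some p) .pm .pm * f D none (.el e) (.bar 0)).eb D h k = 0 := fun h k => by
      have : ∀ p' h, (f D (some p) .pm .pm).tm D p' h = 0 := fun h k => by simp [Alg.tm, cf_f_vec, vec]
      rw [mul_eb]
      simp [mt_f_none, this]
    simp [mt_f_none, this]

/-- Makes the set of all `p` with `f^p_{mm} ∈ I` closed under addition; `star_f_pm` gives closure
under negation. -/
theorem f_pm_mul_f_pm (p q : G) : f D (some p) .pm .pm * f D (some q) .pm .pm = f D (some (p + q)) .pm .pm := by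
  apply ext8
  · intros; rw [mul_tt]; simp [Alg.tt, Alg.ee, Alg.bb, cf_f_vec, vec]
  · intros; rw [mul_tm]; simp [Alg.tm, Alg.eb, Alg.be, cf_f_vec, vec]
  · intros; rw [mul_mt]; simp [Alg.mt, Alg.eb, Alg.be, cf_f_vec, vec]
  · intro r
    rw [mul_mm]; simp [Alg.mm, Alg.ee, Alg.bb, cf_f_vec, vec, eq_sub_iff_add_eq]
  · intros; rw [mul_ee]; simp [Alg.mm, Alg.ee, Alg.tt, cf_f_vec, vec]
  · intros; rw [mul_eb]; simp [Alg.mt, Alg.eb, Alg.tm, cf_f_vec, vec]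
  · intros; rw [mul_be]; simp [Alg.mt, Alg.be, Alg.tm, cf_f_vec, vec]
  · intros; rw [mul_bb]; simp [Alg.mm, Alg.bb, Alg.tt, cf_f_vec, vec]

theorem star_f_pm (p : G) : star (f D (some p) .pm .pm) = f D (some (-p)) .pm .pm := by
  rw [star_f]; simp [weight, dualIdx]

/-! ### Explicit form of `I^Ω` and `I^L`. -/

/-- The condition on a vector of `H^x` for belonging to the quotient type coideal of `(G^L, π^L)`. -/
def IsSubgroupVector (L : AddSubgroup G) : (x : Option G) → (Idx G x → ℂ) → Prop
  | none, v => v = 0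
  | some p, v => (p ≠ 0 → ∀ k, v (.pt k) = 0) ∧ (p = 0 → ∀ h k, h - k ∈ L → v (.pt h) = v (.pt k)) ∧
      (v .pm ≠ 0 → ∀ l ∈ L, D.χ p l = 1)

theorem map_column {M : Type*} [AddCommGroup M] [Module ℂ M] (T : Alg D →ₗ[ℂ] M) (x : Option G) (γ : Idx G x)
    (v : Idx G x → ℂ) : T (column D x γ v) = ∑ α, v α • T (f D x α γ) := by
  simp [column]

/-- For the identity projection the column criterion equates an element supported on `H^x` with one
supported on `H^0`. This kills the column unless `x = 0`, and for `x = 0` it compares every entry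
with the one at `γ`. -/
theorem mem_quotientTypeCoideal_top (b : Alg D) :
    b ∈ quotientTypeCoideal (quantumSubgroupoid D ⊤) ↔
      ∀ x (β : Idx G x), (x ≠ some 0 → ∀ α, cf D b x α β = 0) ∧ ∀ α γ, cf D b x α β = cf D b x γ β := by
  rw [mem_quotientTypeCoideal]
  refine forall_congr' fun x => forall_congr' fun β => ?_
  change (∀ γ, column D x γ _ = cf D b x γ β • unitColumn D _) ↔ _
  have hu : ∀ (c : Idx G (some 0)), unitColumn D c = column D (some 0) c fun _ => 1 := fun c => by
    simp [unitColumn, column]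
  constructor
  · intro h
    have h0 : x ≠ some 0 → ∀ α, cf D b x α β = 0 := by
      intro hx α
      have := congrArg (fun a => cf D a x α α) (h α)
      simp only [cf_smul, hu, cf_column_self, cf_column_of_ne D hx.symm] at this
      simpa using this
    refine ⟨h0, fun α γ => ?_⟩
    by_cases hx : x = some 0
    · subst hx
      -- In `H^0` an index is determined by its target, so the two columns being compared sit in the
      -- same position.
      have hl : ∀ γ : Idx G (some 0), loop (tgt γ) = γ := by
        intro γ; cases γ <;> rfl
      have := congrArg (fun a => cf D a (some 0) α γ) (h γ)
      simp only [cf_smul, hu, cf_column_self, hl] at this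
      simpa using this
    · rw [h0 hx, h0 hx]
  · rintro ⟨h0, h1⟩ γ
    by_cases hx : x = some 0
    · subst hx
      have hl : ∀ γ : Idx G (some 0), loop (tgt γ) = γ := by
        intro γ; cases γ <;> rfl
      rw [hl, unitColumn, column, Finset.smul_sum]
      exact Finset.sum_congr rfl fun α _ => by rw [h1 α γ]
    · simp [column, h0 hx]

variable (L : AddSubgroup G)

theorem subAlg_sum_apply {ι : Type*} (s : Finset ι) (F : ι → SubAlg D L) (l : L) (i j : Option G) :
    (∑ a ∈ s, F a) l i j = ∑ a ∈ s, F a l i j := by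
  have h1 := map_sum (Pi.evalAddMonoidHom (fun _ : L => Matrix (Option G) (Option G) ℂ) l) F s
  exact (congrFun (congrFun h1 i) j).trans (by simp only [Matrix.sum_apply]; rfl)

theorem subAlg_smul_apply (c : ℂ) (X : SubAlg D L) (l : L) (i j : Option G) : (c • X) l i j = c * X l i j := rfl

theorem subProj_unitColumn_pt (k : G) :
    subProj D L (unitColumn D (.pt k)) = ∑ a, E D L (a - k) (some (-k)) (some (-k)) := by
  rw [unitColumn, map_sum, sum_some, proj_mt, zero_add]
  simp only [proj_tt, zero_sub]

theorem subProj_unitColumn_pm : subProj D L (unitColumn D .pm) = ∑ l, E D L l none none := by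
  rw [unitColumn, map_sum, sum_some, proj_mm]
  simp [proj_tm, chi_zero_left]

/-- After applying `π_L`, both sides of the column criterion are combinations of matrix units, and
the three clauses of `IsSubgroupVector` come from comparing entries. Column `k` compares units
`e_{p-k,-k}` with `e_{-k,-k}`; column `m` compares the weights `χ(p,l)` and `1` on `e^l_{m,m}`. -/
theorem mem_quotientTypeCoideal_coe (b : Alg D) :
    b ∈ quotientTypeCoideal (quantumSubgroupoid D (L : WithTop (AddSubgroup G))) ↔
      ∀ x (β : Idx G x), IsSubgroupVector D L x fun α => cf D b x α β := by
  rw [mem_quotientTypeCoideal]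
  refine forall_congr' fun x => forall_congr' fun β => ?_
  generalize hv : (fun α => cf D b x α β) = v
  have hv' : ∀ γ, cf D b x γ β = v γ := fun γ => congrFun hv γ
  simp only [hv']
  change (∀ γ, (subProj D L : Alg D →ₐ[ℂ] SubAlg D L).toLinearMap (column D x γ v) = v γ • subProj D L (unitColumn D (loop (tgt γ)))) ↔ _
  simp only [map_column]
  change (∀ γ, ∑ α, v α • subProj D L (f D x α γ) = v γ • subProj D L (unitColumn D (loop (tgt γ)))) ↔ _
  rcases x with _ | p
  · constructor
    · intro h
      funext γ
      cases γ with
      | el k =>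
        have := h (.el k)
        rw [sum_none] at this
        simp only [proj_ee, proj_be, smul_zero, Finset.sum_const_zero, add_zero, tgt, loop, subProj_unitColumn_pm] at this
        -- The block `l = 0` always belongs to `L`. Its entry `(-k, m)` is the coordinate at `k` on
        -- the left, and `0` on the right, where only `e^l_{m,m}` occurs.
        have := congrFun (congrFun (congrFun this 0) (some (-k))) none
        simp only [subAlg_sum_apply, subAlg_smul_apply, E_apply'] at this
        simpa [eq_comm (a := (0 : G)), sub_eq_zero] using this
      | bar k =>
        have := h (.bar k)
        rw [sum_none] at this
        simp only [proj_bb, proj_eb, smul_zero, Finset.sum_const_zero, zero_add, tgt, loop, subProj_unitColumn_pt] at this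
        have := congrFun (congrFun (congrFun this 0) none) (some (-k))
        simp only [subAlg_sum_apply, subAlg_smul_apply, E_apply'] at this
        simpa [eq_comm (a := (0 : G)), sub_eq_zero] using this
    · rintro rfl γ
      simp
  · constructor
    · intro h
      refine ⟨fun hp k => ?_, ?_, fun hm l hl => ?_⟩
      · have := h (.pt k)
        rw [sum_some] at this
        simp only [proj_tt, proj_mt, smul_zero, zero_add, tgt, loop, subProj_unitColumn_pt] at this
        -- For `p ≠ 0` this entry is off the diagonal, and the right-hand side is diagonal.
        have := congrFun (congrFun (congrFun this 0) (some (p - k))) (some (-k))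
        simp only [subAlg_sum_apply, subAlg_smul_apply, E_apply'] at this
        have h2 : ¬ (-k = p - k) := by simpa [sub_eq_add_neg, eq_comm] using hp
        simpa [eq_comm (a := (0 : G)), sub_eq_zero, h2] using this
      · rintro rfl h1 k hl
        have := h (.pt k)
        rw [sum_some] at this
        simp only [proj_tt, proj_mt, smul_zero, zero_add, tgt, loop, subProj_unitColumn_pt] at this
        -- The block `h1 - k ∈ L` sees the coordinate at `h1` on the left and the one at `k` on the
        -- right.
        have := congrFun (congrFun (congrFun this ⟨_, hl⟩) (some (- k))) (some (-k))
        simp only [subAlg_sum_apply, subAlg_smul_apply, E_apply'] at this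
        simpa using this
      · have := h .pm
        rw [sum_some] at this
        simp only [proj_tm, proj_mm, smul_zero, Finset.sum_const_zero, add_zero, tgt, loop, subProj_unitColumn_pm] at this
        have := congrFun (congrFun (congrFun this ⟨l, hl⟩) none) none
        simp only [subAlg_sum_apply, subAlg_smul_apply, E_apply'] at this
        simpa [hm] using this
    · rintro ⟨h1, h2, h3⟩ γ
      cases γ with
      | pt k =>
        rw [sum_some]
        simp only [proj_tt, proj_mt, smul_zero, zero_add, tgt, loop, subProj_unitColumn_pt, Finset.smul_sum]
        refine Finset.sum_congr rfl fun a _ => ?_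
        by_cases hp : p = 0
        · subst hp
          -- Outside `L` the matrix units project to `0`, so no relation between the coordinates at
          -- `a` and `k` is needed.
          by_cases ha : a - k ∈ L
          · rw [h2 rfl a k ha, zero_sub]
          · rw [E_not D ha, E_not D ha]; simp
        · simp [h1 hp]
      | pm =>
        rw [sum_some]
        simp only [proj_tm, proj_mm, smul_zero, Finset.sum_const_zero, add_zero, tgt, loop, subProj_unitColumn_pm]
        by_cases hm : v .pm = 0
        · simp [hm]
        · congr 1
          refine Finset.sum_congr rfl fun l _ => ?_
          by_cases hl : l ∈ L
          · rw [h3 hm l hl, one_smul]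
          · rw [E_not D hl, smul_zero]

/-! ### Fourier analysis and annihilators on `G`. -/

/-- The coefficients of a function on `G` with respect to the basis of characters. -/
noncomputable def fourierCoeff (F : G → ℂ) (p : G) : ℂ := ∑ e, (D.τ : ℂ) * D.τ * (D.χ p e)⁻¹ * F e

theorem sum_chi_mul_fourierCoeff (F : G → ℂ) (k : G) : ∑ p, D.χ p k * fourierCoeff D F p = F k := by
  rw [← fourier D F k]
  -- `fourier` has the inverse character in the outer sum; the substitution `p ↦ -p` and the
  -- symmetry of `χ` bring it to the present form.
  refine Fintype.sum_equiv (Equiv.neg G) _ _ fun p => ?_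
  simp only [fourierCoeff, Equiv.neg_apply, chi_neg_right, inv_inv, Finset.mul_sum]
  refine Finset.sum_congr rfl fun e _ => ?_
  rw [D.χ_symm k p, D.χ_symm e p]
  ring

/-- Translating the summation variable by the period `l` multiplies the coefficient by `χ(p,l)`,
which is not `1`. -/
theorem fourierCoeff_eq_zero {F : G → ℂ} {l p : G} (hF : ∀ e, F (e + l) = F e) (hl : D.χ p l ≠ 1) :
    fourierCoeff D F p = 0 := by
  have h : D.χ p l * fourierCoeff D F p = fourierCoeff D F p := by
    simp only [fourierCoeff, Finset.mul_sum]
    refine Fintype.sum_equiv (Equiv.subRight l) _ _ fun e => ?_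
    have := hF (e - l)
    rw [sub_add_cancel] at this
    rw [Equiv.subRight_apply, ← this, chi_sub_right, mul_inv, inv_inv]
    ring
  have h2 : (D.χ p l - 1) * fourierCoeff D F p = 0 := by rw [sub_mul, h]; ring
  exact (mul_eq_zero.1 h2).resolve_left (sub_ne_zero.2 hl)

/-- The annihilator of a subgroup. -/
def annihilator (H : AddSubgroup G) : AddSubgroup G where
  carrier := {l | ∀ p ∈ H, D.χ p l = 1}
  zero_mem' p _ := chi_zero_right D p
  add_mem' ha hb p hp := by rw [chi_add_right, ha p hp, hb p hp, one_mul]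
  neg_mem' ha p hp := by rw [chi_neg_right, ha p hp, inv_one]

open scoped Classical in
theorem sum_subgroup_chi (H : AddSubgroup G) (x : G) :
    ∑ h : H, D.χ h x = if x ∈ annihilator D H then (Fintype.card H : ℂ) else 0 := by
  split_ifs with hx
  · rw [Finset.sum_congr rfl fun (h : H) _ => hx h h.2]; simp
  · obtain ⟨p, hp, hpx⟩ : ∃ p ∈ H, D.χ p x ≠ 1 := by
      by_contra! h
      exact hx h
    have h : D.χ p x * ∑ h : H, D.χ h x = ∑ h : H, D.χ h x := by
      rw [Finset.mul_sum]
      refine Fintype.sum_equiv (Equiv.addLeft (⟨p, hp⟩ : H)) _ _ fun h => ?_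
      simp [D.χ_add_left]
    have h2 : (D.χ p x - 1) * ∑ h : H, D.χ h x = 0 := by rw [sub_mul, h]; ring
    exact (mul_eq_zero.1 h2).resolve_left (sub_ne_zero.2 hpx)

/-- The nontrivial half of the double annihilator theorem. The sum of `χ(p,x)⁻¹ χ(h,x)` over `x ∈ G`
and `h ∈ H` is computed twice. Summing over `x` first gives `0` if `p ∉ H`; summing over `h` first
gives `|H|` times the order of the annihilator, since `χ(p,x) = 1` there. -/
theorem mem_of_chi_annihilator_eq_one {H : AddSubgroup G} {p : G} (h : ∀ l ∈ annihilator D H, D.χ p l = 1) :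
    p ∈ H := by
  classical
  by_contra hp
  have h1 : ∑ x, (D.χ p x)⁻¹ * ∑ h : H, D.χ h x = 0 := by
    simp only [Finset.mul_sum]
    rw [Finset.sum_comm]
    refine Finset.sum_eq_zero fun q _ => ?_
    have : ∀ x, (D.χ p x)⁻¹ * D.χ q x = D.χ x (q - p) := fun x => by
      rw [D.χ_symm x, chi_sub_left, mul_comm]
    simp only [this, sum_chi, sub_eq_zero]
    refine if_neg fun h => hp ?_
    rw [← h]
    exact q.2
  have h2 : ∑ x, (D.χ p x)⁻¹ * ∑ h : H, D.χ h x =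
      ∑ x, if x ∈ annihilator D H then (Fintype.card H : ℂ) else 0 := by
    refine Finset.sum_congr rfl fun x _ => ?_
    rw [sum_subgroup_chi]
    split_ifs with hx
    · rw [h x hx, inv_one, one_mul]
    · rw [mul_zero]
  rw [h2, ← Finset.sum_filter, Finset.sum_const, nsmul_eq_mul, mul_eq_zero] at h1
  rcases h1 with h1 | h1
  · rw [Nat.cast_eq_zero, Finset.card_eq_zero] at h1
    have : (0 : G) ∈ Finset.univ.filter (· ∈ annihilator D H) := by simp [zero_mem]
    simp [h1] at this
  · exact Fintype.card_ne_zero (Nat.cast_eq_zero.1 h1)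

/-! ### The fibers of an invariant coideal. -/

/-- The vector `∑_k χ(p,k) v^0_k` of `H^0`. -/
noncomputable def charVector (p : G) : Idx G (some 0) → ℂ
  | .pt k => D.χ p k
  | .pm => 0

theorem charVector_pt (p k : G) : charVector D p (.pt k) = D.χ p k := rfl
theorem charVector_pm (p : G) : charVector D p .pm = 0 := rfl

/-- The vector `v^p_m` of `H^p`. -/
def pmVector (p : G) : Idx G (some p) → ℂ
  | .pt _ => 0
  | .pm => 1

theorem pmVector_pt (p k : G) : pmVector p (.pt k) = 0 := rfl
theorem pmVector_pm (p : G) : pmVector p .pm = 1 := rfl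

variable {D} {I : StarSubalgebra ℂ (Alg D)}

theorem adjointAction_mem (hinv : IsInvariant I) {b : Alg D} (hb : b ∈ I) (y : Alg D) : adjointAction b y ∈ I := by
  have : adjointAction b y ∈ Subalgebra.toSubmodule I.toSubalgebra := by
    rw [← hinv]
    exact Submodule.subset_span ⟨b, hb, y, rfl⟩
  exact this

/-- Uses the inclusion `I ⊆ I ◁ B`: every element of `I` is a combination of values of the adjoint
action, which are supported on loops. The inclusion `I ◁ B ⊆ I` enters through `adjointAction_mem`.
-/
theorem cf_eq_zero_of_mem (hinv : IsInvariant I) {b : Alg D} (hb : b ∈ I) {z : Option G} (μ ν : Idx G z)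
    (h : src μ ≠ tgt μ) : cf D b z μ ν = 0 := by
  have hb' : b ∈ Submodule.span ℂ {c : Alg D | ∃ b ∈ I, ∃ x : Alg D, c = adjointAction b x} := by
    rw [hinv]; exact hb
  have : Submodule.span ℂ {c : Alg D | ∃ b ∈ I, ∃ x : Alg D, c = adjointAction b x} ≤
      LinearMap.ker (coefficient D z μ ν) := by
    rw [Submodule.span_le]
    rintro _ ⟨a, _, y, rfl⟩
    exact cf_adjointAction_eq_zero D a y μ ν h
  exact this hb'

theorem eq_zero_of_mem_fiber (hinv : IsInvariant I) {x : Option G} {v : Idx G x → ℂ} (hv : v ∈ fiber I x)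
    {α : Idx G x} (h : src α ≠ tgt α) : v α = 0 := by
  have := cf_eq_zero_of_mem hinv (hv α) α α h
  rwa [cf_column_self, if_pos rfl] at this

theorem pmVector_mem_fiber (hI : IsCoideal I) {p : G} : pmVector p ∈ fiber I (some p) ↔ f D (some p) .pm .pm ∈ I := by
  have h : ∀ γ, column D (some p) γ (pmVector p) = f D (some p) .pm γ := fun γ => by
    simp [column, sum_some, pmVector]
  constructor
  · intro hv
    have := hv .pm
    rwa [h] at this
  · intro hf
    convert cf_mem_fiber hI hf (some p) .pm
    rename_i α
    cases α <;> simp [pmVector, cf_f_vec, vec]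

theorem mem_fiber_none (hinv : IsInvariant I) (v : Idx G none → ℂ) : v ∈ fiber I none ↔ v = 0 := by
  refine ⟨fun hv => funext fun α => eq_zero_of_mem_fiber hinv hv ?_, fun h => h ▸ zero_mem _⟩
  cases α <;> simp [src, tgt]

/-- Such a vector is a scalar multiple of `v^p_m`, so only the vanishing of the scalar matters. -/
theorem mem_fiber_of_pt_eq_zero (hI : IsCoideal I) {p : G} {v : Idx G (some p) → ℂ} (h : ∀ k, v (.pt k) = 0) :
    v ∈ fiber I (some p) ↔ (v .pm ≠ 0 → f D (some p) .pm .pm ∈ I) := by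
  have hv : v = v .pm • pmVector p := by
    funext α
    cases α <;> simp [pmVector, h]
  rw [← pmVector_mem_fiber hI]
  constructor
  · intro h1 h2
    rw [hv] at h1
    exact (Submodule.smul_mem_iff _ h2).1 h1
  · intro h1
    rw [hv]
    by_cases h2 : v .pm = 0
    · rw [h2, zero_smul]; exact zero_mem _
    · exact Submodule.smul_mem _ _ (h1 h2)

theorem mem_fiber_some_of_ne (hI : IsCoideal I) (hinv : IsInvariant I) {p : G} (hp : p ≠ 0)
    (v : Idx G (some p) → ℂ) :
    v ∈ fiber I (some p) ↔ (∀ k, v (.pt k) = 0) ∧ (v .pm ≠ 0 → f D (some p) .pm .pm ∈ I) := by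
  constructor
  · intro hv
    have h : ∀ k, v (.pt k) = 0 := fun k => eq_zero_of_mem_fiber hinv hv (by simp [src, tgt, hp])
    exact ⟨h, (mem_fiber_of_pt_eq_zero hI h).1 hv⟩
  · rintro ⟨h, h'⟩
    exact (mem_fiber_of_pt_eq_zero hI h).2 h'

/-- Acting with `f^m_{0,0}` on `v`, placed in column `0`, gives an element of `I` whose coordinate
at `f^p_{mm}` is the Fourier coefficient. For `p ≠ 0` the fiber over `p` contains at most multiples
of `v^p_m`, so a nonzero coordinate there forces `f^p_{mm} ∈ I`. For `p = 0` this argument fails. -/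
theorem f_pm_mem_of_fourierCoeff_ne_zero (hI : IsCoideal I) (hinv : IsInvariant I) {v : Idx G (some 0) → ℂ}
    (hv : v ∈ fiber I (some 0)) {p : G} (hp : p ≠ 0) (h : fourierCoeff D (fun k => v (.pt k)) p ≠ 0) :
    f D (some p) .pm .pm ∈ I := by
  have h1 := adjointAction_mem hinv (hv (.pt 0)) (f D none (.el 0) (.el 0))
  have h2 := ((mem_fiber_some_of_ne hI hinv hp _).1 (cf_mem_fiber hI h1 (some p) .pm)).2
  refine h2 ?_
  have h3 := mm_adjointAction_el D (column D (some 0) (.pt 0) v) p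
  simp only [Alg.tt, cf_column_self, if_true] at h3
  change Alg.mm D _ p ≠ 0
  rw [h3]
  exact h

/-- The character is column `0` of `f^p_{mm} ◁ f^m_{0̄,0̄}` in the block of `H^0`. -/
theorem charVector_mem_fiber (hI : IsCoideal I) (hinv : IsInvariant I) {p : G} (hp : f D (some p) .pm .pm ∈ I) :
    charVector D p ∈ fiber I (some 0) := by
  have h1 := adjointAction_mem hinv hp (f D none (.bar 0) (.bar 0))
  convert cf_mem_fiber hI h1 (some 0) (.pt 0) using 1
  funext α
  cases α with
  | pt k =>
    refine Eq.trans ?_ (tt_adjointAction_bar D (f D (some p) .pm .pm) k).symm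
    simp [charVector_pt, mm_f_pm]
  | pm => exact (mt_adjointAction_bar D p).symm

/-- The subgroup of all `p` with `v^p_m ∈ X^p`. -/
def pmSubgroup (I : StarSubalgebra ℂ (Alg D)) (h0 : f D (some 0) .pm .pm ∈ I) : AddSubgroup G where
  carrier := {p | f D (some p) .pm .pm ∈ I}
  zero_mem' := h0
  add_mem' ha hb := by
    rw [Set.mem_setOf_eq, ← f_pm_mul_f_pm]
    exact mul_mem ha hb
  neg_mem' ha := by
    rw [Set.mem_setOf_eq, ← star_f_pm]
    exact star_mem ha

theorem eq_sum_charVector (v : Idx G (some 0) → ℂ) :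
    v = ∑ p, fourierCoeff D (fun k => v (.pt k)) p • charVector D p + v .pm • pmVector 0 := by
  funext α
  cases α with
  | pt k =>
    rw [Pi.add_apply, Finset.sum_apply]
    refine (sum_chi_mul_fourierCoeff D (fun k => v (.pt k)) k).symm.trans ?_
    simp [charVector_pt, pmVector_pt, mul_comm]
  | pm => simp [charVector_pm, pmVector_pm]

/-- Both conditions say that the Fourier support of `v` on `G` lies in `pmSubgroup I h0`. The value
at `m` is free because `v^0_m` itself belongs to the fiber. -/
theorem mem_fiber_zero_of_pm_mem (hI : IsCoideal I) (hinv : IsInvariant I) (h0 : f D (some 0) .pm .pm ∈ I)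
    (v : Idx G (some 0) → ℂ) : v ∈ fiber I (some 0) ↔
      ∀ h k, h - k ∈ annihilator D (pmSubgroup I h0) → v (.pt h) = v (.pt k) := by
  constructor
  · intro hv h k hl
    rw [← sum_chi_mul_fourierCoeff D (fun k => v (.pt k)) h, ← sum_chi_mul_fourierCoeff D (fun k => v (.pt k)) k]
    refine Finset.sum_congr rfl fun p _ => ?_
    by_cases hc : fourierCoeff D (fun k => v (.pt k)) p = 0
    · rw [hc, mul_zero, mul_zero]
    · have hp : p ∈ pmSubgroup I h0 := by
        -- The frequency `0`, not covered by the Fourier argument, belongs to the subgroup by `h0`.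
        by_cases hp : p = 0
        · exact hp ▸ zero_mem _
        · exact f_pm_mem_of_fourierCoeff_ne_zero hI hinv hv hp hc
      have := hl p hp
      rw [chi_sub_right, mul_inv_eq_one₀ (chi_ne_zero D p k)] at this
      rw [this]
  · intro hv
    rw [eq_sum_charVector (D := D) v]
    refine add_mem (sum_mem fun p _ => ?_) (Submodule.smul_mem _ _ ((pmVector_mem_fiber hI).2 h0))
    by_cases hp : p ∈ pmSubgroup I h0
    · exact Submodule.smul_mem _ _ (charVector_mem_fiber hI hinv hp)
    -- By double annihilation, a frequency outside the subgroup is detected by some `l` in the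
    -- annihilator; `v` is `l`-periodic, so its coefficient at `p` vanishes.
    · obtain ⟨l, hl, hpl⟩ : ∃ l ∈ annihilator D (pmSubgroup I h0), D.χ p l ≠ 1 := by
        by_contra! h
        exact hp (mem_of_chi_annihilator_eq_one D h)
      rw [fourierCoeff_eq_zero D (fun e => hv (e + l) e (by simpa using hl)) hpl, zero_smul]
      exact zero_mem _

/-- `(f^p_{mm})* f^p_{mm} = f^0_{mm}`, so a single `p` would already bring in `p = 0`. -/
theorem f_pm_notMem (h0 : f D (some 0) .pm .pm ∉ I) (p : G) : f D (some p) .pm .pm ∉ I := by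
  intro hp
  apply h0
  have := mul_mem (star_mem hp) hp
  rwa [star_f_pm, f_pm_mul_f_pm, neg_add_cancel] at this

/-- The constant vector is a column of `1 ∈ I`. Conversely all coefficients at `p ≠ 0` must vanish,
so `v` is constant on `G`, and the value at `m` has to agree as well. -/
theorem mem_fiber_zero_of_pm_notMem (hI : IsCoideal I) (hinv : IsInvariant I) (h0 : f D (some 0) .pm .pm ∉ I)
    (v : Idx G (some 0) → ℂ) : v ∈ fiber I (some 0) ↔ ∀ α γ, v α = v γ := by
  have h1 : (fun _ => 1 : Idx G (some 0) → ℂ) ∈ fiber I (some 0) := by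
    simpa [cf_one] using cf_mem_fiber hI (one_mem I) (some 0) .pm
  constructor
  · intro hv
    have hc : ∀ k, v (.pt k) = fourierCoeff D (fun k => v (.pt k)) 0 := by
      intro k
      rw [← sum_chi_mul_fourierCoeff D (fun k => v (.pt k)) k, Finset.sum_eq_single 0]
      · rw [chi_zero_left, one_mul]
      · intro p _ hp
        rw [mul_eq_zero]
        right
        by_contra hc
        exact f_pm_notMem h0 p (f_pm_mem_of_fourierCoeff_ne_zero hI hinv hv hp hc)
      · simp
    set c := fourierCoeff D (fun k => v (.pt k)) 0
    -- Subtracting the constant leaves a multiple of `v^0_m`; a nonzero multiple would put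
    -- `f^0_{mm}` in `I`.
    have hw := sub_mem hv (Submodule.smul_mem _ c h1)
    rw [mem_fiber_of_pt_eq_zero hI (by simp [hc])] at hw
    have hm : v .pm = c := by
      by_contra hne
      exact h0 (hw (by simpa [sub_eq_zero] using hne))
    have : ∀ α, v α = c := by
      intro α
      cases α
      · exact hc _
      · exact hm
    intro α γ
    rw [this α, this γ]
  · intro h
    have : v = v .pm • fun _ => 1 := by
      funext α
      simp [h α .pm]
    rw [this]
    exact Submodule.smul_mem _ _ h1

/-! ### Existence and uniqueness of the quantum subgroupoid. -/

theorem exists_eq_quotientTypeCoideal (hI : IsCoideal I) (hinv : IsInvariant I) :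
    ∃ x : WithTop (AddSubgroup G), (I : Set (Alg D)) = quotientTypeCoideal (quantumSubgroupoid D x) := by
  by_cases h0 : f D (some 0) .pm .pm ∈ I
  · refine ⟨(annihilator D (pmSubgroup I h0) : AddSubgroup G), Set.ext fun b => ?_⟩
    rw [mem_quotientTypeCoideal_coe, SetLike.mem_coe, mem_iff_fiber hI]
    refine forall_congr' fun y => forall_congr' fun β => ?_
    generalize (fun α => cf D b y α β) = v
    rcases y with _ | p
    · exact mem_fiber_none hinv v
    · by_cases hp : p = 0
      · subst hp
        rw [mem_fiber_zero_of_pm_mem hI hinv h0]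
        simp [IsSubgroupVector, chi_zero_left]
      · rw [mem_fiber_some_of_ne hI hinv hp]
        simp only [IsSubgroupVector, hp, ne_eq, not_false_eq_true, forall_const, false_implies, true_and]
        refine and_congr_right fun _ => imp_congr_right fun _ => ⟨fun h l hl => hl p h, fun h => ?_⟩
        -- The clause of `I^L` at `v^p_m` speaks of the annihilator of `L`; with `L` itself an
        -- annihilator, double annihilation returns the original subgroup.
        exact mem_of_chi_annihilator_eq_one D h
  · refine ⟨⊤, Set.ext fun b => ?_⟩
    rw [mem_quotientTypeCoideal_top, SetLike.mem_coe, mem_iff_fiber hI]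
    refine forall_congr' fun y => forall_congr' fun β => ?_
    generalize hv : (fun α => cf D b y α β) = v
    simp only [show ∀ γ, cf D b y γ β = v γ from fun γ => congrFun hv γ]
    rcases y with _ | p
    · rw [mem_fiber_none hinv v]
      constructor
      · rintro rfl; simp
      · intro h; exact funext (h.1 (by simp))
    · by_cases hp : p = 0
      · subst hp
        rw [mem_fiber_zero_of_pm_notMem hI hinv h0]
        exact ⟨fun h => ⟨fun h' => absurd rfl h', h⟩, fun h => h.2⟩
      · rw [mem_fiber_some_of_ne hI hinv hp]
        constructor
        · rintro ⟨h1, h2⟩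
          have hm : v .pm = 0 := by
            by_contra hm
            exact f_pm_notMem h0 p (h2 hm)
          have : ∀ α, v α = 0 := by
            intro α
            cases α
            · exact h1 _
            · exact hm
          simp [this]
        · rintro ⟨h, -⟩
          have := h (by simpa using hp)
          simp [this]

open scoped Classical in
/-- The indicator function of `L`, as a vector of `H^0`. -/
noncomputable def indicatorVector (L : AddSubgroup G) : Idx G (some 0) → ℂ
  | .pt k => if k ∈ L then 1 else 0
  | .pm => 0

open scoped Classical in
theorem indicatorVector_pt (L : AddSubgroup G) (k : G) :
    indicatorVector L (.pt k) = if k ∈ L then 1 else 0 := rfl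

/-- The indicator of `L` is constant on the cosets of `M` exactly when `M ≤ L`. Thus `I^M` knows
which subgroups contain `M`, and hence `M` itself. -/
theorem column_indicatorVector_mem (L M : AddSubgroup G) :
    column D (some 0) .pm (indicatorVector L) ∈ quotientTypeCoideal (quantumSubgroupoid D (M : WithTop (AddSubgroup G))) ↔
      M ≤ L := by
  rw [mem_quotientTypeCoideal_coe]
  classical
  constructor
  · intro h l hl
    -- Comparison of the values at `l ∈ M` and at `0`, where the indicator is `1`.
    have := (h (some 0) .pm).2.1 rfl l 0 (by simpa using hl)
    simpa [cf_column_self, indicatorVector_pt, zero_mem] using this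
  · intro h x β
    by_cases hx : x = some 0
    · subst hx
      refine ⟨fun h => absurd rfl h, fun _ a k hl => ?_, fun _ l _ => chi_zero_left D l⟩
      have : a ∈ L ↔ k ∈ L := by
        have := h hl
        constructor
        · intro ha; simpa using sub_mem ha this
        · intro hk; simpa using add_mem this hk
      simp [cf_column_self, indicatorVector_pt, this]
    · have : (fun α => cf D (column D (some 0) .pm (indicatorVector L)) x α β) = 0 :=
        funext fun α => cf_column_of_ne D (Ne.symm hx) _ _ _ _
      rw [this]
      rcases x with _ | p <;> simp [IsSubgroupVector]

/-- `f^0_{mm}` separates them: in every `I^L` the entry at `m` is unconstrained over `x = 0`,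
whereas in `I^Ω` it must equal the entries at `G`. -/
theorem quotientTypeCoideal_coe_ne_top (L : AddSubgroup G) :
    quotientTypeCoideal (quantumSubgroupoid D (L : WithTop (AddSubgroup G))) ≠
      quotientTypeCoideal (quantumSubgroupoid D ⊤) := by
  intro h
  have h1 : f D (some 0) .pm .pm ∈ quotientTypeCoideal (quantumSubgroupoid D (L : WithTop (AddSubgroup G))) := by
    rw [mem_quotientTypeCoideal_coe]
    intro x β
    rcases x with _ | p
    · exact funext fun α => by rw [cf_f, if_neg (fun h => by cases h)]; rfl
    · refine ⟨fun hp k => ?_, fun hp a k _ => ?_, fun hp l _ => ?_⟩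
      · simp [cf_f_vec, vec]
      · simp [cf_f_vec, vec]
      · have : 0 = p := by
          by_contra h
          exact hp (by simp [cf_f_vec, vec, h])
        rw [← this, chi_zero_left]
  rw [h, mem_quotientTypeCoideal_top] at h1
  simpa [cf_f_vec, vec] using (h1 (some 0) .pm).2 .pm (.pt 0)

theorem quotientTypeCoideal_injective :
    Function.Injective fun x : WithTop (AddSubgroup G) => quotientTypeCoideal (quantumSubgroupoid D x) := by
  intro x y h
  induction x using WithTop.recTopCoe with
  | top =>
    induction y using WithTop.recTopCoe with
    | top => rfl
    | coe M => exact absurd h.symm (quotientTypeCoideal_coe_ne_top M)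
  | coe L =>
    induction y using WithTop.recTopCoe with
    | top => exact absurd h (quotientTypeCoideal_coe_ne_top L)
    | coe M =>
      have h' : ∀ b, b ∈ quotientTypeCoideal (quantumSubgroupoid D (L : WithTop (AddSubgroup G))) ↔
        b ∈ quotientTypeCoideal (quantumSubgroupoid D (M : WithTop (AddSubgroup G))) := fun b => Set.ext_iff.1 h b
      refine congrArg _ (le_antisymm ?_ ?_)
      · rw [← column_indicatorVector_mem (D := D), h', column_indicatorVector_mem]
      · rw [← column_indicatorVector_mem (D := D), ← h', column_indicatorVector_mem]

end TambaraYamagami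

theorem proposition5p7 {G : Type u} [AddCommGroup G] [Fintype G] [DecidableEq G]
    (D : TambaraYamagami.Datum G) (I : StarSubalgebra ℂ (TambaraYamagami.Alg D))
    (hI : WeakHopfCStarAlgebra.IsCoideal I) (hinv : WeakHopfCStarAlgebra.IsInvariant I) :
    (∃ X : (y : Option G) → Submodule ℂ (TambaraYamagami.Idx G y → ℂ),
      (I : Set (TambaraYamagami.Alg D)) =
        {b | ∀ y β, (fun α => TambaraYamagami.cf D b y α β) ∈ X y}) ∧
    ∃! x : WithTop (AddSubgroup G),
      (I : Set (TambaraYamagami.Alg D)) =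
        WeakHopfCStarAlgebra.quotientTypeCoideal (TambaraYamagami.quantumSubgroupoid D x) := by
  refine ⟨⟨TambaraYamagami.fiber I, Set.ext fun b => TambaraYamagami.mem_iff_fiber hI b⟩, ?_⟩
  obtain ⟨x, hx⟩ := TambaraYamagami.exists_eq_quotientTypeCoideal hI hinv
  exact ⟨x, hx, fun y hy => TambaraYamagami.quotientTypeCoideal_injective (hy.symm.trans hx)⟩
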